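/- **Setting.** For a nonzero ideal $I\subset\mathbb C[[x,y]]$ let $\Delta(I)\subset\mathbb R^2$ be the convex hull of $\bigcup_{f\in I}\operatorname{Supp} f+\mathbb R_{\ge 0}^2$. Its compact one-dimensional faces $S_1,\dots,S_m$, ordered from top to bottom, are called the faces of the Newton polygon. The line supporting a face $S$ is written $p_S\alpha+q_S\beta=N_S$ with $p_S,q_S\ge 1$ coprime. Let $\mathrm{in}(I,S)$ be the ideal generated by the parts of the $f\in I$ supported on this line. It has the form $$\mathrm{in}(I,S)=x^{a}y^{b}F_S(x^{q_S},y^{p_S})\,\bigl(k_1(x^{q_S},y^{p_S}),\dots,k_s(x^{q_S},y^{p_S})\bigr),$$ with $F_S$ homogeneous, monic in $y$, divisible neither by $x$ nor by $y$, and with $k_1,\dots,k_s$ coprime and homogeneous of the same degree $d_S\ge 0$. The face is dicritical if $d_S\ge 1$. For a root $\mu$ of $F_S(1,X)$, let $I_{S,\mu}$ be the ideal generated by the image of $I$ under $f\mapsto f(\mu^{q'}x^{p},x^{q}(y+\mu^{p'}))$, where $(p,q)=(p_S,q_S)$ and $p',q'\ge 0$ satisfy $pp'-qq'=1$, $p'\le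 q$, $q'<p$. The ideal $I$ has depth zero if $I=(x^k(y+h(x))^\nu)$ for some $k,\nu\ge 0$ and $h\in x\mathbb C[[x]]$. **Newton tree.** If $I=(x^k(y+h)^\nu)$ has depth zero, its Newton tree is one edge joining a top arrow decorated with $k$ and a bottom arrow decorated with $\nu$. Otherwise, take a vertical chain of vertices $v_1,\dots,v_m$ representing $S_1,\dots,S_m$. It is completed by an edge to a top arrow, decorated with the minimal $\alpha$ on $\Delta(I)$, and an edge to a bottom arrow, decorated with the minimal $\beta$ on $\Delta(I)$. The vertex of $S$ is decorated with $(N_S,d_S)$, the edge above it with $q_S$ and the edge below it with $p_S$ (near the vertex). For each root $\mu$ of $F_S(1,X)$ one takes the Newton tree of $I_{S,\mu}$, deletes its top arrow (which is decorated with $N_S$), and glues its top edge, as a horizontal edge, on the vertex of $S$. In this gluing, the decoration $q$ above a vertex $w$ of the glued tree, with decorations $(q,p)$, becomes $q+p_Sq_S\,p_1^2\cdots p_j^2\,p$, where $p_1,\dots,p_j$ are the decorations $p$ of the successive preceding vertices of $w$ inside the glued tree (the preceding vertex of a vertex is the one on which its Newton polygon stage has been glued). A vertex with decorations $(N_v,d_v)$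 is dicritical if $d_v\ge 1$; in the tree of a principal ideal all $d_v$ are $0$. An *extended Newton tree* of $I$ is a tree obtained in the same way, except that the construction need not stop at an ideal of depth zero: at such an ideal one may also perform the general step. For a decorated tree $T$, its *contraction* is obtained as follows. Working from the ends of the tree inwards, whenever a stage consists of a single vertex with $p=1$ and $d=0$, with bottom arrow decorated with $0$, on which exactly one horizontal edge is glued and this edge ends in an arrow decorated with some $\nu$, the vertex and everything below and to the right of it is replaced by an arrow decorated with $\nu$. **Proposition.** Let $I=(f_1,\dots,f_r)$ be a non-principal ideal of $\mathbb C[[x,y]]$. Then the construction of the Newton tree of $I$ terminates; let $T$ be this tree (horizontal edges at a vertex are listed in an arbitrary order). Let $T^+$ be the tree obtained from $T$ by attaching to each dicritical vertex $v$ exactly $d_v$ arrows decorated with $1$ (multiplicity one) and replacing each decoration $(N_v,d_v)$ by $(N_v,0)$, all edge decorations, all decorations $N_v$ and all decorations of the existing arrows being unchanged. Then for generic $\lambda=(\lambda_1,\dots,\lambda_r)\in\mathbb C^r$ (outside the zero set of some nonzero polynomial) the curve $f=\lambda_1f_1+\dots+\lambda_rf_r$ satisfies: 1. $T^+$ is an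 extended Newton tree of the ideal $(f)$; 2. the Newton tree of $(f)$ is the contraction of $T^+$; in particular it is $T^+$ itself if no vertex of $T^+$ is contracted. -/

import Mathlib

namespace NewtonTrees

/-- The ring `ℂ[[x, y]]`; the variable `x` is `X 0` and the variable `y` is `X 1`. A monomial
`x ^ α * y ^ β` is given by its exponent `m : Fin 2 →₀ ℕ` with `m 0 = α` and `m 1 = β`. -/
abbrev PS : Type := MvPowerSeries (Fin 2) ℂ

/-! ### Newton diagrams, faces, initial ideals -/

/-- The union of the supports of the elements of `I`. Adding the quadrant to it gives the same set
as adding the quadrant to the union of the supports of any system of generators. -/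
def idealSupport (I : Ideal PS) : Set (Fin 2 →₀ ℕ) :=
  {m | ∃ f ∈ I, MvPowerSeries.coeff m f ≠ 0}

/-- The Newton diagram `Δ(I)`: the convex hull of (support of `I`) + (closed first quadrant). -/
def newtonDiagram (I : Ideal PS) : Set (ℝ × ℝ) :=
  convexHull ℝ {z | ∃ m ∈ idealSupport I, (m 0 : ℝ) ≤ z.1 ∧ (m 1 : ℝ) ≤ z.2}

/-- `p α + q β = N`, with `p, q` positive and coprime, is the equation of the line supporting a
face of the Newton polygon of `I`, that is, a compact one-dimensional face of `Δ(I)`. -/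
def IsFace (I : Ideal PS) (p q N : ℕ) : Prop :=
  0 < p ∧ 0 < q ∧ Nat.Coprime p q ∧
    (∀ z ∈ newtonDiagram I, (N : ℝ) ≤ p * z.1 + q * z.2) ∧
    {z | z ∈ newtonDiagram I ∧ (p : ℝ) * z.1 + q * z.2 = N}.Nontrivial

/-- The abscissa `α₀` of the vertical non-compact face of `Δ(I)`. -/
noncomputable def topOrder (I : Ideal PS) : ℕ := sInf ((fun m => m 0) '' idealSupport I)

/-- The ordinate `βₘ` of the horizontal non-compact face of `Δ(I)`. -/
noncomputable def bottomOrder (I : Ideal PS) : ℕ := sInf ((fun m => m 1) '' idealSupport I)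

/-- The initial part of `f` with respect to the line `p α + q β = N`. -/
noncomputable def initialPart (p q N : ℕ) (f : PS) : PS :=
  fun m => if p * m 0 + q * m 1 = N then MvPowerSeries.coeff m f else 0

/-- The ideal generated by the initial parts, with respect to the line `p α + q β = N`, of the
elements of `I`. When the line supports a face of the Newton polygon of `I`, the initial parts of
the members of any system of generators of `I` generate the same ideal. -/
noncomputable def initialIdeal (I : Ideal PS) (p q N : ℕ) : Ideal PS :=
  Ideal.span (initialPart p q N '' (I : Set PS))

/-- `G(x ^ q, y ^ p)` as a power series, for a polynomial `G` in two variables. -/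
noncomputable def substPow (p q : ℕ) (G : MvPolynomial (Fin 2) ℂ) : PS :=
  MvPolynomial.aeval (![MvPowerSeries.X 0 ^ q, MvPowerSeries.X 1 ^ p] : Fin 2 → PS) G

/-- A face of the Newton polygon of `I`, with supporting line `p α + q β = N`, together with
its face polynomial `F` and its degree `d`. They are defined by
`in(I, S) = x ^ a * y ^ b * F(x ^ q, y ^ p) * (k₁(x ^ q, y ^ p), …, kₛ(x ^ q, y ^ p))`, where `F` is
homogeneous, monic in `y` and divisible neither by `x` nor by `y`, and where the `kᵢ` are
homogeneous of the same degree `d` and have no common factor. One has `d = 0` exactly when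
`in(I, S)` is principal; the face is dicritical when `d > 0`. -/
structure Face (I : Ideal PS) where
  p : ℕ
  q : ℕ
  N : ℕ
  isFace : IsFace I p q N
  F : MvPolynomial (Fin 2) ℂ
  d : ℕ
  initial_eq : ∃ (a b e s : ℕ) (k : Fin s → MvPolynomial (Fin 2) ℂ),
    F.IsHomogeneous e ∧ F.coeff (Finsupp.single 1 e) = 1 ∧
    ¬ MvPolynomial.X 0 ∣ F ∧ ¬ MvPolynomial.X 1 ∣ F ∧
    (∀ i, (k i).IsHomogeneous d) ∧
    (∀ g : MvPolynomial (Fin 2) ℂ, (∀ i, g ∣ k i) → IsUnit g) ∧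
    initialIdeal I p q N =
      Ideal.span (Set.range fun i =>
        MvPowerSeries.X 0 ^ a * MvPowerSeries.X 1 ^ b * substPow p q F * substPow p q (k i))

/-! ### Newton maps -/

/-- The data of a Newton map `σ_(p, q, μ)`. The pair `(p', q')` is the one with
`p p' - q q' = 1`, `p' ≤ q` and `q' < p`; it is determined by `(p, q)`, and `p, q` are coprime. -/
structure NewtonMap where
  p : ℕ
  q : ℕ
  p' : ℕ
  q' : ℕ
  μ : ℂ
  p_pos : 0 < p
  q_pos : 0 < q
  bezout : p * p' = q * q' + 1
  p'_le : p' ≤ q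
  q'_lt : q' < p
  μ_ne : μ ≠ 0

namespace NewtonMap

/-- The pair `(μ ^ q' * x ^ p, x ^ q * (y + μ ^ p'))` substituted for `(x, y)`. -/
noncomputable def subs (σ : NewtonMap) : Fin 2 → PS :=
  ![MvPowerSeries.C (σ.μ ^ σ.q') * MvPowerSeries.X 0 ^ σ.p,
    MvPowerSeries.X 0 ^ σ.q * (MvPowerSeries.X 1 + MvPowerSeries.C (σ.μ ^ σ.p'))]

theorem hasSubst_subs (σ : NewtonMap) : MvPowerSeries.HasSubst σ.subs := by
  apply MvPowerSeries.hasSubst_of_constantCoeff_zero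
  intro i
  have hp := σ.p_pos.ne'
  have hq := σ.q_pos.ne'
  fin_cases i <;> simp [subs, hp, hq]

/-- The Newton map `f(x, y) ↦ f(μ ^ q' * x ^ p, x ^ q * (y + μ ^ p'))`. -/
noncomputable def toAlgHom (σ : NewtonMap) : PS →ₐ[ℂ] PS :=
  MvPowerSeries.substAlgHom σ.hasSubst_subs

/-- The ideal `I_σ` generated by the image of `I`. -/
noncomputable def mapIdeal (σ : NewtonMap) (I : Ideal PS) : Ideal PS :=
  I.map σ.toAlgHom

end NewtonMap

/-! ### Decorated trees -/

/-- What hangs below an edge of a Newton tree: either the edge ends with an arrow decorated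
with `m`, or it ends at a vertex. A vertex carries the decoration `q` on the edge above it, the
decoration `p` on the edge below it, the decorations `(N, d)` of the vertex itself, `n` horizontal
edges `horizontal j` glued on it, and the vertical edge below it. -/
inductive Branch : Type
  | arrow (m : ℕ) : Branch
  | vertex (q p N d n : ℕ) (horizontal : Fin n → Branch) (below : Branch) : Branch

namespace Branch

/-- The change of the edge decorations when a tree is glued on a vertex. The decoration `q` above
a vertex with decorations `(q, p)` becomes `q + c * p`; for the vertices whose preceding vertex is
this one, `c` is replaced by `c * p ^ 2`. Gluing on a vertex with decorations `(q₀, p₀)` is the case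
`c = p₀ * q₀`. -/
def shift : ℕ → Branch → Branch
  | _, arrow m => arrow m
  | c, vertex q p N d n h b =>
      vertex (q + c * p) p N d n (fun j => shift (c * p ^ 2) (h j)) (shift c b)

/-- Attach to each vertex decorated with `(N, d)` exactly `d` further arrows decorated with `1`, and
change `(N, d)` into `(N, 0)`, i.e. into the decoration `(N)`. Everything else is unchanged. -/
def addArrows : Branch → Branch
  | arrow m => arrow m
  | vertex q p N d n h b =>
      vertex q p N 0 (n + d) (Fin.append (fun j => addArrows (h j)) (fun _ => arrow 1))
        (addArrows b)

/-- Let the branch describe a whole stage (the graph of one Newton diagram with everything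
glued on it). If the stage consists of a single vertex, with `p = 1` and `d = 0`, with bottom arrow
decorated with `0`, on which just one horizontal edge is glued and this edge ends with an arrow
decorated with `ν`, it is replaced by an arrow decorated with `ν`. -/
def contractTop : Branch → Branch
  | vertex q 1 N 0 1 h (arrow 0) =>
      match h 0 with
      | arrow ν => arrow ν
      | vertex _ _ _ _ _ _ _ => vertex q 1 N 0 1 h (arrow 0)
  | b => b

/-- Apply `contractTop`, from the ends of the tree inwards, to all stages glued on the vertices of
a stage. -/
def contractInner : Branch → Branch
  | arrow m => arrow m
  | vertex q p N d n h b =>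
      vertex q p N d n (fun j => contractTop (contractInner (h j))) (contractInner b)

end Branch

/-- A Newton tree: the decoration of the top arrow, and what hangs below the top edge. -/
structure NewtonTree where
  top : ℕ
  branch : Branch

/-- Attach to each vertex decorated with `(N, d)` exactly `d` arrows decorated with `1`. -/
def NewtonTree.addArrows (T : NewtonTree) : NewtonTree := ⟨T.top, T.branch.addArrows⟩

/-- Contract all redundant vertices (see `Branch.contractTop`), from the ends inwards. -/
def NewtonTree.contract (T : NewtonTree) : NewtonTree :=
  ⟨T.top, T.branch.contractInner.contractTop⟩

/-! ### The Newton tree of an ideal -/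

/-- `h ∈ x ℂ[[x]]`. -/
def IsXSeries (h : PS) : Prop :=
  ∀ m : Fin 2 →₀ ℕ, MvPowerSeries.coeff m h ≠ 0 → m 1 = 0 ∧ m 0 ≠ 0

/-- `I` is generated by `x ^ k * (y + h(x)) ^ ν` with `h ∈ x ℂ[[x]]`. -/
def IsMonomialLike (I : Ideal PS) (k ν : ℕ) : Prop :=
  ∃ h : PS, IsXSeries h ∧
    I = Ideal.span {MvPowerSeries.X 0 ^ k * (MvPowerSeries.X 1 + h) ^ ν}

/-- `I` has depth zero. -/
def IsDepthZero (I : Ideal PS) : Prop := ∃ k ν : ℕ, IsMonomialLike I k ν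

/-- The trees produced by the Newton algorithm. `IsTreeOf cont I t B` says that the tree with top
arrow decorated with `t` and with branch `B` is produced from the nonzero ideal `I`. The algorithm
can only stop at an ideal of depth zero, and can only go on at an ideal satisfying `cont`.

In a step, `S 0, …, S (m - 1)` are all the faces of the Newton polygon of `I`, from top to bottom,
and the `σ i j` are, without repetition, all the Newton maps `σ_(pᵢ, qᵢ, μ)` with `μ` a root of the
face polynomial of `S i`. The tree of `I_σ`, `σ = σ i j`, has a top arrow decorated with `Nᵢ`; this
arrow is deleted and its edge is glued on the vertex of the face `S i`. -/
inductive IsTreeOf (cont : Ideal PS → Prop) : Ideal PS → ℕ → Branch → Prop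
  | halt (I : Ideal PS) (k ν : ℕ) (hI : IsMonomialLike I k ν) :
      IsTreeOf cont I k (Branch.arrow ν)
  | step (I : Ideal PS) (hI : cont I)
      (m : ℕ) (S : Fin m → Face I)
      (sorted : ∀ i j, i < j → (S i).q * (S j).p < (S j).q * (S i).p)
      (complete : ∀ p q N, IsFace I p q N → ∃ i, (S i).p = p ∧ (S i).q = q ∧ (S i).N = N)
      (n : Fin m → ℕ) (σ : (i : Fin m) → Fin (n i) → NewtonMap)
      (injective : ∀ i, Function.Injective (σ i))
      (range_eq : ∀ i, Set.range (σ i) =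
        {τ | τ.p = (S i).p ∧ τ.q = (S i).q ∧ MvPolynomial.eval ![1, τ.μ] (S i).F = 0})
      (B : (i : Fin m) → Fin (n i) → Branch)
      (glued : ∀ i j, IsTreeOf cont ((σ i j).mapIdeal I) (S i).N (B i j)) :
      IsTreeOf cont I (topOrder I)
        (Fin.foldr m
          (fun i b => Branch.vertex (S i).q (S i).p (S i).N (S i).d (n i)
            (fun j => (B i j).shift ((S i).p * (S i).q)) b)
          (Branch.arrow (bottomOrder I)))

/-- `T` is the Newton tree of `I` (unique up to the order in which the horizontal edges at a vertex
are listed): the algorithm stops as soon as it reaches an ideal of depth zero. -/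
def IsNewtonTree (I : Ideal PS) (T : NewtonTree) : Prop :=
  IsTreeOf (fun J => ¬ IsDepthZero J) I T.top T.branch

/-- `T` is an extended Newton tree of `I`: the algorithm may be continued for some more steps at
ideals of depth zero. -/
def IsExtendedNewtonTree (I : Ideal PS) (T : NewtonTree) : Prop :=
  IsTreeOf (fun _ => True) I T.top T.branch

end NewtonTrees

/-! Let `g = ∑ cᵢ fᵢ` with `c` generic. The Newton algorithm for `(g)` shadows the algorithm for
`I`, stage by stage. The tree of `I` is finite, so only finitely many nonempty open conditions on
`c` arise.

One stage. The diagram `Δ(I)` is determined by its finitely many minimal exponents, and `g` has the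
same ones as soon as finitely many nonzero linear forms in `c` do not vanish
(`exists_generic_idealSupport`). So `I` and `(g)` have the same faces and the same end arrows. On a
face, the initial parts of the `fᵢ` are `x^a y^b F kᵢ`, with `kᵢ` of degree `d` and without common
factor (`NormalForm`), evaluated at `(x^q, y^p)`. Hence the initial part of `g` is `x^a y^b F K`
with `K = ∑ cᵢ kᵢ`. A Bertini argument in one variable (`generic_separable`) shows that `K(1, X)`
has `d` simple nonzero roots, none of them a root of `F(1, X)`. The roots of `F` give the Newton
maps already used for `I`. These are linear, so the transform of `g` is the same combination of the
transformed generators, and induction applies. At a root of `K` the transform of `g` is `x^N` times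
a series of order one in `y`, which the implicit function theorem turns into `x^N (y + h)` up to a
unit: an arrow decorated with `1`. There are `d` of these (`exists_face_combination`,
`trees_of_step`). At an ideal of depth zero, `g` generates the ideal (`generic_span_eq`).

Termination. The `height` is the ordinate of the upper vertex; for a transform it is the
multiplicity of the root, which never exceeds the height before. Equality forces `p = 1`, and then
the Newton map is a shear `y ↦ y + μ x^q` followed by `y ↦ x^q y`, which lowers by `q ≥ 1` any bound
on the contact with smooth curves `y = h(x)`. Such a bound exists unless the ideal has depth zero,
because approximating curves of unbounded contact converge (`exists_contactLT`). Induction on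
height, then on contact, gives `exists_isTreeOf`.

Contraction. `(g)` can have depth zero when `I` does not, as for `I = (x, y)`; the extended tree
then goes on past it. A depth-zero ideal with a face has one face, with `p = 1`, `d = 0`, one root
and bottom arrow `0`: the pattern that `contractTop` removes
(`contractTop_chain_of_isMonomialLike`). Conversely this pattern occurs only at depth zero, since
depth zero descends through a Newton map with `p = 1` that preserves the height
(`contractTop_chain_of_not_isDepthZero`). -/

namespace NewtonTrees

open MvPowerSeries

/-! ### Exponents and weight filtrations -/

/-- The exponent of the monomial `x ^ i * y ^ j`. -/
noncomputable def expo (i j : ℕ) : Fin 2 →₀ ℕ := Finsupp.single 0 i + Finsupp.single 1 j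

@[simp] theorem expo_apply_zero (i j : ℕ) : expo i j 0 = i := by simp [expo]

@[simp] theorem expo_apply_one (i j : ℕ) : expo i j 1 = j := by simp [expo]

theorem expo_ext {m m' : Fin 2 →₀ ℕ} (h0 : m 0 = m' 0) (h1 : m 1 = m' 1) : m = m' := by
  ext i; fin_cases i <;> assumption

theorem expo_eta (m : Fin 2 →₀ ℕ) : expo (m 0) (m 1) = m := expo_ext (by simp) (by simp)

theorem expo_zero_zero : expo 0 0 = 0 := expo_ext (by simp) (by simp)

theorem expo_add (i j i' j' : ℕ) : expo i j + expo i' j' = expo (i + i') (j + j') :=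
  expo_ext (by simp) (by simp)

/-- The ideal of the power series all of whose monomials have weight at least `W`, where `x` has
weight `a` and `y` has weight `b`. -/
def filtration (a b W : ℕ) : Ideal PS where
  carrier := {f | ∀ m, coeff m f ≠ 0 → W ≤ a * m 0 + b * m 1}
  zero_mem' := by intro m hm; simp at hm
  add_mem' := by
    intro f g hf hg m hm
    by_contra hlt
    have h1 : coeff m f = 0 := by by_contra h; exact hlt (hf m h)
    have h2 : coeff m g = 0 := by by_contra h; exact hlt (hg m h)
    exact hm (by simp [h1, h2])
  smul_mem' := by
    intro c f hf m hm
    rw [smul_eq_mul, coeff_mul] at hm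
    obtain ⟨x, hx, hne⟩ := Finset.exists_ne_zero_of_sum_ne_zero hm
    have hW := hf x.2 (right_ne_zero_of_mul hne)
    rw [Finset.HasAntidiagonal.mem_antidiagonal] at hx
    rw [← hx]
    simp only [Finsupp.add_apply]
    nlinarith [Nat.zero_le (a * x.1 0), Nat.zero_le (b * x.1 1)]

theorem coeff_eq_zero_of_mem_filtration {a b W : ℕ} {f : PS} (hf : f ∈ filtration a b W)
    {m : Fin 2 →₀ ℕ} (hm : a * m 0 + b * m 1 < W) : coeff m f = 0 := by
  by_contra h
  exact absurd (hf m h) (by omega)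

theorem filtration_anti {a b V W : ℕ} (h : V ≤ W) : filtration a b W ≤ filtration a b V :=
  fun _ hf m hm => h.trans (hf m hm)

theorem mul_mem_filtration {a b V W : ℕ} {f g : PS} (hf : f ∈ filtration a b V)
    (hg : g ∈ filtration a b W) : f * g ∈ filtration a b (V + W) := by
  intro m hm
  rw [coeff_mul] at hm
  obtain ⟨x, hx, hne⟩ := Finset.exists_ne_zero_of_sum_ne_zero hm
  have h1 := hf x.1 (left_ne_zero_of_mul hne)
  have h2 := hg x.2 (right_ne_zero_of_mul hne)
  rw [Finset.HasAntidiagonal.mem_antidiagonal] at hx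
  rw [← hx]
  simp only [Finsupp.add_apply]
  nlinarith

theorem mem_filtration_zero (a b : ℕ) (f : PS) : f ∈ filtration a b 0 := fun _ _ => Nat.zero_le _

theorem pow_mem_filtration {a b V : ℕ} {f : PS} (hf : f ∈ filtration a b V) (n : ℕ) :
    f ^ n ∈ filtration a b (V * n) := by
  induction n with
  | zero => exact mem_filtration_zero _ _ _
  | succ n ih => rw [pow_succ, Nat.mul_succ]; exact mul_mem_filtration ih hf

theorem X_zero_mem_filtration (a b : ℕ) : (X 0 : PS) ∈ filtration a b a := by
  classical
  intro m hm
  rw [coeff_X] at hm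
  split_ifs at hm with h
  · simp [h]
  · exact absurd rfl hm

theorem X_one_mem_filtration (a b : ℕ) : (X 1 : PS) ∈ filtration a b b := by
  classical
  intro m hm
  rw [coeff_X] at hm
  split_ifs at hm with h
  · simp [h]
  · exact absurd rfl hm

/-- Each monomial of weight at least `W` is sent to a product of weight at least `W`. All estimates
for shears and Newton maps are instances of this, for suitable weights. -/
theorem subst_mem_filtration {s : Fin 2 → PS} (hs : HasSubst s) {a b a' b' W : ℕ}
    (h0 : s 0 ∈ filtration a' b' a) (h1 : s 1 ∈ filtration a' b' b) {f : PS}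
    (hf : f ∈ filtration a b W) : subst s f ∈ filtration a' b' W := by
  intro m hm
  by_contra hlt
  apply hm
  rw [coeff_subst hs]
  apply finsum_eq_zero_of_forall_eq_zero
  intro d
  by_cases hd : coeff d f = 0
  · simp [hd]
  · have hW := hf d hd
    have : (d.prod fun i e => s i ^ e) ∈ filtration a' b' (a * d 0 + b * d 1) := by
      rw [Finsupp.prod_fintype _ _ (by simp), Fin.prod_univ_two]
      exact mul_mem_filtration (pow_mem_filtration h0 _) (pow_mem_filtration h1 _)
    rw [coeff_eq_zero_of_mem_filtration this (by omega), smul_zero]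

theorem coeff_X_zero_pow_mul (n i j : ℕ) (A : PS) :
    coeff (expo (n + i) j) (X 0 ^ n * A) = coeff (expo i j) A := by
  have : expo (n + i) j = Finsupp.single 0 n + expo i j := by
    apply expo_ext <;> simp
  rw [this, X_pow_eq, coeff_add_monomial_mul, one_mul]

theorem coeff_X_one_pow_mul (n i j : ℕ) (A : PS) :
    coeff (expo i (n + j)) (X 1 ^ n * A) = coeff (expo i j) A := by
  have : expo i (n + j) = Finsupp.single 1 n + expo i j := by
    apply expo_ext <;> simp
  rw [this, X_pow_eq, coeff_add_monomial_mul, one_mul]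

/-- With the degenerate weights `(1, 0)` and `(0, 1)` the filtrations are the powers of `(x)` and of
`(y)`, so divisibility is handled by the same weight lemmas. -/
theorem exists_eq_X_zero_pow_mul {n : ℕ} {f : PS} (hf : f ∈ filtration 1 0 n) :
    ∃ A, f = X 0 ^ n * A := by
  have : (X 0 : PS) ^ n ∣ f := by
    rw [X_pow_dvd_iff]
    intro m hm
    exact coeff_eq_zero_of_mem_filtration hf (by simpa using hm)
  exact this

theorem exists_eq_X_one_pow_mul {n : ℕ} {f : PS} (hf : f ∈ filtration 0 1 n) :
    ∃ A, f = X 1 ^ n * A := by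
  have : (X 1 : PS) ^ n ∣ f := by
    rw [X_pow_dvd_iff]
    intro m hm
    exact coeff_eq_zero_of_mem_filtration hf (by simpa using hm)
  exact this

/-! ### The implicit function theorem -/

/-- A power series of order one in `y` is associated to some `y + h(x)`. -/
theorem exists_isUnit_mul_eq_X_add {g : PS} (h00 : coeff (expo 0 0) g = 0)
    (h01 : coeff (expo 0 1) g ≠ 0) :
    ∃ u h : PS, IsUnit u ∧ IsXSeries h ∧ u * g = X 1 + h := by
  classical
  -- The unit `u` is built by recursion, solving for its coefficient at `(i, j)` so that the
  -- coefficient of `u * g` at `(i, j + 1)` is prescribed. That equation also involves coefficients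
  -- of `u` at `(i', j + 1)` with `i' < i`, hence the lexicographic order.
  let r : ℕ × ℕ → ℕ × ℕ → Prop := Prod.Lex (· < ·) (· < ·)
  have hr : WellFounded r := WellFounded.prod_lex wellFounded_lt wellFounded_lt
  let F : (x : ℕ × ℕ) → ((y : ℕ × ℕ) → r y x → ℂ) → ℂ := fun x rec =>
    ((if x = (0, 0) then 1 else 0) - ∑ z ∈ Finset.HasAntidiagonal.antidiagonal (expo x.1 (x.2 + 1)),
      if h : r (z.1 0, z.1 1) x then rec (z.1 0, z.1 1) h * coeff z.2 g else 0) /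
      coeff (expo 0 1) g
  let v : ℕ × ℕ → ℂ := hr.fix F
  have hv : ∀ x, v x * coeff (expo 0 1) g + ∑ z ∈ Finset.HasAntidiagonal.antidiagonal (expo x.1 (x.2 + 1)),
      (if r (z.1 0, z.1 1) x then v (z.1 0, z.1 1) * coeff z.2 g else 0) =
      if x = (0, 0) then 1 else 0 := by
    intro x
    have : v x = F x (fun y _ => v y) := hr.fix_eq F x
    rw [this]
    simp only [F]
    rw [div_mul_cancel₀ _ h01]
    simp
  let u : PS := fun m => v (m 0, m 1)
  have hu : ∀ m, coeff m u = v (m 0, m 1) := fun m => rfl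
  have key : ∀ i j, coeff (expo i (j + 1)) (u * g) = if (i, j) = (0, 0) then 1 else 0 := by
    intro i j
    rw [← hv (i, j), coeff_mul]
    have hmem : (expo i j, expo 0 1) ∈ Finset.HasAntidiagonal.antidiagonal (expo i (j + 1)) := by
      rw [Finset.HasAntidiagonal.mem_antidiagonal, expo_add]; simp
    rw [← Finset.add_sum_erase _ _ hmem, ← Finset.add_sum_erase _ _ hmem]
    have hnr : ¬ r (i, j) (i, j) := hr.irrefl.irrefl _
    simp only [hu, expo_apply_zero, expo_apply_one, if_neg hnr, zero_add]
    congr 1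
    apply Finset.sum_congr rfl
    rintro ⟨m, m'⟩ hz
    rw [Finset.mem_erase, Finset.HasAntidiagonal.mem_antidiagonal] at hz
    obtain ⟨hne, hsum⟩ := hz
    have e0 : m 0 + m' 0 = i := by simpa using DFunLike.congr_fun hsum 0
    have e1 : m 1 + m' 1 = j + 1 := by simpa using DFunLike.congr_fun hsum 1
    split_ifs with hlt
    · rfl
    -- A pair not preceding `(i, j)` has abscissa `i` and ordinate `j` or `j + 1`. The former is the
    -- erased pair; the latter meets the constant term of `g`, which is zero.
    · have hm0 : m 0 = i := by
        by_contra hcon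
        exact hlt (Prod.Lex.left _ _ (by change m 0 < i; omega))
      have hm1 : ¬ m 1 < j := by
        intro hcon
        apply hlt
        simp only [hm0]
        exact Prod.Lex.right _ hcon
      have hm' : m' = expo 0 0 := by
        have hm1' : m 1 ≠ j := by
          intro hcon
          apply hne
          rw [Prod.mk.injEq]
          constructor
          · apply expo_ext <;> simp [hm0, hcon]
          · apply expo_ext
            · simp; omega
            · simp; omega
        apply expo_ext
        · simp; omega
        · simp; omega
      simp only [hm', h00, mul_zero]
  have hc : coeff (expo 0 1) (u * g) = 1 := by simpa using key 0 0
  -- As `g` has no constant term, the coefficient of `y` in `u * g`, which is `1`, equals the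
  -- constant term of `u` times the coefficient of `y` in `g`.
  have hv0 : v (0, 0) ≠ 0 := by
    intro h0
    have : coeff (expo 0 1) (u * g) = 0 := by
      rw [coeff_mul]
      apply Finset.sum_eq_zero
      rintro ⟨m, m'⟩ hz
      rw [Finset.HasAntidiagonal.mem_antidiagonal] at hz
      have e0 : m 0 + m' 0 = 0 := by simpa using DFunLike.congr_fun hz 0
      have e1 : m 1 + m' 1 = 1 := by simpa using DFunLike.congr_fun hz 1
      rcases Nat.eq_zero_or_pos (m 1) with h | h
      · have : m 0 = 0 := by omega
        simp [hu, h, this, h0]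
      · have : m' = expo 0 0 := expo_ext (by simp; omega) (by simp; omega)
        simp only [this, h00, mul_zero]
    rw [this] at hc
    exact zero_ne_one hc
  refine ⟨u, u * g - X 1, ?_, ?_, by ring⟩
  · rw [MvPowerSeries.isUnit_iff_constantCoeff, isUnit_iff_ne_zero,
      ← coeff_zero_eq_constantCoeff_apply, hu]
    exact hv0
  · intro m hm
    rw [map_sub, coeff_X] at hm
    have hm1 : m 1 = 0 := by
      by_contra hcon
      obtain ⟨j, hj⟩ := Nat.exists_eq_succ_of_ne_zero hcon
      have hmm : m = expo (m 0) (j + 1) := expo_ext (by simp) (by simp [hj])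
      apply hm
      rw [hmm, key]
      by_cases h : (m 0, j) = (0, 0)
      · rw [if_pos h, if_pos, sub_self]
        rw [Prod.mk.injEq] at h
        apply expo_ext <;> simp [h.1, h.2]
      · rw [if_neg h, if_neg, sub_self]
        intro h'
        apply h
        have e0 := DFunLike.congr_fun h' 0
        have e1 := DFunLike.congr_fun h' 1
        simp at e0 e1
        simp [e0, e1]
    refine ⟨hm1, fun hm0 => hm ?_⟩
    have : m = 0 := by rw [← expo_eta m, hm0, hm1, expo_zero_zero]
    rw [expo_zero_zero, coeff_zero_eq_constantCoeff_apply] at h00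
    subst this
    rw [if_neg, coeff_zero_eq_constantCoeff_apply, map_mul, h00, mul_zero, sub_zero]
    intro h
    have e1 := DFunLike.congr_fun h 1
    simp at e1

/-! ### Shears and dilations -/

theorem subst_eq_self_of_isXSeries {s : Fin 2 → PS} (hs : HasSubst s) (h0 : s 0 = X 0) {h : PS}
    (hh : IsXSeries h) : subst s h = h := by
  classical
  ext e
  rw [coeff_subst hs, finsum_eq_single _ e]
  · by_cases he : coeff e h = 0
    · simp [he]
    · have h1 := (hh e he).1
      rw [Finsupp.prod_fintype _ _ (by simp), Fin.prod_univ_two, h0, h1, pow_zero, mul_one,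
        coeff_X_pow, if_pos, smul_eq_mul, mul_one]
      apply expo_ext <;> simp [h1]
  · intro d hd
    by_cases he : coeff d h = 0
    · simp [he]
    · have h1 := (hh d he).1
      rw [Finsupp.prod_fintype _ _ (by simp), Fin.prod_univ_two, h0, h1, pow_zero, mul_one,
        coeff_X_pow, if_neg, smul_zero]
      rintro rfl
      apply hd
      apply expo_ext <;> simp [h1]

/-- The substitution `y ↦ y + h`. -/
noncomputable def shearSubst (h : PS) : Fin 2 → PS := ![X 0, X 1 + h]

theorem IsXSeries.constantCoeff_eq {h : PS} (hh : IsXSeries h) : constantCoeff h = 0 := by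
  rw [← coeff_zero_eq_constantCoeff_apply]
  by_contra hne
  exact (hh 0 hne).2 rfl

theorem IsXSeries.zero : IsXSeries 0 := fun m hm => absurd (by simp) hm

theorem IsXSeries.neg {h : PS} (hh : IsXSeries h) : IsXSeries (-h) := fun m hm =>
  hh m (by simpa using hm)

theorem IsXSeries.add {h h' : PS} (hh : IsXSeries h) (hh' : IsXSeries h') : IsXSeries (h + h') := by
  intro m hm
  by_cases h1 : coeff m h = 0
  · exact hh' m (by simpa [h1] using hm)
  · exact hh m h1

theorem IsXSeries.sub {h h' : PS} (hh : IsXSeries h) (hh' : IsXSeries h') : IsXSeries (h - h') := by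
  rw [sub_eq_add_neg]; exact hh.add hh'.neg

theorem hasSubst_shearSubst {h : PS} (hh : IsXSeries h) : HasSubst (shearSubst h) := by
  apply hasSubst_of_constantCoeff_zero
  intro i
  fin_cases i <;> simp [shearSubst, hh.constantCoeff_eq]

/-- The automorphism `y ↦ y + h` of `ℂ[[x, y]]`. -/
noncomputable def shear {h : PS} (hh : IsXSeries h) : PS →ₐ[ℂ] PS :=
  substAlgHom (hasSubst_shearSubst hh)

theorem shear_apply {h : PS} (hh : IsXSeries h) (f : PS) :
    shear hh f = subst (shearSubst h) f := substAlgHom_apply _ f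

@[simp] theorem shear_X_zero {h : PS} (hh : IsXSeries h) : shear hh (X 0) = X 0 := by
  rw [shear_apply, subst_X (hasSubst_shearSubst hh)]; rfl

@[simp] theorem shear_X_one {h : PS} (hh : IsXSeries h) : shear hh (X 1) = X 1 + h := by
  rw [shear_apply, subst_X (hasSubst_shearSubst hh)]; rfl

theorem shear_eq_self {h g : PS} (hh : IsXSeries h) (hg : IsXSeries g) : shear hh g = g := by
  rw [shear_apply]
  exact subst_eq_self_of_isXSeries (hasSubst_shearSubst hh) rfl hg

/-- Series in `x` alone are fixed by shears, so shears compose additively; in particular each is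
invertible. -/
theorem shear_shear {h g : PS} (hh : IsXSeries h) (hg : IsXSeries g) (f : PS) :
    shear hh (shear hg f) = shear (hg.add hh) f := by
  have hsg := hasSubst_shearSubst hg
  have hsh := hasSubst_shearSubst hh
  rw [shear_apply hh, shear_apply hg, shear_apply, subst_comp_subst_apply hsg hsh]
  congr 1
  funext i
  have h1 : subst (shearSubst h) (X 1 + g : PS) = X 1 + (g + h) := by
    rw [← shear_apply hh, map_add, shear_X_one, shear_eq_self hh hg]; ring
  have h0 : subst (shearSubst h) (X 0 : PS) = X 0 := by
    rw [← shear_apply hh, shear_X_zero]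
  fin_cases i
  · exact h0
  · exact h1

theorem shear_zero (f : PS) : shear IsXSeries.zero f = f := by
  have : shearSubst 0 = (X : Fin 2 → MvPowerSeries (Fin 2) ℂ) := by
    funext i; fin_cases i <;> simp [shearSubst]
  rw [shear_apply, this, subst_self, id]

theorem shear_neg_shear {h : PS} (hh : IsXSeries h) (f : PS) :
    shear hh.neg (shear hh f) = f := by
  rw [shear_shear]
  have : ∀ {g : PS} (hg : IsXSeries g), g = 0 → shear hg f = f := by
    rintro g hg rfl; exact shear_zero f
  exact this _ (by ring)

/-- The hypothesis on `h` says exactly that `y + h` keeps the weight of `y`. -/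
theorem shear_mem_filtration {h : PS} (hh : IsXSeries h) {a b W : ℕ} (hb : h ∈ filtration a b b)
    {f : PS} (hf : f ∈ filtration a b W) : shear hh f ∈ filtration a b W := by
  rw [shear_apply]
  exact subst_mem_filtration (hasSubst_shearSubst hh) (X_zero_mem_filtration a b)
    (add_mem (X_one_mem_filtration a b) hb) hf

/-- The substitution `y ↦ x ^ q * y`. -/
noncomputable def dilationSubst (q : ℕ) : Fin 2 → PS := ![X 0, X 0 ^ q * X 1]

theorem hasSubst_dilationSubst (q : ℕ) : HasSubst (dilationSubst q) := by
  apply hasSubst_of_constantCoeff_zero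
  intro i
  fin_cases i <;> simp [dilationSubst]

/-- The map `(i, j) ↦ (i + q j, j)` on exponents is injective, so a single term contributes. -/
theorem coeff_subst_dilation (q i j : ℕ) (f : PS) :
    coeff (expo (i + q * j) j) (subst (dilationSubst q) f) = coeff (expo i j) f := by
  classical
  have key : ∀ d e : Fin 2 →₀ ℕ, coeff e (d.prod fun i e => dilationSubst q i ^ e) =
      if e = expo (d 0 + q * d 1) (d 1) then 1 else 0 := by
    intro d e
    have : (d.prod fun i e => dilationSubst q i ^ e) =
        monomial (expo (d 0 + q * d 1) (d 1)) 1 := by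
      rw [Finsupp.prod_fintype _ _ (by simp), Fin.prod_univ_two]
      simp only [dilationSubst, Matrix.cons_val_zero, Matrix.cons_val_one, mul_pow, ← pow_mul]
      rw [X_pow_eq, X_pow_eq, X_pow_eq, monomial_mul_monomial, monomial_mul_monomial]
      congr 1
      · congr 1; apply expo_ext <;> simp
      · simp
    rw [this, coeff_monomial]
  rw [coeff_subst (hasSubst_dilationSubst q), finsum_eq_single _ (expo i j)]
  · rw [key]; simp
  · intro d hd
    rw [key, if_neg, smul_zero]
    intro h
    apply hd
    have e0 := DFunLike.congr_fun h 0
    have e1 := DFunLike.congr_fun h 1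
    simp at e0 e1
    rw [← e1] at e0
    apply expo_ext
    · simp; omega
    · simp [e1]

end NewtonTrees

namespace NewtonTrees

open MvPowerSeries

/-! ### The support of an ideal -/

theorem le_filtration_iff {I : Ideal PS} {a b W : ℕ} :
    I ≤ filtration a b W ↔ ∀ m ∈ idealSupport I, W ≤ a * m 0 + b * m 1 :=
  ⟨fun h _ ⟨_, hf, hm⟩ => h hf _ hm, fun h f hf m hm => h m ⟨f, hf, hm⟩⟩

theorem idealSupport_nonempty {I : Ideal PS} (hI : I ≠ ⊥) : (idealSupport I).Nonempty := by
  obtain ⟨f, hf, hf0⟩ := Submodule.exists_mem_ne_zero_of_ne_bot hI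
  obtain ⟨m, hm⟩ := (ne_zero_iff_exists_coeff_ne_zero f).1 hf0
  exact ⟨m, f, hf, hm⟩

theorem idealSupport_mono {I J : Ideal PS} (h : I ≤ J) : idealSupport I ⊆ idealSupport J :=
  fun _ ⟨f, hf, hm⟩ => ⟨f, h hf, hm⟩

theorem idealSupport_upward {I : Ideal PS} {m m' : Fin 2 →₀ ℕ} (hm : m ∈ idealSupport I)
    (h : m ≤ m') : m' ∈ idealSupport I := by
  obtain ⟨f, hf, hne⟩ := hm
  refine ⟨monomial (m' - m) 1 * f, I.mul_mem_left _ hf, ?_⟩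
  obtain ⟨e, rfl⟩ := exists_add_of_le h
  rw [add_tsub_cancel_left, add_comm m e, coeff_add_monomial_mul, one_mul]
  exact hne

theorem le_iff_expo {m m' : Fin 2 →₀ ℕ} : m ≤ m' ↔ m 0 ≤ m' 0 ∧ m 1 ≤ m' 1 := by
  rw [Finsupp.le_def]; exact Fin.forall_fin_two

/-- Dickson's lemma: the minimal exponents form an antichain in `ℕ²`, hence a finite set. -/
theorem exists_minimal_exponents (I : Ideal PS) : ∃ E : Finset (Fin 2 →₀ ℕ),
    (∀ e ∈ E, e ∈ idealSupport I) ∧ (∀ m ∈ idealSupport I, ∃ e ∈ E, e ≤ m) ∧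
    ∀ e ∈ E, ∀ m ∈ idealSupport I, m ≤ e → m = e := by
  have hfin : {m | Minimal (· ∈ idealSupport I) m}.Finite :=
    WellQuasiOrderedLE.finite_of_isAntichain (setOfPred_minimal_antichain _)
  refine ⟨hfin.toFinset, ?_, ?_, ?_⟩
  · intro e he
    rw [Set.Finite.mem_toFinset] at he
    exact he.1
  · intro m hm
    obtain ⟨e, he, hmin⟩ := exists_minimal_le_of_wellFoundedLT (· ∈ idealSupport I) m hm
    exact ⟨e, by rw [Set.Finite.mem_toFinset]; exact hmin, he⟩
  · intro e he m hm hle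
    rw [Set.Finite.mem_toFinset] at he
    exact le_antisymm hle (he.2 hm hle)

/-- A generic linear combination of generators has the same Newton diagram. -/
theorem exists_generic_idealSupport {r : ℕ} (f : Fin r → PS) :
    ∃ P : MvPolynomial (Fin r) ℂ, P ≠ 0 ∧ ∀ c : Fin r → ℂ, MvPolynomial.eval c P ≠ 0 →
      idealSupport (Ideal.span {∑ i, c i • f i}) = idealSupport (Ideal.span (Set.range f)) := by
  classical
  obtain ⟨E, hE, hmin, hE'⟩ := exists_minimal_exponents (Ideal.span (Set.range f))
  -- One linear form for each minimal exponent `e`: the coefficient at `e` of the combination.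
  refine ⟨∏ e ∈ E, ∑ i, MvPolynomial.C (coeff e (f i)) * MvPolynomial.X i, ?_, ?_⟩
  · rw [Finset.prod_ne_zero_iff]
    intro e he h0
    have hfi : ∀ i, coeff e (f i) = 0 := by
      intro i
      have := congrArg (MvPolynomial.eval (Pi.single i 1)) h0
      simpa [Pi.single_apply] using this
    obtain ⟨g, hg, hne⟩ := hE e he
    rw [Ideal.mem_span_range_iff_exists_fun] at hg
    obtain ⟨a, rfl⟩ := hg
    rw [map_sum] at hne
    obtain ⟨i, -, hi⟩ := Finset.exists_ne_zero_of_sum_ne_zero hne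
    rw [coeff_mul] at hi
    obtain ⟨z, hz, hzne⟩ := Finset.exists_ne_zero_of_sum_ne_zero hi
    rw [Finset.HasAntidiagonal.mem_antidiagonal] at hz
    have hz2 : z.2 ∈ idealSupport (Ideal.span (Set.range f)) :=
      ⟨f i, Ideal.subset_span ⟨i, rfl⟩, right_ne_zero_of_mul hzne⟩
    -- If no generator had `e` in its support, an element of the ideal with `e` in its support would
    -- force a support point of the ideal strictly below `e`.
    have := hE' e he z.2 hz2 (by rw [← hz]; exact le_add_self)
    rw [this] at hzne
    exact right_ne_zero_of_mul hzne (hfi i)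
  · intro c hc
    apply Set.Subset.antisymm
    · apply idealSupport_mono
      rw [Ideal.span_singleton_le_iff_mem]
      refine Ideal.sum_mem _ fun i _ => ?_
      rw [smul_eq_C_mul]
      exact Ideal.mul_mem_left _ _ (Ideal.subset_span ⟨i, rfl⟩)
    · intro m hm
      obtain ⟨e, he, hle⟩ := hmin m hm
      refine idealSupport_upward ⟨_, Ideal.subset_span rfl, ?_⟩ hle
      rw [map_prod, Finset.prod_ne_zero_iff] at hc
      have := hc e he
      simpa [map_sum, mul_comm] using this

theorem topOrder_le {I : Ideal PS} {m : Fin 2 →₀ ℕ} (hm : m ∈ idealSupport I) :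
    topOrder I ≤ m 0 := Nat.sInf_le ⟨m, hm, rfl⟩

theorem bottomOrder_le {I : Ideal PS} {m : Fin 2 →₀ ℕ} (hm : m ∈ idealSupport I) :
    bottomOrder I ≤ m 1 := Nat.sInf_le ⟨m, hm, rfl⟩

/-- The ordinate of the upper vertex of the Newton diagram. -/
noncomputable def height (I : Ideal PS) : ℕ := sInf {j | expo (topOrder I) j ∈ idealSupport I}

theorem exists_mem_bottomOrder {I : Ideal PS} (hI : I ≠ ⊥) :
    ∃ m ∈ idealSupport I, m 1 = bottomOrder I := by
  obtain ⟨m, hm, h⟩ := Nat.sInf_mem ((idealSupport_nonempty hI).image fun m => m 1)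
  exact ⟨m, hm, h⟩

theorem expo_height_mem {I : Ideal PS} (hI : I ≠ ⊥) :
    expo (topOrder I) (height I) ∈ idealSupport I := by
  obtain ⟨m, hm, hm0⟩ := Nat.sInf_mem ((idealSupport_nonempty hI).image fun m => m 0)
  refine Nat.sInf_mem (s := {j | expo (topOrder I) j ∈ idealSupport I}) ⟨m 1, ?_⟩
  have : expo (topOrder I) (m 1) = m := by
    rw [← expo_eta m]; apply expo_ext
    · simp only [expo_apply_zero]; exact hm0.symm
    · simp
  simpa [this] using hm

theorem height_le {I : Ideal PS} {m : Fin 2 →₀ ℕ} (hm : m ∈ idealSupport I)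
    (h0 : m 0 = topOrder I) : height I ≤ m 1 := by
  apply Nat.sInf_le
  rw [← h0]
  simpa [expo_eta] using hm

/-- Encodes "the upper vertex is `(N, n)`" by memberships that can be tested on generators. The
weight `(n, 1)` imposes `β ≥ n` on the column `α = N` and nothing on the columns further right. -/
theorem topOrder_eq_and_height_eq {J : Ideal PS} {N n : ℕ} (h1 : J ≤ filtration 1 0 N)
    (h2 : J ≤ filtration n 1 (n * N + n)) (hm : expo N n ∈ idealSupport J) :
    topOrder J = N ∧ height J = n := by
  have hJ : J ≠ ⊥ := by
    rintro rfl
    obtain ⟨f, hf, hne⟩ := hm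
    rw [Ideal.mem_bot] at hf
    simp [hf] at hne
  have ht : topOrder J = N := by
    apply le_antisymm
    · simpa using topOrder_le hm
    · have := le_filtration_iff.1 h1 _ (expo_height_mem hJ)
      simpa using this
  refine ⟨ht, le_antisymm ?_ ?_⟩
  · simpa using height_le hm (by simp [ht])
  · have := le_filtration_iff.1 h2 _ (expo_height_mem hJ)
    rw [ht] at this
    simp at this
    omega

/-! ### Faces of the Newton polygon -/

/-- Replaces the convex hull by the support itself, so that afterwards only integer inequalities
occur. -/
theorem isFace_iff {I : Ideal PS} {p q N : ℕ} : IsFace I p q N ↔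
    0 < p ∧ 0 < q ∧ Nat.Coprime p q ∧ (∀ m ∈ idealSupport I, N ≤ p * m 0 + q * m 1) ∧
    ∃ m ∈ idealSupport I, ∃ m' ∈ idealSupport I, m ≠ m' ∧
      p * m 0 + q * m 1 = N ∧ p * m' 0 + q * m' 1 = N := by
  unfold IsFace
  refine and_congr_right fun hp => and_congr_right fun hq => and_congr_right fun hpq => ?_
  have hp' : (0 : ℝ) < p := by exact_mod_cast hp
  have hq' : (0 : ℝ) < q := by exact_mod_cast hq
  have hsub : ∀ m ∈ idealSupport I, ((m 0 : ℝ), (m 1 : ℝ)) ∈ newtonDiagram I := fun m hm =>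
    subset_convexHull _ _ ⟨m, hm, le_rfl, le_rfl⟩
  have hlin : IsLinearMap ℝ fun z : ℝ × ℝ => (p : ℝ) * z.1 + q * z.2 :=
    ⟨fun x y => by simp; ring, fun c x => by simp; ring⟩
  constructor
  · rintro ⟨h1, h2⟩
    have h1' : ∀ m ∈ idealSupport I, N ≤ p * m 0 + q * m 1 := fun m hm => by
      have := h1 _ (hsub m hm)
      dsimp only at this
      exact_mod_cast this
    refine ⟨h1', ?_⟩
    by_contra! hcon
    have hw : ∃ w : ℝ × ℝ, ∀ m ∈ idealSupport I, p * m 0 + q * m 1 = N →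
        w = ((m 0 : ℝ), (m 1 : ℝ)) := by
      by_cases hex : ∃ m ∈ idealSupport I, p * m 0 + q * m 1 = N
      · obtain ⟨m, hm, hmN⟩ := hex
        refine ⟨((m 0 : ℝ), (m 1 : ℝ)), fun m' hm' hmN' => ?_⟩
        by_contra hne
        exact hcon m hm m' hm' (fun h => hne (by rw [h])) hmN hmN'
      · exact ⟨0, fun m hm hmN => absurd ⟨m, hm, hmN⟩ hex⟩
    obtain ⟨w, hw⟩ := hw
    -- If at most one support point `w` lay on the line, the part of the half-plane meeting the line
    -- at most in `w` would be a convex set containing the diagram. If there is no support point on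
    -- the line, the value of `w` is irrelevant.
    have hC : Convex ℝ {z : ℝ × ℝ | (N : ℝ) ≤ p * z.1 + q * z.2 ∧
        (p * z.1 + q * z.2 = (N : ℝ) → z = w)} := by
      rintro ⟨x1, x2⟩ ⟨hx, hx'⟩ ⟨y1, y2⟩ ⟨hy, hy'⟩ s t hs ht hst
      simp only [Set.mem_ofPred_eq, Prod.smul_mk, Prod.mk_add_mk, smul_eq_mul] at *
      have e : (p : ℝ) * (s * x1 + t * y1) + q * (s * x2 + t * y2) =
        s * (p * x1 + q * x2) + t * (p * y1 + q * y2) := by ring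
      rw [e]
      refine ⟨by nlinarith, fun heq => ?_⟩
      have hs0 : s * ((p * x1 + q * x2) - N) = 0 := by nlinarith
      have ht0 : t * ((p * y1 + q * y2) - N) = 0 := by nlinarith
      rcases mul_eq_zero.1 hs0 with hs0 | hs0 <;> rcases mul_eq_zero.1 ht0 with ht0 | ht0
      · linarith
      · rw [hs0] at hst ⊢
        have : t = 1 := by linarith
        rw [this, ← hy' (by linarith)]; simp
      · rw [ht0] at hst ⊢
        have : s = 1 := by linarith
        rw [this, ← hx' (by linarith)]; simp
      · have a1 := hx' (by linarith)
        have a2 := hy' (by linarith)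
        rw [← a1] at a2 ⊢
        rw [Prod.mk.injEq] at a2 ⊢
        rw [a2.1, a2.2, ← add_mul, ← add_mul, hst]; simp
    have hsubC : newtonDiagram I ⊆ {z : ℝ × ℝ | (N : ℝ) ≤ p * z.1 + q * z.2 ∧
        (p * z.1 + q * z.2 = (N : ℝ) → z = w)} := by
      apply convexHull_min _ hC
      rintro z ⟨m, hm, hz1, hz2⟩
      have hN : (N : ℝ) ≤ p * m 0 + q * m 1 := by exact_mod_cast h1' m hm
      refine ⟨by nlinarith, fun heq => ?_⟩
      have e1 : (p : ℝ) * (z.1 - m 0) = 0 := by nlinarith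
      have e2 : (q : ℝ) * (z.2 - m 1) = 0 := by nlinarith
      have e1' : z.1 = m 0 := by
        rcases mul_eq_zero.1 e1 with h | h <;> linarith
      have e2' : z.2 = m 1 := by
        rcases mul_eq_zero.1 e2 with h | h <;> linarith
      rw [hw m hm (by rw [e1', e2'] at heq; exact_mod_cast heq)]
      exact Prod.ext e1' e2'
    obtain ⟨z, hz, z', hz', hne⟩ := h2
    exact hne (((hsubC hz.1).2 hz.2).trans ((hsubC hz'.1).2 hz'.2).symm)
  · rintro ⟨h1, m, hm, m', hm', hne, hN, hN'⟩
    constructor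
    · have hC := convex_halfSpace_ge hlin (N : ℝ)
      have : newtonDiagram I ⊆ {z : ℝ × ℝ | (N : ℝ) ≤ p * z.1 + q * z.2} := by
        apply convexHull_min _ hC
        rintro z ⟨m, hm, hz1, hz2⟩
        have hN : (N : ℝ) ≤ p * m 0 + q * m 1 := by exact_mod_cast h1 m hm
        simp only [Set.mem_ofPred_eq]
        nlinarith
      exact this
    · refine ⟨_, ⟨hsub m hm, by dsimp only; exact_mod_cast hN⟩, _,
        ⟨hsub m' hm', by dsimp only; exact_mod_cast hN'⟩, ?_⟩
      intro h
      rw [Prod.mk.injEq] at h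
      exact hne (expo_ext (by exact_mod_cast h.1) (by exact_mod_cast h.2))

theorem isFace_congr {I J : Ideal PS} (h : idealSupport I = idealSupport J) {p q N : ℕ} :
    IsFace I p q N ↔ IsFace J p q N := by
  rw [isFace_iff, isFace_iff, h]

theorem topOrder_congr {I J : Ideal PS} (h : idealSupport I = idealSupport J) :
    topOrder I = topOrder J := by rw [topOrder, topOrder, h]

theorem bottomOrder_congr {I J : Ideal PS} (h : idealSupport I = idealSupport J) :
    bottomOrder I = bottomOrder J := by rw [bottomOrder, bottomOrder, h]

theorem height_congr {I J : Ideal PS} (h : idealSupport I = idealSupport J) :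
    height I = height J := by rw [height, height, h, topOrder_congr h]

/-- Below a vertex of the Newton diagram which is not the lowest one there is a further face. -/
theorem exists_isFace_below {I : Ideal PS} {m : Fin 2 →₀ ℕ} (hm : m ∈ idealSupport I)
    {p q N : ℕ} (hp : 0 < p) (hN : p * m 0 + q * m 1 = N)
    (hle : ∀ m' ∈ idealSupport I, N ≤ p * m' 0 + q * m' 1)
    (hlt : ∀ m' ∈ idealSupport I, m' 1 < m 1 → N < p * m' 0 + q * m' 1)
    (hex : ∃ m' ∈ idealSupport I, m' 1 < m 1) :
    ∃ p' q' N', IsFace I p' q' N' ∧ p' * m 0 + q' * m 1 = N' ∧ q * p' < q' * p := by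
  classical
  obtain ⟨E, hE, hmin, -⟩ := exists_minimal_exponents I
  have hne : (E.filter fun e => e 1 < m 1).Nonempty := by
    obtain ⟨m', hm', hlt'⟩ := hex
    obtain ⟨e, he, hle'⟩ := hmin m' hm'
    exact ⟨e, Finset.mem_filter.2 ⟨he, (le_iff_expo.1 hle').2.trans_lt hlt'⟩⟩
  -- The next face joins `m` to the point below it seen under the least ratio of horizontal gain to
  -- vertical loss.
  obtain ⟨e, he, hemin⟩ := Finset.exists_min_image _
    (fun e : Fin 2 →₀ ℕ => ((e 0 : ℚ) - m 0) / ((m 1 : ℚ) - e 1)) hne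
  rw [Finset.mem_filter] at he
  have heI := hE e he.1
  have hstep : ∀ m' ∈ idealSupport I, m' 1 < m 1 → m 0 < m' 0 := by
    intro m' hm' hlt'
    have := hlt m' hm' hlt'
    by_contra hcon
    have h1 : p * m' 0 ≤ p * m 0 := Nat.mul_le_mul_left _ (not_lt.1 hcon)
    have h2 : q * m' 1 ≤ q * m 1 := Nat.mul_le_mul_left _ hlt'.le
    omega
  obtain ⟨A, hA⟩ := Nat.exists_eq_add_of_lt (hstep e heI he.2)
  obtain ⟨B, hB⟩ := Nat.exists_eq_add_of_lt he.2
  have hlte := hlt e heI he.2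
  obtain ⟨g, p', q', hg, hcop, hBg, hAg⟩ : ∃ g p' q' : ℕ, 0 < g ∧ Nat.Coprime p' q' ∧
      B + 1 = p' * g ∧ A + 1 = q' * g := by
    have hpos : 0 < Nat.gcd (B + 1) (A + 1) := Nat.gcd_pos_of_pos_left _ (Nat.succ_pos _)
    obtain ⟨p', q', h1, h2, h3⟩ := Nat.exists_coprime (B + 1) (A + 1)
    exact ⟨_, p', q', hpos, h1, h2, h3⟩
  have hp' : 0 < p' := Nat.pos_of_ne_zero (by rintro rfl; simp at hBg)
  have hq' : 0 < q' := Nat.pos_of_ne_zero (by rintro rfl; simp at hAg)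
  have hAB : q * (B + 1) < p * (A + 1) := by nlinarith
  have hqp : q * p' < q' * p := by
    rw [hBg, hAg] at hAB
    have : (q * p') * g < (q' * p) * g := by nlinarith
    exact Nat.lt_of_mul_lt_mul_right this
  refine ⟨p', q', _, isFace_iff.2 ⟨hp', hq', hcop, ?_, m, hm, e, heI, ?_, rfl, ?_⟩, rfl, hqp⟩
  · intro m' hm'
    -- Below `m` the inequality is the minimality of the ratio. At or above `m` it follows from the
    -- old supporting line, since `q' / p'` is larger than `q / p`.
    by_cases hlt' : m' 1 < m 1
    · obtain ⟨e', he', hle'⟩ := hmin m' hm'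
      obtain ⟨hl0, hl1⟩ := le_iff_expo.1 hle'
      have he1' : e' 1 < m 1 := hl1.trans_lt hlt'
      have hq := hemin e' (Finset.mem_filter.2 ⟨he', he1'⟩)
      obtain ⟨A', hA'⟩ := Nat.exists_eq_add_of_lt (hstep e' (hE e' he') he1')
      obtain ⟨B', hB'⟩ := Nat.exists_eq_add_of_lt he1'
      have hq2 : ((A : ℚ) + 1) / (B + 1) ≤ (A' + 1) / (B' + 1) := by
        have e1 : (e 0 : ℚ) - m 0 = A + 1 := by rw [hA]; push_cast; ring
        have e2 : (m 1 : ℚ) - e 1 = B + 1 := by rw [hB]; push_cast; ring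
        have e3 : (e' 0 : ℚ) - m 0 = A' + 1 := by rw [hA']; push_cast; ring
        have e4 : (m 1 : ℚ) - e' 1 = B' + 1 := by rw [hB']; push_cast; ring
        rwa [e1, e2, e3, e4] at hq
      rw [div_le_div_iff₀ (by positivity) (by positivity)] at hq2
      have hq3 : (A + 1) * (B' + 1) ≤ (A' + 1) * (B + 1) := by exact_mod_cast hq2
      rw [hBg, hAg] at hq3
      have hq4 : q' * (B' + 1) ≤ p' * (A' + 1) := by
        have : (q' * (B' + 1)) * g ≤ (p' * (A' + 1)) * g := by nlinarith
        exact Nat.le_of_mul_le_mul_right this hg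
      have h5 : p' * e' 0 ≤ p' * m' 0 := Nat.mul_le_mul_left _ hl0
      have h6 : q' * e' 1 ≤ q' * m' 1 := Nat.mul_le_mul_left _ hl1
      have h7 : p' * e' 0 = p' * m 0 + p' * (A' + 1) := by rw [hA']; ring
      have h8 : q' * m 1 = q' * e' 1 + q' * (B' + 1) := by
        have : m 1 = e' 1 + (B' + 1) := by omega
        rw [this]; ring
      omega
    · obtain ⟨w, hw⟩ := Nat.exists_eq_add_of_le (not_lt.1 hlt')
      rcases le_total (m 0) (m' 0) with h0 | h0
      · have h5 : p' * m 0 ≤ p' * m' 0 := Nat.mul_le_mul_left _ h0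
        have h6 : q' * m 1 ≤ q' * m' 1 := Nat.mul_le_mul_left _ (not_lt.1 hlt')
        omega
      · obtain ⟨u, hu⟩ := Nat.exists_eq_add_of_le h0
        have h5 := hle m' hm'
        rw [← hN, hw, hu] at h5
        have h6 : p * u ≤ q * w := by nlinarith
        have h7 : p' * u ≤ q' * w := by
          have : p * (p' * u) ≤ p * (q' * w) := by
            calc p * (p' * u) = p' * (p * u) := by ring
              _ ≤ p' * (q * w) := Nat.mul_le_mul_left _ h6
              _ = (q * p') * w := by ring
              _ ≤ (q' * p) * w := Nat.mul_le_mul_right _ hqp.le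
              _ = p * (q' * w) := by ring
          exact Nat.le_of_mul_le_mul_left this hp
        rw [hw, hu]
        nlinarith
  · intro h
    rw [h] at he
    exact lt_irrefl _ he.2
  · have hB1 : m 1 = e 1 + p' * g := by omega
    have hA1 : e 0 = m 0 + q' * g := by omega
    rw [hB1, hA1]; ring

/-- The upper vertex lies on a face, unless it is the only vertex. -/
theorem exists_isFace_top {I : Ideal PS} (hI : I ≠ ⊥) (h : bottomOrder I < height I) :
    ∃ p q N, IsFace I p q N ∧ p * topOrder I + q * height I = N := by
  obtain ⟨m', hm', hb⟩ := exists_mem_bottomOrder hI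
  -- The starting line is the vertical one, `(p, q) = (1, 0)`; this is why `q` may vanish in
  -- `exists_isFace_below`.
  obtain ⟨p, q, N, hF, hN, -⟩ := exists_isFace_below (p := 1) (q := 0) (expo_height_mem hI)
    one_pos rfl (fun m hm => by simpa using topOrder_le hm) (fun m hm hlt => by
      simp only [expo_apply_one, expo_apply_zero, one_mul, zero_mul, add_zero] at *
      refine lt_of_le_of_ne (topOrder_le hm) fun heq => ?_
      have := height_le hm heq.symm
      omega) ⟨m', hm', by simpa [hb] using h⟩
  exact ⟨p, q, N, hF, by simpa using hN⟩

theorem IsFace.topOrder_height_le {I : Ideal PS} (hI : I ≠ ⊥) {p q N : ℕ} (hF : IsFace I p q N) :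
    N ≤ p * topOrder I + q * height I := by
  simpa using (isFace_iff.1 hF).2.2.2.1 _ (expo_height_mem hI)

theorem IsFace.exists_ordinate_lt {I : Ideal PS} {p q N : ℕ} (hF : IsFace I p q N) :
    ∃ m ∈ idealSupport I, ∃ m' ∈ idealSupport I, m 1 < m' 1 ∧
      p * m 0 + q * m 1 = N ∧ p * m' 0 + q * m' 1 = N := by
  obtain ⟨hp, hq, -, -, m, hm, m', hm', hne, h, h'⟩ := isFace_iff.1 hF
  rcases lt_trichotomy (m 1) (m' 1) with hlt | heq | hlt
  · exact ⟨m, hm, m', hm', hlt, h, h'⟩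
  · exfalso
    apply hne
    refine expo_ext ?_ heq
    rw [heq] at h
    exact Nat.eq_of_mul_eq_mul_left hp (by omega)
  · exact ⟨m', hm', m, hm, hlt, h', h⟩

theorem IsFace.ordinate_le_height {I : Ideal PS} (hI : I ≠ ⊥) {p q N : ℕ} (hF : IsFace I p q N)
    {m : Fin 2 →₀ ℕ} (hm : m ∈ idealSupport I) (hN : p * m 0 + q * m 1 = N) :
    m 1 ≤ height I ∧ (m 1 = height I → m 0 = topOrder I) := by
  have h1 := hF.topOrder_height_le hI
  have h2 := topOrder_le hm
  obtain ⟨hp, hq, -⟩ := hF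
  have h3 : p * topOrder I ≤ p * m 0 := Nat.mul_le_mul_left _ h2
  constructor
  · have : q * m 1 ≤ q * height I := by omega
    exact Nat.le_of_mul_le_mul_left this hq
  · intro heq
    rw [heq] at hN
    exact Nat.eq_of_mul_eq_mul_left hp (by omega)

/-- Coprimality recovers `(p, q)` from the slope, and `N` is the minimum of the linear form on the
support. -/
theorem IsFace.eq_of_slope_eq {I : Ideal PS} {p q N p' q' N' : ℕ} (h : IsFace I p q N)
    (h' : IsFace I p' q' N') (hs : q * p' = q' * p) : p = p' ∧ q = q' ∧ N = N' := by
  obtain ⟨hp, hq, hc, hle, m, hm, -, -, -, hN, -⟩ := isFace_iff.1 h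
  obtain ⟨hp', hq', hc', hle', m', hm', -, -, -, hN', -⟩ := isFace_iff.1 h'
  have e1 : p = p' := by
    apply Nat.dvd_antisymm
    · exact hc.dvd_of_dvd_mul_left (Dvd.intro_left q' hs.symm)
    · exact hc'.dvd_of_dvd_mul_left (Dvd.intro_left q hs)
  subst e1
  have e2 : q = q' := Nat.eq_of_mul_eq_mul_right hp hs
  subst e2
  exact ⟨rfl, rfl, le_antisymm (hN' ▸ hle m' hm') (hN ▸ hle' m hm)⟩

/-- Points of a face are minimal exponents, because `p` and `q` are positive. Two of them differ by
a multiple of `(q, -p)`, so the minimal exponents bound `p`, `q` and `N`. -/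
theorem finite_isFace (I : Ideal PS) : {t : ℕ × ℕ × ℕ | IsFace I t.1 t.2.1 t.2.2}.Finite := by
  classical
  obtain ⟨E, hE, hmin, hE'⟩ := exists_minimal_exponents I
  let M := ∑ e ∈ E, (e 0 + e 1)
  have hM : ∀ e ∈ E, e 0 + e 1 ≤ M := fun e he =>
    Finset.single_le_sum (f := fun e : Fin 2 →₀ ℕ => e 0 + e 1) (fun _ _ => Nat.zero_le _) he
  apply Set.Finite.subset (Finset.finite_toSet
    (Finset.Iic M ×ˢ Finset.Iic M ×ˢ Finset.Iic (M * M + M * M)))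
  rintro ⟨p, q, N⟩ h
  simp only [Set.mem_ofPred_eq] at h
  obtain ⟨m, hm, m', hm', hlt, hN, hN'⟩ := h.exists_ordinate_lt
  obtain ⟨hp, hq, hc, hle, -⟩ := isFace_iff.1 h
  have hmE : ∀ m ∈ idealSupport I, p * m 0 + q * m 1 = N → m ∈ E := by
    intro m hm hN
    obtain ⟨e, he, hle'⟩ := hmin m hm
    obtain ⟨h0, h1⟩ := le_iff_expo.1 hle'
    have := hle e (hE e he)
    have h2 : p * e 0 ≤ p * m 0 := Nat.mul_le_mul_left _ h0
    have h3 : q * e 1 ≤ q * m 1 := Nat.mul_le_mul_left _ h1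
    have : e = m := expo_ext (Nat.eq_of_mul_eq_mul_left hp (by omega))
      (Nat.eq_of_mul_eq_mul_left hq (by omega))
    rwa [← this]
  have b1 := hM m (hmE m hm hN)
  have b2 := hM m' (hmE m' hm' hN')
  obtain ⟨w, hw⟩ := Nat.exists_eq_add_of_lt hlt
  have hlt0 : m' 0 < m 0 := by
    by_contra hcon
    have h2 : p * m 0 ≤ p * m' 0 := Nat.mul_le_mul_left _ (not_lt.1 hcon)
    have h3 : q * m 1 < q * m' 1 := Nat.mul_lt_mul_of_pos_left hlt hq
    omega
  obtain ⟨u, hu⟩ := Nat.exists_eq_add_of_lt hlt0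
  have huw : p * (u + 1) = q * (w + 1) := by
    rw [hu] at hN
    rw [hw] at hN'
    nlinarith
  have hpw : p ≤ w + 1 := Nat.le_of_dvd (Nat.succ_pos _)
    (hc.dvd_of_dvd_mul_left (Dvd.intro _ huw))
  have hqu : q ≤ u + 1 := Nat.le_of_dvd (Nat.succ_pos _)
    (hc.symm.dvd_of_dvd_mul_left (Dvd.intro _ huw.symm))
  have hpM : p ≤ M := by omega
  have hqM : q ≤ M := by omega
  have hNM : N ≤ M * M + M * M := by
    rw [← hN]
    exact Nat.add_le_add (Nat.mul_le_mul hpM (by omega)) (Nat.mul_le_mul hqM (by omega))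
  simp [hpM, hqM, hNM]

/-- Distinct faces have distinct ratios `q / p`, so listing these ratios in increasing order lists
the faces from top to bottom. -/
theorem exists_sorted_faces (I : Ideal PS) : ∃ (m : ℕ) (p q N : Fin m → ℕ),
    (∀ i, IsFace I (p i) (q i) (N i)) ∧ (∀ i j, i < j → q i * p j < q j * p i) ∧
    ∀ p' q' N', IsFace I p' q' N' → ∃ i, p i = p' ∧ q i = q' ∧ N i = N' := by
  classical
  let Φ := (finite_isFace I).toFinset
  have hΦ : ∀ t, t ∈ Φ ↔ IsFace I t.1 t.2.1 t.2.2 := fun t => Set.Finite.mem_toFinset _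
  let sl : ℕ × ℕ × ℕ → ℚ := fun t => (t.2.1 : ℚ) / t.1
  let s := Φ.image sl
  have hch : ∀ i : Fin s.card, ∃ t ∈ Φ, sl t = s.orderEmbOfFin rfl i := fun i =>
    Finset.mem_image.1 (s.orderEmbOfFin_mem rfl i)
  choose t ht hts using hch
  refine ⟨s.card, fun i => (t i).1, fun i => (t i).2.1, fun i => (t i).2.2,
    fun i => (hΦ _).1 (ht i), ?_, ?_⟩
  · intro i j hij
    have h1 : sl (t i) < sl (t j) := by
      rw [hts, hts]; exact (s.orderEmbOfFin rfl).strictMono hij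
    have hpi := ((hΦ _).1 (ht i)).1
    have hpj := ((hΦ _).1 (ht j)).1
    simp only [sl] at h1
    rw [div_lt_div_iff₀ (by exact_mod_cast hpi) (by exact_mod_cast hpj)] at h1
    exact_mod_cast h1
  · intro p' q' N' hF
    have hmem : sl (p', q', N') ∈ s := Finset.mem_image_of_mem _ ((hΦ _).2 hF)
    have : sl (p', q', N') ∈ Set.range (s.orderEmbOfFin rfl) := by
      rw [Finset.range_orderEmbOfFin]; exact hmem
    obtain ⟨i, hi⟩ := this
    refine ⟨i, ?_⟩
    have hFi := (hΦ _).1 (ht i)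
    apply hFi.eq_of_slope_eq hF
    rw [← hts] at hi
    simp only [sl] at hi
    rw [div_eq_div_iff (by exact_mod_cast hFi.1.ne') (by exact_mod_cast hF.1.ne')] at hi
    exact_mod_cast hi

end NewtonTrees

namespace NewtonTrees

open MvPowerSeries

/-! ### Homogeneous polynomials in two variables -/

/-- The dehomogenization `G ↦ G(1, X)`. -/
noncomputable def dehom : MvPolynomial (Fin 2) ℂ →ₐ[ℂ] Polynomial ℂ :=
  MvPolynomial.aeval ![1, Polynomial.X]

theorem eval_dehom (G : MvPolynomial (Fin 2) ℂ) (μ : ℂ) :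
    (dehom G).eval μ = MvPolynomial.eval ![1, μ] G := by
  rw [dehom, ← Polynomial.coe_evalRingHom, MvPolynomial.aeval_def, MvPolynomial.hom_eval₂]
  have h1 : (Polynomial.evalRingHom μ).comp (algebraMap ℂ (Polynomial ℂ)) = RingHom.id ℂ := by
    ext; simp
  have h2 : (fun i => Polynomial.evalRingHom μ ((![1, Polynomial.X] : Fin 2 → Polynomial ℂ) i)) =
      ![1, μ] := by
    funext i; fin_cases i <;> simp
  rw [h1, MvPolynomial.eval]
  exact congrArg (fun v => MvPolynomial.eval₂ (RingHom.id ℂ) v G) h2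

theorem degree_fin_two (m : Fin 2 →₀ ℕ) : m.degree = m 0 + m 1 := by
  rw [Finsupp.degree_eq_sum, Fin.sum_univ_two]

theorem sum_eq_of_isHomogeneous {G : MvPolynomial (Fin 2) ℂ} {D : ℕ} (hG : G.IsHomogeneous D)
    {m : Fin 2 →₀ ℕ} (hm : G.coeff m ≠ 0) : m 0 + m 1 = D := by
  have := hG hm
  rw [Finsupp.weight_apply, Finsupp.sum_fintype _ _ (by simp), Fin.sum_univ_two] at this
  simpa using this

theorem coeff_dehom {G : MvPolynomial (Fin 2) ℂ} {D : ℕ} (hG : G.IsHomogeneous D) (j : ℕ) :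
    (dehom G).coeff j = if j ≤ D then G.coeff (expo (D - j) j) else 0 := by
  have h : dehom G = ∑ m ∈ G.support, Polynomial.C (G.coeff m) * Polynomial.X ^ m 1 := by
    rw [dehom, MvPolynomial.aeval_def, MvPolynomial.eval₂_eq']
    apply Finset.sum_congr rfl
    intro m _
    rw [Fin.prod_univ_two]
    simp
  rw [h, Polynomial.finsetSum_coeff]
  simp only [Polynomial.coeff_C_mul, Polynomial.coeff_X_pow]
  split_ifs with hj
  · rw [Finset.sum_eq_single (expo (D - j) j)]
    · simp
    · intro m hm hne
      have := sum_eq_of_isHomogeneous hG (MvPolynomial.mem_support_iff.1 hm)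
      rw [if_neg, mul_zero]
      intro hj'
      apply hne
      apply expo_ext
      · simp; omega
      · simp [hj']
    · intro hm
      rw [MvPolynomial.notMem_support_iff] at hm
      simp [hm]
  · apply Finset.sum_eq_zero
    intro m hm
    have := sum_eq_of_isHomogeneous hG (MvPolynomial.mem_support_iff.1 hm)
    rw [if_neg (by omega), mul_zero]

/-- In a fixed degree the exponent of `y` determines that of `x`. Identities between forms can
therefore be checked in one variable. -/
theorem dehom_inj {G G' : MvPolynomial (Fin 2) ℂ} {D : ℕ} (hG : G.IsHomogeneous D)
    (hG' : G'.IsHomogeneous D) (h : dehom G = dehom G') : G = G' := by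
  ext m
  by_cases hm : m 0 + m 1 = D
  · have h1 := congrArg (fun P => Polynomial.coeff P (m 1)) h
    simp only [coeff_dehom hG, coeff_dehom hG'] at h1
    have : expo (D - m 1) (m 1) = m := expo_ext (by simp; omega) (by simp)
    rwa [if_pos (by omega), if_pos (by omega), this] at h1
  · have h1 : G.coeff m = 0 := by
      by_contra h; exact hm (sum_eq_of_isHomogeneous hG h)
    have h2 : G'.coeff m = 0 := by
      by_contra h; exact hm (sum_eq_of_isHomogeneous hG' h)
    rw [h1, h2]

theorem natDegree_dehom_le {G : MvPolynomial (Fin 2) ℂ} {D : ℕ} (hG : G.IsHomogeneous D) :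
    (dehom G).natDegree ≤ D := by
  rw [Polynomial.natDegree_le_iff_coeff_eq_zero]
  intro j hj
  rw [coeff_dehom hG, if_neg (by omega)]

/-- The homogeneous polynomial of degree `D` whose dehomogenization is a given polynomial. -/
noncomputable def homog (D : ℕ) (κ : Polynomial ℂ) : MvPolynomial (Fin 2) ℂ :=
  ∑ j ∈ Finset.range (D + 1), MvPolynomial.monomial (expo (D - j) j) (κ.coeff j)

theorem isHomogeneous_homog (D : ℕ) (κ : Polynomial ℂ) : (homog D κ).IsHomogeneous D := by
  apply MvPolynomial.IsHomogeneous.sum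
  intro j hj
  rw [Finset.mem_range] at hj
  apply MvPolynomial.isHomogeneous_monomial
  rw [degree_fin_two]
  simp; omega

theorem dehom_homog {D : ℕ} {κ : Polynomial ℂ} (hκ : κ.natDegree ≤ D) : dehom (homog D κ) = κ := by
  rw [homog, map_sum]
  conv_rhs => rw [κ.as_sum_range_C_mul_X_pow' (Nat.lt_succ_of_le hκ)]
  apply Finset.sum_congr rfl
  intro j _
  rw [dehom, MvPolynomial.aeval_monomial, Finsupp.prod_fintype _ _ (by simp), Fin.prod_univ_two]
  simp

theorem dehom_X_zero : dehom (MvPolynomial.X 0) = 1 := by simp [dehom]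

theorem dehom_X_one : dehom (MvPolynomial.X 1) = Polynomial.X := by simp [dehom]

theorem dehom_C (c : ℂ) : dehom (MvPolynomial.C c) = Polynomial.C c := by simp [dehom]

theorem X_one_sub_dvd_of_eval_eq_zero {G : MvPolynomial (Fin 2) ℂ} {D : ℕ}
    (hG : G.IsHomogeneous D) {μ : ℂ} (h : (dehom G).eval μ = 0) :
    MvPolynomial.X 1 - MvPolynomial.C μ * MvPolynomial.X 0 ∣ G := by
  obtain ⟨κ, hκ⟩ := Polynomial.dvd_iff_isRoot.2 h
  by_cases h0 : dehom G = 0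
  · have : G = 0 := dehom_inj hG (MvPolynomial.isHomogeneous_zero _ _ _) (by rw [h0, map_zero])
    rw [this]; exact dvd_zero _
  have hκ0 : κ ≠ 0 := by rintro rfl; simp at hκ; exact h0 hκ
  have hdeg : (dehom G).natDegree = 1 + κ.natDegree := by
    rw [hκ, Polynomial.natDegree_mul (Polynomial.X_sub_C_ne_zero _) hκ0,
      Polynomial.natDegree_X_sub_C]
  have hle := natDegree_dehom_le hG
  refine ⟨homog (D - 1) κ, ?_⟩
  have h1 : (MvPolynomial.X 1 - MvPolynomial.C μ * MvPolynomial.X 0 :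
      MvPolynomial (Fin 2) ℂ).IsHomogeneous 1 :=
    (MvPolynomial.isHomogeneous_X _ _).sub (by
      simpa using (MvPolynomial.isHomogeneous_C _ μ).mul (MvPolynomial.isHomogeneous_X _ 0))
  have h2 := h1.mul (isHomogeneous_homog (D - 1) κ)
  rw [show 1 + (D - 1) = D by omega] at h2
  apply dehom_inj hG h2
  rw [map_mul, dehom_homog (by omega), hκ, map_sub, map_mul, dehom_X_zero, dehom_X_one, dehom_C,
    mul_one]

/-- Dehomogenizing loses factors `x`; they remain visible only as a drop of the degree below `D`. -/
theorem X_zero_dvd_iff {G : MvPolynomial (Fin 2) ℂ} {D : ℕ} (hG : G.IsHomogeneous D) :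
    MvPolynomial.X 0 ∣ G ↔ (dehom G).coeff D = 0 := by
  rw [coeff_dehom hG, if_pos le_rfl, MvPolynomial.X_dvd_iff_modMonomial_eq_zero]
  constructor
  · intro h
    have := congrArg (MvPolynomial.coeff (expo (D - D) D)) h
    rwa [MvPolynomial.coeff_modMonomial_of_not_le, MvPolynomial.coeff_zero] at this
    intro hle
    have := hle 0
    simp at this
  · intro h
    ext m
    rw [MvPolynomial.coeff_zero]
    by_cases hm : Finsupp.single 0 1 ≤ m
    · exact MvPolynomial.coeff_modMonomial_of_le _ hm
    · rw [MvPolynomial.coeff_modMonomial_of_not_le _ hm]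
      by_contra hne
      have hs := sum_eq_of_isHomogeneous hG hne
      have : m 0 = 0 := by
        by_contra h0
        apply hm
        rw [le_iff_expo]
        simp; omega
      have : m = expo (D - D) D := expo_ext (by simp; omega) (by simp; omega)
      rw [← this] at h
      exact hne h

theorem X_one_dvd_iff {G : MvPolynomial (Fin 2) ℂ} {D : ℕ} (hG : G.IsHomogeneous D) :
    MvPolynomial.X 1 ∣ G ↔ (dehom G).eval 0 = 0 := by
  constructor
  · rintro ⟨H, rfl⟩
    rw [map_mul, dehom_X_one, Polynomial.eval_mul, Polynomial.eval_X, zero_mul]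
  · intro h
    simpa using X_one_sub_dvd_of_eval_eq_zero hG h

theorem not_isUnit_of_eval_zero {G : MvPolynomial (Fin 2) ℂ} (h : MvPolynomial.eval 0 G = 0) :
    ¬ IsUnit G := fun hu => (hu.map (MvPolynomial.eval (0 : Fin 2 → ℂ))).ne_zero h

/-- The polynomials of a family have no common factor. -/
def NoCommonFactor {s : ℕ} (k : Fin s → MvPolynomial (Fin 2) ℂ) : Prop :=
  ∀ g : MvPolynomial (Fin 2) ℂ, (∀ i, g ∣ k i) → IsUnit g

/-- A common root `μ` would give the common factor `y - μ x`. -/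
theorem NoCommonFactor.exists_eval_ne_zero {s d : ℕ} {k : Fin s → MvPolynomial (Fin 2) ℂ}
    (hk : NoCommonFactor k) (hd : ∀ i, (k i).IsHomogeneous d) (μ : ℂ) :
    ∃ i, (dehom (k i)).eval μ ≠ 0 := by
  by_contra! h
  exact not_isUnit_of_eval_zero (by simp)
    (hk _ fun i => X_one_sub_dvd_of_eval_eq_zero (hd i) (h i))

theorem NoCommonFactor.exists_coeff_ne_zero {s d : ℕ} {k : Fin s → MvPolynomial (Fin 2) ℂ}
    (hk : NoCommonFactor k) (hd : ∀ i, (k i).IsHomogeneous d) :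
    ∃ i, (dehom (k i)).coeff d ≠ 0 := by
  by_contra! h
  exact not_isUnit_of_eval_zero (by simp) (hk _ fun i => (X_zero_dvd_iff (hd i)).2 (h i))

/-- The Nullstellensatz in one variable: a generator of the ideal has no root over `ℂ`, hence is a
unit. -/
theorem exists_sum_mul_eq_one {s : ℕ} {κ : Fin s → Polynomial ℂ}
    (h : ∀ μ, ∃ i, (κ i).eval μ ≠ 0) : ∃ u : Fin s → Polynomial ℂ, ∑ i, u i * κ i = 1 := by
  have htop : Ideal.span (Set.range κ) = ⊤ := by
    obtain ⟨g, hg⟩ := (IsPrincipalIdealRing.principal (Ideal.span (Set.range κ))).principal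
    rw [Ideal.submodule_span_eq] at hg
    rw [hg, Ideal.span_singleton_eq_top]
    by_contra hu
    have hroot : ∃ μ, g.eval μ = 0 := by
      by_cases h0 : g = 0
      · exact ⟨0, by simp [h0]⟩
      · exact IsAlgClosed.exists_root g fun hdeg => hu (Polynomial.isUnit_iff_degree_eq_zero.2 hdeg)
    obtain ⟨μ, hμ⟩ := hroot
    obtain ⟨i, hi⟩ := h μ
    have : κ i ∈ Ideal.span {g} := hg ▸ Ideal.subset_span ⟨i, rfl⟩
    obtain ⟨c, hc⟩ := Ideal.mem_span_singleton.1 this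
    apply hi
    rw [hc, Polynomial.eval_mul, hμ, zero_mul]
  have : (1 : Polynomial ℂ) ∈ Ideal.span (Set.range κ) := by rw [htop]; trivial
  exact Ideal.mem_span_range_iff_exists_fun.1 this

/-- Homogenizing the Bézout relation puts a power of `x` in the ideal of the `kᵢ`. A common factor
is then associated to a power of `x`, and some `kᵢ` is not divisible by `x`. -/
theorem noCommonFactor_of_sum_mul_eq_one {s d : ℕ} {k : Fin s → MvPolynomial (Fin 2) ℂ}
    (hd : ∀ i, (k i).IsHomogeneous d) {u : Fin s → Polynomial ℂ}
    (hu : ∑ i, u i * dehom (k i) = 1) (hc : ∃ i, (dehom (k i)).coeff d ≠ 0) :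
    NoCommonFactor k := by
  intro g hg
  let M := ∑ i, (u i).natDegree
  have hM : ∀ i, (u i).natDegree ≤ M := fun i =>
    Finset.single_le_sum (f := fun i => (u i).natDegree) (fun _ _ => Nat.zero_le _)
      (Finset.mem_univ i)
  have hX : ∑ i, homog M (u i) * k i = MvPolynomial.X 0 ^ (M + d) := by
    apply dehom_inj (D := M + d)
    · exact MvPolynomial.IsHomogeneous.sum _ _ _ fun i _ => (isHomogeneous_homog M (u i)).mul (hd i)
    · simpa using (MvPolynomial.isHomogeneous_X ℂ (0 : Fin 2)).pow (M + d)
    · rw [map_sum, map_pow, dehom_X_zero, one_pow, ← hu]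
      apply Finset.sum_congr rfl
      intro i _
      rw [map_mul, dehom_homog (hM i)]
  have hgX : g ∣ MvPolynomial.X 0 ^ (M + d) := by
    rw [← hX]
    exact Finset.dvd_sum fun i _ => (hg i).mul_left _
  obtain ⟨j, -, hj⟩ := (dvd_prime_pow (MvPolynomial.X_prime) _).1 hgX
  rcases Nat.eq_zero_or_pos j with rfl | hpos
  · rw [pow_zero] at hj
    exact hj.isUnit_iff.2 isUnit_one
  · exfalso
    obtain ⟨i, hi⟩ := hc
    apply hi
    rw [← X_zero_dvd_iff (hd i)]
    exact ((dvd_pow_self _ hpos.ne').trans hj.symm.dvd).trans (hg i)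

/-! ### Quasi-homogeneous polynomials -/

theorem substPow_eq_coe (p q : ℕ) (G : MvPolynomial (Fin 2) ℂ) :
    substPow p q G = ((MvPolynomial.aeval
      (![MvPolynomial.X 0 ^ q, MvPolynomial.X 1 ^ p] : Fin 2 → MvPolynomial (Fin 2) ℂ) G :
        MvPolynomial (Fin 2) ℂ) : PS) := by
  induction G using MvPolynomial.induction_on with
  | C a => simp [substPow, MvPowerSeries.algebraMap_apply]
  | add f g hf hg =>
    rw [map_add, MvPolynomial.coe_add, ← hf, ← hg]
    simp [substPow]
  | mul_X f i hf =>
    rw [map_mul, MvPolynomial.coe_mul, ← hf]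
    fin_cases i <;> simp [substPow]

theorem substPow_mul (p q : ℕ) (G H : MvPolynomial (Fin 2) ℂ) :
    substPow p q (G * H) = substPow p q G * substPow p q H := map_mul _ _ _

theorem substPow_C_mul (p q : ℕ) (c : ℂ) (G : MvPolynomial (Fin 2) ℂ) :
    substPow p q (MvPolynomial.C c * G) = C c * substPow p q G := by
  rw [substPow_mul]
  simp [substPow, MvPowerSeries.algebraMap_apply]

theorem substPow_monomial (p q : ℕ) (m : Fin 2 →₀ ℕ) (a : ℂ) :
    substPow p q (MvPolynomial.monomial m a) = monomial (expo (q * m 0) (p * m 1)) a := by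
  rw [substPow, MvPolynomial.aeval_monomial, Finsupp.prod_fintype _ _ (by simp), Fin.prod_univ_two]
  simp only [Matrix.cons_val_zero, Matrix.cons_val_one, ← pow_mul]
  rw [X_pow_eq, X_pow_eq, monomial_mul_monomial, MvPowerSeries.algebraMap_apply,
    ← monomial_zero_eq_C_apply, monomial_mul_monomial, zero_add]
  simp [expo]

theorem coeff_substPow {p q : ℕ} (hp : 0 < p) (hq : 0 < q) (i j : ℕ)
    (G : MvPolynomial (Fin 2) ℂ) :
    coeff (expo (q * i) (p * j)) (substPow p q G) = G.coeff (expo i j) := by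
  classical
  induction G using MvPolynomial.induction_on' with
  | monomial m a =>
    rw [substPow_monomial, coeff_monomial, MvPolynomial.coeff_monomial]
    congr 1
    rw [eq_iff_iff]
    constructor
    · intro h
      have e0 := DFunLike.congr_fun h 0
      have e1 := DFunLike.congr_fun h 1
      simp at e0 e1
      apply expo_ext
      · simp; omega
      · simp; omega
    · rintro rfl
      simp
  | add f g hf hg =>
    rw [MvPolynomial.coeff_add, ← hf, ← hg]
    simp [substPow]

theorem exists_of_coeff_substPow_ne_zero {p q : ℕ} {m : Fin 2 →₀ ℕ}
    {G : MvPolynomial (Fin 2) ℂ} (h : coeff m (substPow p q G) ≠ 0) :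
    ∃ i j, m = expo (q * i) (p * j) ∧ G.coeff (expo i j) ≠ 0 := by
  classical
  have hG : substPow p q G = ∑ d ∈ G.support, monomial (expo (q * d 0) (p * d 1)) (G.coeff d) := by
    conv_lhs => rw [G.as_sum]
    rw [substPow, map_sum]
    exact Finset.sum_congr rfl fun d _ => substPow_monomial p q d _
  rw [hG, map_sum] at h
  obtain ⟨d, hd, hne⟩ := Finset.exists_ne_zero_of_sum_ne_zero h
  refine ⟨d 0, d 1, eq_of_coeff_monomial_ne_zero hne, ?_⟩
  rw [expo_eta]
  exact MvPolynomial.mem_support_iff.1 hd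

theorem substPow_injective {p q : ℕ} (hp : 0 < p) (hq : 0 < q) :
    Function.Injective (substPow p q) := by
  intro G H h
  ext m
  rw [← expo_eta m, ← coeff_substPow hp hq, ← coeff_substPow hp hq, h]

/-- The series all of whose monomials lie on the line `p α + q β = N`. -/
def IsQuasiHomogeneous (p q N : ℕ) (f : PS) : Prop :=
  ∀ m, coeff m f ≠ 0 → p * m 0 + q * m 1 = N

theorem IsQuasiHomogeneous.mul {p q N M : ℕ} {f g : PS} (hf : IsQuasiHomogeneous p q N f)
    (hg : IsQuasiHomogeneous p q M g) : IsQuasiHomogeneous p q (N + M) (f * g) := by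
  intro m hm
  rw [coeff_mul] at hm
  obtain ⟨x, hx, hne⟩ := Finset.exists_ne_zero_of_sum_ne_zero hm
  have h1 := hf x.1 (left_ne_zero_of_mul hne)
  have h2 := hg x.2 (right_ne_zero_of_mul hne)
  rw [Finset.HasAntidiagonal.mem_antidiagonal] at hx
  rw [← hx, ← h1, ← h2]
  simp only [Finsupp.add_apply]
  ring

theorem isQuasiHomogeneous_monomial (p q i j : ℕ) (a : ℂ) :
    IsQuasiHomogeneous p q (p * i + q * j) (monomial (expo i j) a) := by
  intro m hm
  rw [eq_of_coeff_monomial_ne_zero hm]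
  simp

theorem isQuasiHomogeneous_substPow {p q D : ℕ} {G : MvPolynomial (Fin 2) ℂ}
    (hG : G.IsHomogeneous D) : IsQuasiHomogeneous p q (p * q * D) (substPow p q G) := by
  intro m hm
  obtain ⟨i, j, rfl, hne⟩ := exists_of_coeff_substPow_ne_zero hm
  have := sum_eq_of_isHomogeneous hG hne
  simp only [expo_apply_zero, expo_apply_one] at *
  rw [← this]; ring

theorem X_pow_mul_X_pow_eq (a b : ℕ) :
    (X 0 ^ a * X 1 ^ b : PS) = monomial (expo a b) 1 := by
  rw [X_pow_eq, X_pow_eq, monomial_mul_monomial, one_mul]; rfl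

theorem isQuasiHomogeneous_mul_substPow {p q D a b : ℕ} {G : MvPolynomial (Fin 2) ℂ}
    (hG : G.IsHomogeneous D) :
    IsQuasiHomogeneous p q (p * a + q * b + p * q * D) (X 0 ^ a * X 1 ^ b * substPow p q G) := by
  rw [X_pow_mul_X_pow_eq]
  exact (isQuasiHomogeneous_monomial p q a b 1).mul (isQuasiHomogeneous_substPow hG)

theorem coeff_mul_substPow {p q : ℕ} (hp : 0 < p) (hq : 0 < q) (a b i j : ℕ)
    (G : MvPolynomial (Fin 2) ℂ) :
    coeff (expo (a + q * i) (b + p * j)) (X 0 ^ a * X 1 ^ b * substPow p q G) =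
      G.coeff (expo i j) := by
  rw [X_pow_mul_X_pow_eq, ← expo_add, coeff_add_monomial_mul, one_mul, coeff_substPow hp hq]

theorem IsQuasiHomogeneous.mem_filtration {p q N : ℕ} {f : PS} (hf : IsQuasiHomogeneous p q N f) :
    f ∈ filtration p q N := fun m hm => (hf m hm).ge

/-! ### Initial parts -/

theorem coeff_initialPart (p q N : ℕ) (f : PS) (m : Fin 2 →₀ ℕ) :
    coeff m (initialPart p q N f) = if p * m 0 + q * m 1 = N then coeff m f else 0 := rfl

theorem initialPart_add (p q N : ℕ) (f g : PS) :
    initialPart p q N (f + g) = initialPart p q N f + initialPart p q N g := by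
  ext m
  simp only [map_add, coeff_initialPart]
  split_ifs <;> simp

theorem initialPart_sum (p q N : ℕ) {ι : Type*} (s : Finset ι) (f : ι → PS) :
    initialPart p q N (∑ i ∈ s, f i) = ∑ i ∈ s, initialPart p q N (f i) := by
  have h0 : initialPart p q N 0 = 0 := by
    ext m; simp [coeff_initialPart]
  exact map_sum (⟨⟨initialPart p q N, h0⟩, initialPart_add p q N⟩ : PS →+ PS) f s

theorem isQuasiHomogeneous_initialPart (p q N : ℕ) (f : PS) :
    IsQuasiHomogeneous p q N (initialPart p q N f) := by
  intro m hm
  rw [coeff_initialPart] at hm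
  by_contra h
  exact hm (if_neg h)

theorem IsQuasiHomogeneous.initialPart_eq {p q N : ℕ} {f : PS} (hf : IsQuasiHomogeneous p q N f) :
    initialPart p q N f = f := by
  ext m
  rw [coeff_initialPart]
  split_ifs with h
  · rfl
  · by_contra hne
    exact h (hf m (Ne.symm hne))

/-- As `f` has weight at least `N` and both weights are positive, a nonconstant monomial of `a`
pushes every term off the line. Taking initial parts thus turns `PS`-linear combinations into
`ℂ`-linear ones. -/
theorem initialPart_mul {p q N : ℕ} (hp : 0 < p) (hq : 0 < q) (a : PS) {f : PS}
    (hf : f ∈ filtration p q N) :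
    initialPart p q N (a * f) = C (constantCoeff a) * initialPart p q N f := by
  ext m
  rw [coeff_initialPart, coeff_C_mul, coeff_initialPart]
  split_ifs with h
  · rw [coeff_mul, Finset.sum_eq_single (0, m)]
    · simp
    · rintro ⟨u, v⟩ hz hne
      rw [Finset.HasAntidiagonal.mem_antidiagonal] at hz
      have e0 : u 0 + v 0 = m 0 := by simpa using DFunLike.congr_fun hz 0
      have e1 : u 1 + v 1 = m 1 := by simpa using DFunLike.congr_fun hz 1
      by_cases hv : p * v 0 + q * v 1 < N
      · simp [coeff_eq_zero_of_mem_filtration hf hv]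
      · exfalso
        have hu : p * u 0 + q * u 1 = 0 := by
          rw [← e0, ← e1] at h
          nlinarith
        have hu0 : u 0 = 0 := by
          rcases Nat.eq_zero_of_add_eq_zero_right hu |> Nat.mul_eq_zero.1 with h | h
          · omega
          · exact h
        have hu1 : u 1 = 0 := by
          rcases Nat.eq_zero_of_add_eq_zero_left hu |> Nat.mul_eq_zero.1 with h | h
          · omega
          · exact h
        apply hne
        have hu' : u = 0 := by rw [← expo_eta u, hu0, hu1, expo_zero_zero]
        rw [hu', zero_add] at hz
        exact Prod.ext hu' hz
    · intro hn
      exact absurd (by simp) hn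
  · rw [mul_zero]

theorem sub_initialPart_mem_filtration {p q N : ℕ} {f : PS} (hf : f ∈ filtration p q N) :
    f - initialPart p q N f ∈ filtration p q (N + 1) := by
  intro m hm
  rw [map_sub, coeff_initialPart] at hm
  split_ifs at hm with h
  · exact absurd (sub_self _) hm
  · rw [sub_zero] at hm
    have := hf m hm
    omega

theorem initialPart_sum_mul {p q N : ℕ} (hp : 0 < p) (hq : 0 < q) {r : ℕ} (a f : Fin r → PS)
    (hf : ∀ i, f i ∈ filtration p q N) :
    initialPart p q N (∑ i, a i * f i) =
      ∑ i, C (constantCoeff (a i)) * initialPart p q N (f i) := by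
  rw [initialPart_sum]
  exact Finset.sum_congr rfl fun i _ => initialPart_mul hp hq _ (hf i)

theorem initialIdeal_eq_span {p q N : ℕ} (hp : 0 < p) (hq : 0 < q) {r : ℕ} {f : Fin r → PS}
    (hf : ∀ i, f i ∈ filtration p q N) :
    initialIdeal (Ideal.span (Set.range f)) p q N =
      Ideal.span (Set.range fun i => initialPart p q N (f i)) := by
  apply le_antisymm
  · rw [initialIdeal, Ideal.span_le]
    rintro _ ⟨g, hg, rfl⟩
    obtain ⟨a, rfl⟩ := Ideal.mem_span_range_iff_exists_fun.1 hg
    rw [initialPart_sum_mul hp hq _ _ hf]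
    exact Ideal.sum_mem _ fun i _ => Ideal.mul_mem_left _ _ (Ideal.subset_span ⟨i, rfl⟩)
  · rw [Ideal.span_le]
    rintro _ ⟨i, rfl⟩
    exact Ideal.subset_span ⟨f i, Ideal.subset_span ⟨i, rfl⟩, rfl⟩

end NewtonTrees

namespace NewtonTrees

open MvPowerSeries

/-! ### Normal forms of the initial parts on a face -/

/-- The initial parts of the members of the family `f` on the line `p α + q β = N` are
`x ^ a * y ^ b * F(x ^ q, y ^ p) * kᵢ(x ^ q, y ^ p)`, where `F` is homogeneous, monic in `y` and
divisible neither by `x` nor by `y` and the `kᵢ` are homogeneous of degree `d` and have no common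
factor. -/
structure NormalForm (p q N d : ℕ) (F : MvPolynomial (Fin 2) ℂ) {r : ℕ} (f : Fin r → PS) where
  a : ℕ
  b : ℕ
  e : ℕ
  k : Fin r → MvPolynomial (Fin 2) ℂ
  F_hom : F.IsHomogeneous e
  F_monic : (dehom F).coeff e = 1
  F_eval : (dehom F).eval 0 ≠ 0
  k_hom : ∀ i, (k i).IsHomogeneous d
  k_coprime : NoCommonFactor k
  weight_eq : p * a + q * b + p * q * (e + d) = N
  initialPart_eq : ∀ i, initialPart p q N (f i) = X 0 ^ a * X 1 ^ b * substPow p q (F * k i)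

namespace NormalForm

variable {p q N d : ℕ} {F : MvPolynomial (Fin 2) ℂ} {r : ℕ} {f : Fin r → PS}

theorem dehom_monic (Φ : NormalForm p q N d F f) : (dehom F).Monic := by
  have h : (dehom F).natDegree = Φ.e := by
    apply le_antisymm (natDegree_dehom_le Φ.F_hom)
    apply Polynomial.le_natDegree_of_ne_zero
    rw [Φ.F_monic]; exact one_ne_zero
  rw [Polynomial.Monic, Polynomial.leadingCoeff, h, Φ.F_monic]

theorem natDegree_dehom (Φ : NormalForm p q N d F f) : (dehom F).natDegree = Φ.e := by
  apply le_antisymm (natDegree_dehom_le Φ.F_hom)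
  apply Polynomial.le_natDegree_of_ne_zero
  rw [Φ.F_monic]; exact one_ne_zero

theorem mul_hom (Φ : NormalForm p q N d F f) (i : Fin r) :
    (F * Φ.k i).IsHomogeneous (Φ.e + d) := Φ.F_hom.mul (Φ.k_hom i)

theorem coeff_upper (Φ : NormalForm p q N d F f) (hp : 0 < p) (hq : 0 < q) (i : Fin r) :
    coeff (expo Φ.a (Φ.b + p * (Φ.e + d))) (f i) = (dehom (Φ.k i)).coeff d := by
  have h1 : (F * Φ.k i).coeff (expo 0 (Φ.e + d)) = (dehom (Φ.k i)).coeff d := by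
    have := coeff_dehom (Φ.mul_hom i) (Φ.e + d)
    rw [if_pos le_rfl, Nat.sub_self] at this
    rw [← this, map_mul, Polynomial.coeff_mul_add_eq_of_natDegree_le (natDegree_dehom_le Φ.F_hom)
      (natDegree_dehom_le (Φ.k_hom i)), Φ.F_monic, one_mul]
  rw [← h1, ← coeff_mul_substPow hp hq Φ.a Φ.b, ← Φ.initialPart_eq, coeff_initialPart, if_pos]
  · simp
  · refine Eq.trans ?_ Φ.weight_eq
    simp; ring

theorem coeff_lower (Φ : NormalForm p q N d F f) (hp : 0 < p) (hq : 0 < q) (i : Fin r) :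
    coeff (expo (Φ.a + q * (Φ.e + d)) Φ.b) (f i) =
      (dehom F).eval 0 * (dehom (Φ.k i)).eval 0 := by
  have h1 : (F * Φ.k i).coeff (expo (Φ.e + d) 0) = (dehom F).eval 0 * (dehom (Φ.k i)).eval 0 := by
    have := coeff_dehom (Φ.mul_hom i) 0
    rw [if_pos (Nat.zero_le _), Nat.sub_zero] at this
    rw [← this, map_mul, Polynomial.coeff_zero_eq_eval_zero, Polynomial.eval_mul]
  rw [← h1, ← coeff_mul_substPow hp hq Φ.a Φ.b, ← Φ.initialPart_eq, coeff_initialPart, if_pos]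
  · simp
  · refine Eq.trans ?_ Φ.weight_eq
    simp; ring

theorem exists_coeff_upper (Φ : NormalForm p q N d F f) (hp : 0 < p) (hq : 0 < q) :
    ∃ i, coeff (expo Φ.a (Φ.b + p * (Φ.e + d))) (f i) ≠ 0 := by
  obtain ⟨i, hi⟩ := Φ.k_coprime.exists_coeff_ne_zero Φ.k_hom
  exact ⟨i, by rwa [Φ.coeff_upper hp hq]⟩

theorem exists_coeff_lower (Φ : NormalForm p q N d F f) (hp : 0 < p) (hq : 0 < q) :
    ∃ i, coeff (expo (Φ.a + q * (Φ.e + d)) Φ.b) (f i) ≠ 0 := by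
  obtain ⟨i, hi⟩ := Φ.k_coprime.exists_eval_ne_zero Φ.k_hom 0
  exact ⟨i, by rw [Φ.coeff_lower hp hq]; exact mul_ne_zero Φ.F_eval hi⟩

theorem le_of_coeff_ne_zero (Φ : NormalForm p q N d F f) {i : Fin r} {m : Fin 2 →₀ ℕ}
    (hm : coeff m (f i) ≠ 0) (hN : p * m 0 + q * m 1 = N) : Φ.a ≤ m 0 ∧ Φ.b ≤ m 1 := by
  have h : coeff m (initialPart p q N (f i)) ≠ 0 := by rwa [coeff_initialPart, if_pos hN]
  rw [Φ.initialPart_eq, X_pow_mul_X_pow_eq, coeff_mul] at h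
  obtain ⟨z, hz, hne⟩ := Finset.exists_ne_zero_of_sum_ne_zero h
  rw [Finset.HasAntidiagonal.mem_antidiagonal] at hz
  have h1 := eq_of_coeff_monomial_ne_zero (left_ne_zero_of_mul hne)
  rw [← hz, h1]
  simp

end NormalForm

theorem monomial_mul_substPow_ne_zero {p q : ℕ} (hp : 0 < p) (hq : 0 < q) {F : MvPolynomial (Fin 2) ℂ}
    (hF : F ≠ 0) (a b : ℕ) : (X 0 ^ a * X 1 ^ b * substPow p q F : PS) ≠ 0 := by
  have hX : ∀ i : Fin 2, (X i : PS) ≠ 0 := fun i h => by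
    have := congrArg (coeff (Finsupp.single i 1)) h
    rw [coeff_index_single_self_X, map_zero] at this
    exact one_ne_zero this
  refine mul_ne_zero (mul_ne_zero (pow_ne_zero _ (hX 0)) (pow_ne_zero _ (hX 1))) fun h => hF ?_
  apply substPow_injective hp hq
  rw [h]; simp [substPow]

theorem Face.le_filtration {I : Ideal PS} (S : Face I) : I ≤ filtration S.p S.q S.N :=
  le_filtration_iff.2 (isFace_iff.1 S.isFace).2.2.2.1

/-- Among quasi-homogeneous series of one weight, membership in the ideal reduces to membership in
the `ℂ`-span. -/
theorem initialPart_mul_of_quasiHomogeneous {p q N : ℕ} (hp : 0 < p) (hq : 0 < q) {s : ℕ}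
    {g : Fin s → PS} (hg : ∀ i, IsQuasiHomogeneous p q N (g i)) {v : PS}
    (hv : IsQuasiHomogeneous p q N v) (hmem : v ∈ Ideal.span (Set.range g)) :
    ∃ c : Fin s → ℂ, v = ∑ i, C (c i) * g i := by
  obtain ⟨a, ha⟩ := Ideal.mem_span_range_iff_exists_fun.1 hmem
  refine ⟨fun i => constantCoeff (a i), ?_⟩
  rw [← hv.initialPart_eq, ← ha, initialPart_sum_mul hp hq _ _ fun i => (hg i).mem_filtration]
  exact Finset.sum_congr rfl fun i _ => by rw [(hg i).initialPart_eq]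

/-- A `Face` describes the initial ideal through some generators; here the description is carried
over to the given `fᵢ`. Everything is quasi-homogeneous of weight `N`, so the two systems are
`ℂ`-linear combinations of each other, which also carries over the absence of common factors. -/
theorem Face.nonempty_normalForm {I : Ideal PS} (S : Face I) {r : ℕ} {f : Fin r → PS}
    (hI : I = Ideal.span (Set.range f)) : Nonempty (NormalForm S.p S.q S.N S.d S.F f) := by
  obtain ⟨a, b, e, s, k, hFhom, hFmonic, hX0, hX1, hk, hcop, heq⟩ := S.initial_eq
  have hp : 0 < S.p := S.isFace.1
  have hq : 0 < S.q := S.isFace.2.1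
  have hfm : ∀ i, f i ∈ filtration S.p S.q S.N := fun i =>
    S.le_filtration (hI ▸ Ideal.subset_span ⟨i, rfl⟩)
  have hF0 : S.F ≠ 0 := fun h => hX0 (h ▸ dvd_zero _)
  set M : PS := X 0 ^ a * X 1 ^ b * substPow S.p S.q S.F with hM
  have hM0 : M ≠ 0 := monomial_mul_substPow_ne_zero hp hq hF0 a b
  have hgen : ∀ G : MvPolynomial (Fin 2) ℂ, M * substPow S.p S.q G =
      X 0 ^ a * X 1 ^ b * substPow S.p S.q (S.F * G) := fun G => by rw [substPow_mul, hM]; ring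
  set w := S.p * a + S.q * b + S.p * S.q * (e + S.d) with hw
  have hquasi : ∀ G : MvPolynomial (Fin 2) ℂ, G.IsHomogeneous S.d →
      IsQuasiHomogeneous S.p S.q w (M * substPow S.p S.q G) := fun G hG => by
    rw [hgen]; exact isQuasiHomogeneous_mul_substPow (hFhom.mul hG)
  have hin : initialIdeal I S.p S.q S.N =
      Ideal.span (Set.range fun i => initialPart S.p S.q S.N (f i)) := by
    have := initialIdeal_eq_span hp hq hfm
    rwa [← hI] at this
  rw [hin] at heq
  -- A support point on the line gives `w ≤ N`; a nonzero generator of the initial ideal gives `N ≤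
  -- w`.
  have hwN : w = S.N := by
    apply le_antisymm
    · have hle : Ideal.span (Set.range fun i => initialPart S.p S.q S.N (f i)) ≤
          filtration S.p S.q w := by
        rw [heq, Ideal.span_le]
        rintro _ ⟨i, rfl⟩
        exact (hquasi _ (hk i)).mem_filtration
      obtain ⟨-, -, -, -, m, ⟨g, hg, hm⟩, -, -, -, hmN, -⟩ := isFace_iff.1 S.isFace
      have hmem : initialPart S.p S.q S.N g ∈ filtration S.p S.q w :=
        hle (hin ▸ Ideal.subset_span ⟨g, hg, rfl⟩)
      rw [← hmN]
      exact hmem m (by rwa [coeff_initialPart, if_pos hmN])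
    · have hle : Ideal.span (Set.range fun i => M * substPow S.p S.q (k i)) ≤
          filtration S.p S.q S.N := by
        rw [← heq, Ideal.span_le]
        rintro _ ⟨i, rfl⟩
        exact (isQuasiHomogeneous_initialPart _ _ _ _).mem_filtration
      obtain ⟨i, hi⟩ := NoCommonFactor.exists_coeff_ne_zero hcop hk
      have hk0 : k i ≠ 0 := by rintro h; simp [h] at hi
      have hne : M * substPow S.p S.q (k i) ≠ 0 := by
        rw [hgen]; exact monomial_mul_substPow_ne_zero hp hq (mul_ne_zero hF0 hk0) a b
      obtain ⟨m, hm⟩ := (ne_zero_iff_exists_coeff_ne_zero _).1 hne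
      rw [← hquasi _ (hk i) m hm]
      exact hle (Ideal.subset_span ⟨i, rfl⟩) m hm
  rw [hwN] at hquasi
  have hc : ∀ j, ∃ c : Fin s → ℂ, initialPart S.p S.q S.N (f j) =
      ∑ i, C (c i) * (M * substPow S.p S.q (k i)) := fun j =>
    initialPart_mul_of_quasiHomogeneous hp hq (fun i => hquasi _ (hk i))
      (isQuasiHomogeneous_initialPart _ _ _ _) (heq ▸ Ideal.subset_span ⟨j, rfl⟩)
  choose c hc using hc
  have hsum : ∀ {n : ℕ} (c : Fin n → ℂ) (k : Fin n → MvPolynomial (Fin 2) ℂ),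
      ∑ i, C (c i) * (M * substPow S.p S.q (k i)) =
        M * substPow S.p S.q (∑ i, MvPolynomial.C (c i) * k i) := by
    intro n c k
    have : substPow S.p S.q (∑ i, MvPolynomial.C (c i) * k i) =
        ∑ i, C (c i) * substPow S.p S.q (k i) := by
      rw [substPow, map_sum]
      exact Finset.sum_congr rfl fun i _ => substPow_C_mul _ _ _ _
    rw [this, Finset.mul_sum]
    exact Finset.sum_congr rfl fun i _ => by ring
  have hkey : ∀ j, initialPart S.p S.q S.N (f j) =
      M * substPow S.p S.q (∑ i, MvPolynomial.C (c j i) * k i) := fun j => by rw [hc, hsum]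
  refine ⟨⟨a, b, e, fun j => ∑ i, MvPolynomial.C (c j i) * k i, hFhom, ?_, ?_, ?_, ?_, hwN, ?_⟩⟩
  · rw [coeff_dehom hFhom, if_pos le_rfl, ← hFmonic]
    congr 1
    apply expo_ext <;> simp
  · rwa [Ne, ← X_one_dvd_iff hFhom]
  · intro j
    refine MvPolynomial.IsHomogeneous.sum _ _ _ fun i _ => ?_
    simpa using (MvPolynomial.isHomogeneous_C _ (c j i)).mul (hk i)
  · intro g hg
    apply hcop
    intro i
    have hmem : M * substPow S.p S.q (k i) ∈
        Ideal.span (Set.range fun i => initialPart S.p S.q S.N (f i)) :=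
      heq ▸ Ideal.subset_span ⟨i, rfl⟩
    obtain ⟨u, hu⟩ := initialPart_mul_of_quasiHomogeneous hp hq
      (fun i => isQuasiHomogeneous_initialPart _ _ _ _) (hquasi _ (hk i)) hmem
    simp only [hkey] at hu
    rw [hsum] at hu
    rw [substPow_injective hp hq (mul_left_cancel₀ hM0 hu)]
    exact Finset.dvd_sum fun j _ => (hg j).mul_left _
  · intro j
    rw [hkey, hgen]

/-- Setting `x = 1` moves the comparison of two normal forms to one variable. -/
theorem expand_dehom_eq {p q a b a' b' : ℕ} {G G' : MvPolynomial (Fin 2) ℂ}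
    (h : (X 0 ^ a * X 1 ^ b * substPow p q G : PS) = X 0 ^ a' * X 1 ^ b' * substPow p q G') :
    Polynomial.X ^ b * Polynomial.expand ℂ p (dehom G) =
      Polynomial.X ^ b' * Polynomial.expand ℂ p (dehom G') := by
  have hexp : ∀ G : MvPolynomial (Fin 2) ℂ, dehom (MvPolynomial.aeval
      (![MvPolynomial.X 0 ^ q, MvPolynomial.X 1 ^ p] : Fin 2 → MvPolynomial (Fin 2) ℂ) G) =
      Polynomial.expand ℂ p (dehom G) := by
    intro G
    induction G using MvPolynomial.induction_on with
    | C a => simp [dehom]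
    | add f g hf hg => simp only [map_add, hf, hg]
    | mul_X f i hf =>
      rw [map_mul, map_mul, hf, map_mul, map_mul]
      fin_cases i <;> simp [dehom_X_zero, dehom_X_one]
  rw [substPow_eq_coe, substPow_eq_coe] at h
  have h' : (MvPolynomial.X 0 ^ a * MvPolynomial.X 1 ^ b * MvPolynomial.aeval
      (![MvPolynomial.X 0 ^ q, MvPolynomial.X 1 ^ p] : Fin 2 → MvPolynomial (Fin 2) ℂ) G :
        MvPolynomial (Fin 2) ℂ) = MvPolynomial.X 0 ^ a' * MvPolynomial.X 1 ^ b' *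
      MvPolynomial.aeval
      (![MvPolynomial.X 0 ^ q, MvPolynomial.X 1 ^ p] : Fin 2 → MvPolynomial (Fin 2) ℂ) G' := by
    apply MvPolynomial.coe_injective (σ := Fin 2) (R := ℂ)
    simpa using h
  have := congrArg dehom h'
  simpa only [map_mul, map_pow, hexp, dehom_X_zero, dehom_X_one, one_pow, one_mul] using this

theorem eq_of_X_pow_mul_eq {b b' : ℕ} {U V : Polynomial ℂ} (hU : U.eval 0 ≠ 0) (hV : V.eval 0 ≠ 0)
    (h : Polynomial.X ^ b * U = Polynomial.X ^ b' * V) : U = V := by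
  have key : ∀ {b b' : ℕ} {U V : Polynomial ℂ}, U.eval 0 ≠ 0 → b ≤ b' →
      Polynomial.X ^ b * U = Polynomial.X ^ b' * V → U = V := by
    intro b b' U V hU hle h
    obtain ⟨n, rfl⟩ := Nat.exists_eq_add_of_le hle
    rw [pow_add, mul_assoc] at h
    have h2 := mul_left_cancel₀ (pow_ne_zero b Polynomial.X_ne_zero) h
    rcases Nat.eq_zero_or_pos n with rfl | hn
    · simpa using h2
    · exfalso
      apply hU
      rw [h2, Polynomial.eval_mul, Polynomial.eval_pow, Polynomial.eval_X, zero_pow hn.ne',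
        zero_mul]
  rcases le_total b b' with hle | hle
  · exact key hU hle h
  · exact (key hV hle h.symm).symm

/-- The face polynomial and the degree of a face are determined by the supporting line. -/
theorem NormalForm.unique {p q N d d' : ℕ} {F F' : MvPolynomial (Fin 2) ℂ} {r : ℕ}
    {f : Fin r → PS} (hp : 0 < p) (Φ : NormalForm p q N d F f)
    (Φ' : NormalForm p q N d' F' f) : F = F' ∧ d = d' := by
  have hX : ∀ i, Polynomial.X ^ Φ.b * Polynomial.expand ℂ p (dehom F) *
      Polynomial.expand ℂ p (dehom (Φ.k i)) = Polynomial.X ^ Φ'.b *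
      Polynomial.expand ℂ p (dehom F') * Polynomial.expand ℂ p (dehom (Φ'.k i)) := by
    intro i
    have := expand_dehom_eq ((Φ.initialPart_eq i).symm.trans (Φ'.initialPart_eq i))
    rwa [map_mul, map_mul, map_mul, map_mul, ← mul_assoc, ← mul_assoc] at this
  -- By Bézout for the `kᵢ`, `X^b F(1, X^p)` is a greatest common divisor of the dehomogenized
  -- initial parts. Being monic it is unique, and `F(1, 0) ≠ 0` then separates `F` from the power of
  -- `X`.
  have hdvd : ∀ {d d' : ℕ} {F F' : MvPolynomial (Fin 2) ℂ} (Φ : NormalForm p q N d F f)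
      (Φ' : NormalForm p q N d' F' f), (∀ i, Polynomial.X ^ Φ.b * Polynomial.expand ℂ p (dehom F) *
      Polynomial.expand ℂ p (dehom (Φ.k i)) = Polynomial.X ^ Φ'.b *
      Polynomial.expand ℂ p (dehom F') * Polynomial.expand ℂ p (dehom (Φ'.k i))) →
      Polynomial.X ^ Φ'.b * Polynomial.expand ℂ p (dehom F') ∣
        Polynomial.X ^ Φ.b * Polynomial.expand ℂ p (dehom F) := by
    intro d d' F F' Φ Φ' h
    obtain ⟨u, hu⟩ := exists_sum_mul_eq_one (Φ.k_coprime.exists_eval_ne_zero Φ.k_hom)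
    have hu' := congrArg (Polynomial.expand ℂ p) hu
    rw [map_sum, map_one] at hu'
    rw [← mul_one (Polynomial.X ^ Φ.b * Polynomial.expand ℂ p (dehom F)), ← hu', Finset.mul_sum]
    refine Finset.dvd_sum fun i _ => ?_
    rw [map_mul, mul_left_comm, h i]
    exact (Dvd.intro _ rfl).mul_left _
  have hmon : ∀ {d : ℕ} {F : MvPolynomial (Fin 2) ℂ} (Φ : NormalForm p q N d F f),
      (Polynomial.X ^ Φ.b * Polynomial.expand ℂ p (dehom F)).Monic := fun Φ =>
    (Polynomial.monic_X_pow _).mul (Φ.dehom_monic.expand hp)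
  have hA := Polynomial.eq_of_monic_of_associated (hmon Φ) (hmon Φ')
    (associated_of_dvd_dvd (hdvd Φ' Φ fun i => (hX i).symm) (hdvd Φ Φ' hX))
  have hev : ∀ {d : ℕ} {F : MvPolynomial (Fin 2) ℂ} (Φ : NormalForm p q N d F f),
      (Polynomial.expand ℂ p (dehom F)).eval 0 ≠ 0 := by
    intro d F Φ
    rw [Polynomial.expand_eval, zero_pow hp.ne']
    exact Φ.F_eval
  have hF : dehom F = dehom F' :=
    Polynomial.expand_injective hp (eq_of_X_pow_mul_eq (hev Φ) (hev Φ') hA)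
  have hk : ∀ i, dehom (Φ.k i) = dehom (Φ'.k i) := by
    intro i
    have := hX i
    rw [hA] at this
    exact Polynomial.expand_injective hp (mul_left_cancel₀ (hmon Φ').ne_zero this)
  refine ⟨?_, ?_⟩
  · have he : Φ.e = Φ'.e := by rw [← Φ.natDegree_dehom, hF, Φ'.natDegree_dehom]
    exact dehom_inj Φ.F_hom (he ▸ Φ'.F_hom) hF
  -- The degree `d` is recovered as the largest degree of the `kᵢ(1, X)`, since `x` does not divide
  -- all of them.
  · have hle : ∀ {d d' : ℕ} {F F' : MvPolynomial (Fin 2) ℂ} (Φ : NormalForm p q N d F f)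
        (Φ' : NormalForm p q N d' F' f), (∀ i, dehom (Φ.k i) = dehom (Φ'.k i)) → d ≤ d' := by
      intro d d' F F' Φ Φ' h
      obtain ⟨i, hi⟩ := Φ.k_coprime.exists_coeff_ne_zero Φ.k_hom
      rw [h] at hi
      exact (Polynomial.le_natDegree_of_ne_zero hi).trans (natDegree_dehom_le (Φ'.k_hom i))
    exact le_antisymm (hle Φ Φ' hk) (hle Φ' Φ fun i => (hk i).symm)

/-- A normal form of a system of generators makes a supporting line into a face. -/
noncomputable def NormalForm.toFace {p q N d : ℕ} {F : MvPolynomial (Fin 2) ℂ} {r : ℕ}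
    {f : Fin r → PS} (Φ : NormalForm p q N d F f)
    (hF : IsFace (Ideal.span (Set.range f)) p q N) : Face (Ideal.span (Set.range f)) where
  p := p
  q := q
  N := N
  isFace := hF
  F := F
  d := d
  initial_eq := by
    refine ⟨Φ.a, Φ.b, Φ.e, r, Φ.k, Φ.F_hom, ?_, ?_, ?_, Φ.k_hom, Φ.k_coprime, ?_⟩
    · rw [← Φ.F_monic, coeff_dehom Φ.F_hom, if_pos le_rfl]
      congr 1
      apply expo_ext <;> simp
    · rw [X_zero_dvd_iff Φ.F_hom, Φ.F_monic]; exact one_ne_zero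
    · rw [X_one_dvd_iff Φ.F_hom]; exact Φ.F_eval
    · have hle := le_filtration_iff.2 (isFace_iff.1 hF).2.2.2.1
      rw [initialIdeal_eq_span hF.1 hF.2.1 fun i => hle (Ideal.subset_span ⟨i, rfl⟩)]
      congr 2
      funext i
      rw [Φ.initialPart_eq, substPow_mul, mul_assoc _ (substPow p q F)]

end NewtonTrees

namespace NewtonTrees

open MvPowerSeries

/-! ### Existence of the normal form -/

/-- The lattice points on the line are spaced by `(q, -p)`. With `a < q` and `b < p` the common
residues of the coordinates, an initial part is `x^a y^b` times a form of degree `D` in `x^q, y^p`.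
-/
theorem exists_univariate_initialPart {p q N : ℕ} (hp : 0 < p) (hq : 0 < q)
    (hpq : Nat.Coprime p q) {m : Fin 2 →₀ ℕ} (hm : p * m 0 + q * m 1 = N) :
    ∃ a b D : ℕ, p * a + q * b + p * q * D = N ∧ ∀ f : PS, ∃ γ : Polynomial ℂ,
      γ.natDegree ≤ D ∧ initialPart p q N f = X 0 ^ a * X 1 ^ b * substPow p q (homog D γ) := by
  obtain ⟨a, u, ha, hau⟩ : ∃ a u, a < q ∧ m 0 = a + q * u :=
    ⟨m 0 % q, m 0 / q, Nat.mod_lt _ hq, (Nat.mod_add_div _ _).symm⟩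
  obtain ⟨b, t, hb, hbt⟩ : ∃ b t, b < p ∧ m 1 = b + p * t :=
    ⟨m 1 % p, m 1 / p, Nat.mod_lt _ hp, (Nat.mod_add_div _ _).symm⟩
  have hN : p * a + q * b + p * q * (u + t) = N := by rw [← hm, hau, hbt]; ring
  have hline : ∀ m' : Fin 2 →₀ ℕ, p * m' 0 + q * m' 1 = N →
      ∃ i j, i + j = u + t ∧ m' = expo (a + q * i) (b + p * j) := by
    intro m' hm'
    obtain ⟨a', i, ha', hi⟩ : ∃ a' i, a' < q ∧ m' 0 = a' + q * i :=
      ⟨m' 0 % q, m' 0 / q, Nat.mod_lt _ hq, (Nat.mod_add_div _ _).symm⟩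
    obtain ⟨b', j, hb', hj⟩ : ∃ b' j, b' < p ∧ m' 1 = b' + p * j :=
      ⟨m' 1 % p, m' 1 / p, Nat.mod_lt _ hp, (Nat.mod_add_div _ _).symm⟩
    have hN' : p * a' + q * b' + p * q * (i + j) = N := by rw [← hm', hi, hj]; ring
    have haa : a' = a := by
      have h1 : p * a' ≡ p * a [MOD q] := by
        have : p * a' + q * (b' + p * (i + j)) = p * a + q * (b + p * (u + t)) := by
          rw [← hN] at hN'; linarith
        have h2 := congrArg (· % q) this
        simp only [Nat.add_mul_mod_self_left] at h2
        exact h2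
      have h2 : a' ≡ a [MOD q] := Nat.ModEq.cancel_left_of_coprime
        (by rw [Nat.gcd_comm]; exact hpq) h1
      exact Nat.ModEq.eq_of_lt_of_lt h2 ha' ha
    have hbb : b' = b := by
      have h1 : q * b' ≡ q * b [MOD p] := by
        have : q * b' + p * (a' + q * (i + j)) = q * b + p * (a + q * (u + t)) := by
          rw [← hN] at hN'; linarith
        have h2 := congrArg (· % p) this
        simp only [Nat.add_mul_mod_self_left] at h2
        exact h2
      have h2 : b' ≡ b [MOD p] := Nat.ModEq.cancel_left_of_coprime hpq h1
      exact Nat.ModEq.eq_of_lt_of_lt h2 hb' hb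
    subst haa hbb
    refine ⟨i, j, ?_, by rw [← expo_eta m', hi, hj]⟩
    have : p * q * (i + j) = p * q * (u + t) := by omega
    exact Nat.eq_of_mul_eq_mul_left (Nat.mul_pos hp hq) this
  refine ⟨a, b, u + t, hN, fun f => ?_⟩
  let γ : Polynomial ℂ := ∑ j ∈ Finset.range (u + t + 1),
    Polynomial.monomial j (coeff (expo (a + q * (u + t - j)) (b + p * j)) f)
  have hγ : ∀ j, γ.coeff j = if j ≤ u + t then
      coeff (expo (a + q * (u + t - j)) (b + p * j)) f else 0 := by
    intro j
    simp only [γ, Polynomial.finsetSum_coeff, Polynomial.coeff_monomial]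
    rw [Finset.sum_ite_eq' (Finset.range (u + t + 1)) j
      (fun j => coeff (expo (a + q * (u + t - j)) (b + p * j)) f)]
    simp
  have hdeg : γ.natDegree ≤ u + t := by
    rw [Polynomial.natDegree_le_iff_coeff_eq_zero]
    intro j hj
    rw [hγ, if_neg (by omega)]
  refine ⟨γ, hdeg, ?_⟩
  ext m'
  by_cases hm' : p * m' 0 + q * m' 1 = N
  · rw [coeff_initialPart, if_pos hm']
    obtain ⟨i, j, hij, rfl⟩ := hline m' hm'
    rw [coeff_mul_substPow hp hq]
    have h1 := coeff_dehom (isHomogeneous_homog (u + t) γ) j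
    have hi : u + t - j = i := by omega
    rw [dehom_homog hdeg, hγ, if_pos (by omega), if_pos (by omega), hi] at h1
    exact h1
  · rw [coeff_initialPart, if_neg hm']
    by_contra hne
    apply hm'
    rw [isQuasiHomogeneous_mul_substPow (isHomogeneous_homog (u + t) γ) m' (Ne.symm hne), hN]

/-- The initial parts on a face have a normal form. -/
theorem IsFace.exists_normalForm {p q N r : ℕ} {f : Fin r → PS}
    (hF : IsFace (Ideal.span (Set.range f)) p q N) :
    ∃ (d : ℕ) (F : MvPolynomial (Fin 2) ℂ), Nonempty (NormalForm p q N d F f) := by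
  obtain ⟨hp, hq, hpq, hle, m, ⟨g, hg, hm⟩, -, -, -, hmN, -⟩ := isFace_iff.1 hF
  have hfil := le_filtration_iff.2 hle
  obtain ⟨a, b, D, hN, hγ⟩ := exists_univariate_initialPart hp hq hpq hmN
  have hγ' : ∀ i, ∃ γ : Polynomial ℂ, γ.natDegree ≤ D ∧
    initialPart p q N (f i) = X 0 ^ a * X 1 ^ b * substPow p q (homog D γ) := fun i => hγ (f i)
  choose γ hdeg hin using hγ'
  have hexγ : ∃ i, γ i ≠ 0 := by
    by_contra! h0
    obtain ⟨c, rfl⟩ := Ideal.mem_span_range_iff_exists_fun.1 hg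
    have h1 : coeff m (initialPart p q N (∑ i, c i * f i)) = 0 := by
      rw [initialPart_sum_mul hp hq _ _ fun i => hfil (Ideal.subset_span ⟨i, rfl⟩)]
      simp [hin, h0, homog, substPow]
    rw [coeff_initialPart, if_pos hmN] at h1
    exact hm h1
  -- A generator `g'` of the ideal of the `γᵢ` is their greatest common divisor. Removing its factor
  -- `X^b'` and its leading coefficient `l` leaves the face polynomial.
  obtain ⟨g', hg'⟩ := (IsPrincipalIdealRing.principal (Ideal.span (Set.range γ))).principal
  rw [Ideal.submodule_span_eq] at hg'
  have hdvd : ∀ i, g' ∣ γ i := fun i =>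
    Ideal.mem_span_singleton.1 (hg' ▸ Ideal.subset_span ⟨i, rfl⟩)
  have hg0 : g' ≠ 0 := by
    rintro rfl
    obtain ⟨i, hi⟩ := hexγ
    exact hi (zero_dvd_iff.1 (hdvd i))
  obtain ⟨u, hu⟩ := Ideal.mem_span_range_iff_exists_fun.1
    (show g' ∈ Ideal.span (Set.range γ) by rw [hg']; exact Ideal.mem_span_singleton_self _)
  obtain ⟨F₀, hF₀, hF₀'⟩ := Polynomial.exists_eq_pow_rootMultiplicity_mul_and_not_dvd g' hg0 0
  rw [map_zero, sub_zero] at hF₀ hF₀'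
  set b' := Polynomial.rootMultiplicity 0 g'
  have hF₀0 : F₀ ≠ 0 := by rintro rfl; exact hF₀' (dvd_zero _)
  set l := F₀.leadingCoeff with hl
  have hl0 : l ≠ 0 := Polynomial.leadingCoeff_ne_zero.2 hF₀0
  set F₁ := Polynomial.C l⁻¹ * F₀ with hF₁
  have hF₁e : F₁.natDegree = F₀.natDegree := Polynomial.natDegree_C_mul (inv_ne_zero hl0)
  set e := F₀.natDegree with he
  have hlF : F₀ = Polynomial.C l * F₁ := by
    rw [hF₁, ← mul_assoc, ← Polynomial.C_mul, mul_inv_cancel₀ hl0, Polynomial.C_1, one_mul]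
  have hF₁monic : F₁.coeff e = 1 := by
    rw [hF₁, Polynomial.coeff_C_mul, he, Polynomial.coeff_natDegree, ← hl, inv_mul_cancel₀ hl0]
  have hF₁0 : F₁.eval 0 ≠ 0 := by
    intro h
    apply hF₀'
    rw [hlF]
    have := Polynomial.dvd_iff_isRoot.2 h
    rw [map_zero, sub_zero] at this
    exact this.mul_left _
  choose κ hκ using hdvd
  have huκ : ∑ i, u i * κ i = 1 := by
    apply mul_left_cancel₀ hg0
    rw [Finset.mul_sum, mul_one]
    conv_rhs => rw [← hu]
    exact Finset.sum_congr rfl fun i _ => by rw [hκ i]; ring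
  have hκne : (Finset.univ : Finset (Fin r)).Nonempty := by
    obtain ⟨i, -⟩ := hexγ
    exact ⟨i, Finset.mem_univ i⟩
  -- The degree `d` is the largest degree of a cofactor. The case split is needed because the zero
  -- polynomial has `natDegree` zero and could be the maximum found.
  have hdex : ∃ i, κ i ≠ 0 ∧ ∀ j, (κ j).natDegree ≤ (κ i).natDegree := by
    obtain ⟨i, -, hi⟩ := Finset.exists_max_image Finset.univ (fun i => (κ i).natDegree) hκne
    by_cases h0 : κ i = 0
    · obtain ⟨j, hj⟩ := hexγ
      refine ⟨j, fun h => hj (by rw [hκ j, h, mul_zero]), fun j' => ?_⟩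
      have := hi j' (Finset.mem_univ _)
      rw [h0, Polynomial.natDegree_zero] at this
      omega
    · exact ⟨i, h0, fun j => hi j (Finset.mem_univ _)⟩
  obtain ⟨i₀, hi₀, hmax⟩ := hdex
  set d := (κ i₀).natDegree with hd
  have hgF : g' = Polynomial.C l * (Polynomial.X ^ b' * F₁) := by rw [hF₀, hlF]; ring
  have hF₁ne : F₁ ≠ 0 := by rintro h; rw [h] at hF₁0; simp at hF₁0
  have hsum : b' + e + d ≤ D := by
    have h1 := hdeg i₀
    rw [hκ i₀, hgF, Polynomial.natDegree_mul (mul_ne_zero (Polynomial.C_ne_zero.2 hl0)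
      (mul_ne_zero (pow_ne_zero _ Polynomial.X_ne_zero) hF₁ne)) hi₀,
      Polynomial.natDegree_C_mul hl0, Polynomial.natDegree_mul
      (pow_ne_zero _ Polynomial.X_ne_zero) hF₁ne, Polynomial.natDegree_X_pow, hF₁e] at h1
    exact h1
  have hkdeg : ∀ i, (Polynomial.C l * κ i).natDegree ≤ d := fun i => by
    rw [Polynomial.natDegree_C_mul hl0]; exact hmax i
  -- The excess `D - b' - e - d` of the nominal degree is a common power of `x^q`, absorbed in
  -- `x^a`; likewise `X^b'` goes to `y^b`.
  refine ⟨d, homog e F₁, ⟨⟨a + q * (D - b' - e - d), b + p * b', e,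
    fun i => homog d (Polynomial.C l * κ i), isHomogeneous_homog _ _, ?_, ?_,
    fun i => isHomogeneous_homog _ _, ?_, ?_, ?_⟩⟩⟩
  · rw [dehom_homog hF₁e.le, hF₁monic]
  · rwa [dehom_homog hF₁e.le]
  · apply noCommonFactor_of_sum_mul_eq_one (fun i => isHomogeneous_homog _ _)
      (u := fun i => Polynomial.C l⁻¹ * u i)
    · rw [← huκ]
      apply Finset.sum_congr rfl
      intro i _
      rw [dehom_homog (hkdeg i)]
      calc Polynomial.C l⁻¹ * u i * (Polynomial.C l * κ i)
          = (Polynomial.C l⁻¹ * Polynomial.C l) * (u i * κ i) := by ring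
        _ = u i * κ i := by
          rw [← Polynomial.C_mul, inv_mul_cancel₀ hl0, Polynomial.C_1, one_mul]
    · refine ⟨i₀, ?_⟩
      rw [dehom_homog (hkdeg i₀), Polynomial.coeff_C_mul]
      exact mul_ne_zero hl0 (Polynomial.leadingCoeff_ne_zero.2 hi₀)
  · rw [← hN]
    obtain ⟨c, hc⟩ := Nat.exists_eq_add_of_le hsum
    have : D - b' - e - d = c := by omega
    rw [this, hc]; ring
  · intro i
    have hG : homog D (γ i) = MvPolynomial.X 0 ^ (D - b' - e - d) * MvPolynomial.X 1 ^ b' *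
        (homog e F₁ * homog d (Polynomial.C l * κ i)) := by
      apply dehom_inj (isHomogeneous_homog _ _) (D := D)
      · have h1 := (((MvPolynomial.isHomogeneous_X ℂ (0 : Fin 2)).pow (D - b' - e - d)).mul
          ((MvPolynomial.isHomogeneous_X ℂ (1 : Fin 2)).pow b')).mul
          ((isHomogeneous_homog e F₁).mul (isHomogeneous_homog d (Polynomial.C l * κ i)))
        convert h1 using 1
        omega
      · rw [dehom_homog (hdeg i), map_mul, map_mul, map_pow, map_pow, map_mul, dehom_X_zero,
          dehom_X_one, dehom_homog hF₁e.le, dehom_homog (hkdeg i), hκ i, hgF]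
        ring
    rw [hin, hG, substPow_mul, substPow_mul]
    have hX0 : ∀ n, substPow p q (MvPolynomial.X 0 ^ n) = X 0 ^ (q * n) := fun n => by
      simp [substPow, pow_mul]
    have hX1 : ∀ n, substPow p q (MvPolynomial.X 1 ^ n) = X 1 ^ (p * n) := fun n => by
      simp [substPow, pow_mul]
    rw [hX0, hX1, pow_add, pow_add]
    ring

/-! ### Newton maps and multiplicities of roots -/

theorem aeval_mul_of_isHomogeneous {A : Type*} [CommRing A] [Algebra ℂ A]
    {G : MvPolynomial (Fin 2) ℂ} {D : ℕ} (hG : G.IsHomogeneous D) (t W : A) :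
    MvPolynomial.aeval ![t, t * W] G = t ^ D * Polynomial.aeval W (dehom G) := by
  have h1 : Polynomial.aeval W (dehom G) = MvPolynomial.aeval ![1, W] G := by
    have : ((Polynomial.aeval W).comp dehom : MvPolynomial (Fin 2) ℂ →ₐ[ℂ] A) =
        MvPolynomial.aeval ![1, W] := by
      apply MvPolynomial.algHom_ext
      intro i
      fin_cases i <;> simp [dehom]
    exact DFunLike.congr_fun this G
  rw [h1, MvPolynomial.aeval_def, MvPolynomial.aeval_def, MvPolynomial.eval₂_eq',
    MvPolynomial.eval₂_eq', Finset.mul_sum]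
  apply Finset.sum_congr rfl
  intro m hm
  have := sum_eq_of_isHomogeneous hG (MvPolynomial.mem_support_iff.1 hm)
  rw [Fin.prod_univ_two, Fin.prod_univ_two, ← this]
  simp only [Matrix.cons_val_zero, Matrix.cons_val_one, one_pow, one_mul, mul_pow, pow_add]
  ring

namespace NewtonMap

variable (τ : NewtonMap)

theorem toAlgHom_apply (f : PS) : τ.toAlgHom f = subst τ.subs f := substAlgHom_apply _ f

theorem toAlgHom_X_zero : τ.toAlgHom (X 0) = C (τ.μ ^ τ.q') * X 0 ^ τ.p := by
  rw [toAlgHom_apply, subst_X τ.hasSubst_subs]; rfl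

theorem toAlgHom_X_one : τ.toAlgHom (X 1) = X 0 ^ τ.q * (X 1 + C (τ.μ ^ τ.p')) := by
  rw [toAlgHom_apply, subst_X τ.hasSubst_subs]; rfl

theorem toAlgHom_mem_filtration {N : ℕ} {f : PS} (hf : f ∈ filtration τ.p τ.q N) :
    τ.toAlgHom f ∈ filtration 1 0 N := by
  rw [toAlgHom_apply]
  have hX : ∀ n, (X 0 ^ n : PS) ∈ filtration 1 0 n := fun n => by
    simpa using pow_mem_filtration (X_zero_mem_filtration 1 0) n
  exact subst_mem_filtration τ.hasSubst_subs (Ideal.mul_mem_left _ _ (hX _))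
    (Ideal.mul_mem_right _ _ (hX _)) hf

/-- The series on the left is the image of `y^p / x^q` minus `μ`. It vanishes at `y = 0` because `p
p' = q q' + 1`, and to order exactly one because its derivative there is nonzero. -/
theorem exists_sub_eq : ∃ U : PS, constantCoeff U ≠ 0 ∧
    C ((τ.μ ^ (τ.q * τ.q'))⁻¹) * (X 1 + C (τ.μ ^ τ.p')) ^ τ.p - C τ.μ = X 1 * U := by
  have hμ := τ.μ_ne
  refine ⟨C ((τ.μ ^ (τ.q * τ.q'))⁻¹) * ∑ i ∈ Finset.range τ.p,
    (X 1 + C (τ.μ ^ τ.p')) ^ i * C (τ.μ ^ τ.p') ^ (τ.p - 1 - i), ?_, ?_⟩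
  · have : constantCoeff (∑ i ∈ Finset.range τ.p,
        (X 1 + C (τ.μ ^ τ.p') : PS) ^ i * C (τ.μ ^ τ.p') ^ (τ.p - 1 - i)) =
        τ.p * (τ.μ ^ τ.p') ^ (τ.p - 1) := by
      rw [map_sum]
      have h : ∀ i ∈ Finset.range τ.p, constantCoeff
          ((X 1 + C (τ.μ ^ τ.p') : PS) ^ i * C (τ.μ ^ τ.p') ^ (τ.p - 1 - i)) =
          (τ.μ ^ τ.p') ^ (τ.p - 1) := by
        intro i hi
        rw [Finset.mem_range] at hi
        simp only [map_mul, map_pow, map_add, constantCoeff_X, constantCoeff_C, zero_add]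
        rw [← pow_add]
        congr 1
        omega
      rw [Finset.sum_congr rfl h]
      simp
    rw [map_mul, this, constantCoeff_C]
    have hp : (τ.p : ℂ) ≠ 0 := by exact_mod_cast τ.p_pos.ne'
    positivity
  · have h := geom_sum₂_mul (X 1 + C (τ.μ ^ τ.p') : PS) (C (τ.μ ^ τ.p')) τ.p
    rw [add_sub_cancel_right] at h
    have h2 : C τ.μ = C ((τ.μ ^ (τ.q * τ.q'))⁻¹) * (C (τ.μ ^ τ.p') ^ τ.p : PS) := by
      rw [← map_pow, ← map_mul, ← pow_mul, mul_comm τ.p', τ.bezout, pow_succ, ← mul_assoc,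
        inv_mul_cancel₀ (pow_ne_zero _ hμ), one_mul]
    rw [h2, ← mul_sub, ← h]
    ring

/-- Up to a unit, the Newton map replaces `y^p - μ x^q` by `x^(pq) y` and the other factors by
powers of `x`. Only the multiplicity of `μ` survives. -/
theorem exists_toAlgHom_eq {a b D : ℕ} {G : MvPolynomial (Fin 2) ℂ} (hG : G.IsHomogeneous D)
    (hG0 : G ≠ 0) : ∃ U : PS, constantCoeff U ≠ 0 ∧
      τ.toAlgHom (X 0 ^ a * X 1 ^ b * substPow τ.p τ.q G) =
        X 0 ^ (τ.p * a + τ.q * b + τ.p * τ.q * D) *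
          (X 1 ^ (dehom G).rootMultiplicity τ.μ * U) := by
  have hμ := τ.μ_ne
  have hd0 : dehom G ≠ 0 := fun h => hG0
    (dehom_inj hG (MvPolynomial.isHomogeneous_zero _ _ _) (by rw [h, map_zero]))
  obtain ⟨H, hH, hH'⟩ := Polynomial.exists_eq_pow_rootMultiplicity_mul_and_not_dvd _ hd0 τ.μ
  obtain ⟨V, hV, hV'⟩ := τ.exists_sub_eq
  set u := τ.μ ^ (τ.q * τ.q') with hu
  set W : PS := C u⁻¹ * (X 1 + C (τ.μ ^ τ.p')) ^ τ.p with hW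
  have hu0 : u ≠ 0 := pow_ne_zero _ hμ
  have hsub : τ.toAlgHom (substPow τ.p τ.q G) =
      (C u * X 0 ^ (τ.p * τ.q)) ^ D * Polynomial.aeval W (dehom G) := by
    rw [substPow, MvPolynomial.comp_aeval_apply, ← aeval_mul_of_isHomogeneous hG]
    congr 2
    funext i
    fin_cases i
    · simp [τ.toAlgHom_X_zero, mul_pow, ← pow_mul, hu]
      left; ring
    · have : (C u * C u⁻¹ : PS) = 1 := by rw [← map_mul, mul_inv_cancel₀ hu0, map_one]
      change τ.toAlgHom (X 1 ^ τ.p) = C u * X 0 ^ (τ.p * τ.q) * W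
      rw [map_pow, τ.toAlgHom_X_one, mul_pow, ← pow_mul]
      calc (X 0 ^ (τ.q * τ.p) * (X 1 + C (τ.μ ^ τ.p')) ^ τ.p : PS)
          = (C u * C u⁻¹) * (X 0 ^ (τ.q * τ.p) * (X 1 + C (τ.μ ^ τ.p')) ^ τ.p) := by
            rw [this, one_mul]
        _ = _ := by rw [hW, mul_comm τ.q]; ring
  have hconstW : Polynomial.aeval W (dehom G) =
      (X 1 * V) ^ (dehom G).rootMultiplicity τ.μ * Polynomial.aeval W H := by
    conv_lhs => rw [hH]
    rw [map_mul, map_pow, map_sub, Polynomial.aeval_X, Polynomial.aeval_C,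
      MvPowerSeries.algebraMap_apply]
    simp only [Algebra.algebraMap_self, RingHom.id_apply]
    rw [hV']
  have hccW : constantCoeff W = τ.μ := by
    have := congrArg constantCoeff hV'
    rw [map_sub, map_mul (constantCoeff : PS →+* ℂ) (X 1), constantCoeff_X, constantCoeff_C,
      zero_mul] at this
    exact sub_eq_zero.1 this
  have hccH : constantCoeff (Polynomial.aeval W H) ≠ 0 := by
    have : constantCoeff (Polynomial.aeval W H) = H.eval τ.μ := by
      rw [Polynomial.aeval_def, Polynomial.hom_eval₂, hccW]
      have : (constantCoeff : PS →+* ℂ).comp (algebraMap ℂ PS) = RingHom.id ℂ := by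
        ext c
        simp [MvPowerSeries.algebraMap_apply]
      rw [this, Polynomial.eval]
    rw [this]
    exact fun h => hH' (Polynomial.dvd_iff_isRoot.2 h)
  refine ⟨C (τ.μ ^ τ.q') ^ a * (X 1 + C (τ.μ ^ τ.p')) ^ b * C u ^ D *
    V ^ (dehom G).rootMultiplicity τ.μ * Polynomial.aeval W H, ?_, ?_⟩
  · simp only [map_mul, map_pow, map_add, constantCoeff_X, constantCoeff_C, zero_add]
    have := pow_ne_zero D hu0
    have h1 := pow_ne_zero (dehom G |>.rootMultiplicity τ.μ) hV
    exact mul_ne_zero (mul_ne_zero (mul_ne_zero (mul_ne_zero (by positivity) (by positivity)) this)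
      h1) hccH
  · rw [map_mul, map_mul, map_pow, map_pow, hsub, hconstW, τ.toAlgHom_X_zero, τ.toAlgHom_X_one]
    simp only [mul_pow, pow_add, ← pow_mul]
    ring

/-- The part of lowest degree in `x` of the transform of a series. -/
theorem coeff_toAlgHom {N a b D : ℕ} {f : PS} (hf : f ∈ filtration τ.p τ.q N)
    {G : MvPolynomial (Fin 2) ℂ} (hG : G.IsHomogeneous D) (hG0 : G ≠ 0)
    (hin : initialPart τ.p τ.q N f = X 0 ^ a * X 1 ^ b * substPow τ.p τ.q G)
    (hN : τ.p * a + τ.q * b + τ.p * τ.q * D = N) :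
    (∀ j < (dehom G).rootMultiplicity τ.μ, coeff (expo N j) (τ.toAlgHom f) = 0) ∧
      coeff (expo N ((dehom G).rootMultiplicity τ.μ)) (τ.toAlgHom f) ≠ 0 := by
  obtain ⟨U, hU, hU'⟩ := τ.exists_toAlgHom_eq (a := a) (b := b) hG hG0
  rw [hN, ← hin] at hU'
  have key : ∀ j, coeff (expo N j) (τ.toAlgHom f) =
      coeff (expo 0 j) (X 1 ^ (dehom G).rootMultiplicity τ.μ * U) := by
    intro j
    have h1 := τ.toAlgHom_mem_filtration (sub_initialPart_mem_filtration hf)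
    have h2 := coeff_eq_zero_of_mem_filtration h1 (m := expo N j) (by simp)
    rw [map_sub, map_sub, sub_eq_zero] at h2
    rw [h2, hU']
    simpa using coeff_X_zero_pow_mul N 0 j _
  constructor
  · intro j hj
    rw [key]
    apply coeff_eq_zero_of_mem_filtration (a := 0) (b := 1)
      (Ideal.mul_mem_right _ _ (pow_mem_filtration (X_one_mem_filtration 0 1) _))
    simpa using hj
  · rw [key]
    have := coeff_X_one_pow_mul ((dehom G).rootMultiplicity τ.μ) 0 0 U
    rw [add_zero, expo_zero_zero, coeff_zero_eq_constantCoeff_apply] at this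
    rwa [this]

theorem mapIdeal_span {r : ℕ} (f : Fin r → PS) :
    τ.mapIdeal (Ideal.span (Set.range f)) = Ideal.span (Set.range fun i => τ.toAlgHom (f i)) := by
  rw [mapIdeal, Ideal.map_span, ← Set.range_comp]
  rfl

end NewtonMap

/-- The upper vertex of the Newton diagram of the transform of an ideal. -/
theorem NormalForm.topOrder_mapIdeal {p q N d : ℕ} {F : MvPolynomial (Fin 2) ℂ} {r : ℕ}
    {f : Fin r → PS} (Φ : NormalForm p q N d F f) (hf : ∀ i, f i ∈ filtration p q N)
    (τ : NewtonMap) (hp : τ.p = p) (hq : τ.q = q) :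
    expo N ((dehom F).rootMultiplicity τ.μ) ∈ idealSupport
      (τ.mapIdeal (Ideal.span (Set.range f))) ∧
    topOrder (τ.mapIdeal (Ideal.span (Set.range f))) = N ∧
    height (τ.mapIdeal (Ideal.span (Set.range f))) = (dehom F).rootMultiplicity τ.μ := by
  subst hp hq
  set n := (dehom F).rootMultiplicity τ.μ with hn
  have hF0 : dehom F ≠ 0 := Φ.dehom_monic.ne_zero
  -- On the column `α = N`, the transform of each generator starts at the multiplicity of `μ` in `F
  -- kᵢ`, which is at least that in `F`. Equality occurs for any `kᵢ` not vanishing at `μ`. If `F kᵢ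
  -- = 0` the whole column vanishes.
  have hrow : ∀ i, ∀ j < n, coeff (expo N j) (τ.toAlgHom (f i)) = 0 := by
    intro i j hj
    by_cases h0 : F * Φ.k i = 0
    · have h1 : f i ∈ filtration τ.p τ.q (N + 1) := by
        have := sub_initialPart_mem_filtration (hf i)
        rw [Φ.initialPart_eq, h0] at this
        simpa [substPow] using this
      exact coeff_eq_zero_of_mem_filtration (τ.toAlgHom_mem_filtration h1) (by simp)
    · refine (τ.coeff_toAlgHom (hf i) (Φ.mul_hom i) h0 (Φ.initialPart_eq i) Φ.weight_eq).1 j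
        (hj.trans_le ?_)
      have h1 : dehom (F * Φ.k i) ≠ 0 := fun h => h0
        (dehom_inj (Φ.mul_hom i) (MvPolynomial.isHomogeneous_zero _ _ _) (by rw [h, map_zero]))
      rw [map_mul] at h1 ⊢
      rw [Polynomial.rootMultiplicity_mul h1]
      exact Nat.le_add_right _ _
  have hmem : expo N n ∈ idealSupport (τ.mapIdeal (Ideal.span (Set.range f))) := by
    obtain ⟨i, hi⟩ := Φ.k_coprime.exists_eval_ne_zero Φ.k_hom τ.μ
    have hk0 : dehom (Φ.k i) ≠ 0 := by rintro h; simp [h] at hi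
    have h1 : dehom (F * Φ.k i) ≠ 0 := by rw [map_mul]; exact mul_ne_zero hF0 hk0
    have h0 : F * Φ.k i ≠ 0 := by rintro h; simp [h] at h1
    have h2 := (τ.coeff_toAlgHom (hf i) (Φ.mul_hom i) h0 (Φ.initialPart_eq i) Φ.weight_eq).2
    rw [map_mul] at h1 h2
    rw [Polynomial.rootMultiplicity_mul h1, Polynomial.rootMultiplicity_eq_zero hi, add_zero] at h2
    rw [τ.mapIdeal_span]
    exact ⟨_, Ideal.subset_span ⟨i, rfl⟩, h2⟩
  have hle : τ.mapIdeal (Ideal.span (Set.range f)) ≤ filtration 1 0 N := by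
    rw [τ.mapIdeal_span, Ideal.span_le]
    rintro _ ⟨i, rfl⟩
    exact τ.toAlgHom_mem_filtration (hf i)
  refine ⟨hmem, topOrder_eq_and_height_eq hle ?_ hmem⟩
  rw [τ.mapIdeal_span, Ideal.span_le]
  rintro _ ⟨i, rfl⟩ m hm
  have h1 : N ≤ m 0 := by simpa using τ.toAlgHom_mem_filtration (hf i) m hm
  -- Right of the column `N` the weight bound is automatic; on that column it is `hrow`.
  rcases Nat.lt_or_ge N (m 0) with h2 | h2
  · have : n * (N + 1) ≤ n * m 0 := Nat.mul_le_mul_left _ h2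
    rw [Nat.mul_succ] at this
    omega
  · have h3 : N = m 0 := le_antisymm h1 h2
    have h4 : n ≤ m 1 := by
      by_contra hlt
      apply hm
      rw [← expo_eta m, ← h3]
      exact hrow i _ (not_le.1 hlt)
    rw [h3]
    omega

end NewtonTrees

namespace NewtonTrees

open MvPowerSeries

/-! ### Ideals of depth zero -/

theorem IsXSeries.mem_filtration {h : PS} (hh : IsXSeries h) {a b : ℕ} :
    h ∈ filtration a b a := by
  intro m hm
  have := Nat.mul_le_mul_left a (Nat.one_le_iff_ne_zero.2 (hh m hm).2)
  omega

theorem IsXSeries.mem_filtration_one {h : PS} (hh : IsXSeries h) {a b : ℕ} (ha : 0 < a) :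
    h ∈ filtration a b 1 := filtration_anti ha hh.mem_filtration

theorem coeff_X_add_pow {h : PS} (hh : IsXSeries h) (n : ℕ) :
    coeff (expo 0 n) ((X 1 + h) ^ n) = 1 := by
  have h1 : (X 1 + h) ^ n - X 1 ^ n ∈ filtration 1 0 1 := by
    obtain ⟨c, hc⟩ := sub_dvd_pow_sub_pow (X 1 + h) (X 1 : PS) n
    rw [hc, add_sub_cancel_left]
    exact Ideal.mul_mem_right _ _ hh.mem_filtration
  have h2 := coeff_eq_zero_of_mem_filtration h1 (m := expo 0 n) (by simp)
  rw [map_sub, sub_eq_zero] at h2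
  rw [h2]
  have := coeff_X_one_pow_mul n 0 0 1
  rw [add_zero, mul_one, expo_zero_zero, coeff_zero_one] at this
  exact this

theorem IsMonomialLike.ne_bot {I : Ideal PS} {k n : ℕ} (hI : IsMonomialLike I k n) : I ≠ ⊥ := by
  obtain ⟨h, hh, rfl⟩ := hI
  rw [Ne, Ideal.span_singleton_eq_bot]
  intro h0
  have := congrArg (coeff (expo k n)) h0
  have h1 := coeff_X_zero_pow_mul k 0 n ((X 1 + h) ^ n)
  rw [add_zero] at h1
  rw [h1, coeff_X_add_pow hh, map_zero] at this
  exact one_ne_zero this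

theorem IsMonomialLike.topOrder_eq {I : Ideal PS} {k n : ℕ} (hI : IsMonomialLike I k n) :
    topOrder I = k ∧ height I = n := by
  obtain ⟨h, hh, rfl⟩ := hI
  have h1 := coeff_X_zero_pow_mul k 0 n ((X 1 + h) ^ n)
  rw [add_zero, coeff_X_add_pow hh] at h1
  apply topOrder_eq_and_height_eq
  · rw [Ideal.span_singleton_le_iff_mem]
    apply Ideal.mul_mem_right
    simpa using pow_mem_filtration (X_zero_mem_filtration 1 0) k
  · rw [Ideal.span_singleton_le_iff_mem]
    apply mul_mem_filtration (pow_mem_filtration (X_zero_mem_filtration n 1) k)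
    rcases Nat.eq_zero_or_pos n with rfl | hn
    · exact mem_filtration_zero _ _ _
    · simpa using pow_mem_filtration (add_mem (X_one_mem_filtration n 1)
        (hh.mem_filtration_one hn)) n
  · exact ⟨_, Ideal.subset_span rfl, by rw [h1]; exact one_ne_zero⟩

theorem shear_mem_filtration_top {h : PS} (hh : IsXSeries h) {k : ℕ} {f : PS}
    (hf : f ∈ filtration 1 0 k) : shear hh f ∈ filtration 1 0 k :=
  shear_mem_filtration hh (mem_filtration_zero _ _ _) hf

/-- The coefficient at the upper vertex is invariant under shears. -/
theorem coeff_shear {h : PS} (hh : IsXSeries h) {k n : ℕ} {f : PS}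
    (hf : ∀ m, coeff m f ≠ 0 → k ≤ m 0 ∧ (m 0 = k → n ≤ m 1)) :
    coeff (expo k n) (shear hh f) = coeff (expo k n) f := by
  classical
  set u := coeff (expo k n) f with hu
  -- For the weights `(n + 1, 1)` the point `(k, n)` is strictly lighter than all other support
  -- points, and shears respect these weights.
  have hr : f - C u * (X 0 ^ k * X 1 ^ n) ∈ filtration (n + 1) 1 ((n + 1) * k + n + 1) := by
    intro m hm
    rw [map_sub, coeff_C_mul, X_pow_mul_X_pow_eq, coeff_monomial] at hm
    split_ifs at hm with heq
    · rw [heq, ← hu, mul_one, sub_self] at hm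
      exact absurd rfl hm
    · rw [mul_zero, sub_zero] at hm
      obtain ⟨h1, h2⟩ := hf m hm
      rcases h1.lt_or_eq with h3 | h3
      · have : (n + 1) * (k + 1) ≤ (n + 1) * m 0 := Nat.mul_le_mul_left _ h3
        rw [Nat.mul_succ] at this
        omega
      · have h4 := h2 h3.symm
        have h5 : n ≠ m 1 := fun h => heq (expo_ext (by simp [h3]) (by simp [h]))
        rw [h3]
        omega
  have hr' := shear_mem_filtration hh (hh.mem_filtration_one (Nat.succ_pos n)) hr
  have h2 := coeff_eq_zero_of_mem_filtration hr' (m := expo k n) (by simp)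
  rw [map_sub, map_sub, sub_eq_zero] at h2
  have hC : shear hh (C u) = C u := by
    have := (shear hh).commutes u
    simpa [MvPowerSeries.algebraMap_apply] using this
  rw [h2, map_mul (shear hh), map_mul (shear hh), map_pow, map_pow, hC, shear_X_zero, shear_X_one, coeff_C_mul]
  have h3 := coeff_X_zero_pow_mul k 0 n ((X 1 + h) ^ n)
  rw [add_zero] at h3
  rw [h3, coeff_X_add_pow hh, mul_one]

theorem top_of_mem {I : Ideal PS} {f : PS} (hf : f ∈ I) (m : Fin 2 →₀ ℕ) (hm : coeff m f ≠ 0) :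
    topOrder I ≤ m 0 ∧ (m 0 = topOrder I → height I ≤ m 1) :=
  ⟨topOrder_le ⟨f, hf, hm⟩, height_le ⟨f, hf, hm⟩⟩

theorem mem_filtration_topOrder {I : Ideal PS} {f : PS} (hf : f ∈ I) :
    f ∈ filtration 1 0 (topOrder I) := fun m hm => by simpa using (top_of_mem hf m hm).1

/-- An ideal has depth zero as soon as a shear makes it divisible by the expected power of `y`. -/
theorem isMonomialLike_of_shear_mem {I : Ideal PS} (hI : I ≠ ⊥) {h : PS} (hh : IsXSeries h)
    (hf : ∀ f ∈ I, shear hh f ∈ filtration 0 1 (height I)) :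
    IsMonomialLike I (topOrder I) (height I) := by
  have hdiv : ∀ f ∈ I, ∃ B, shear hh f = X 0 ^ topOrder I * X 1 ^ height I * B := by
    intro f hfI
    obtain ⟨A, hA⟩ := exists_eq_X_zero_pow_mul
      (shear_mem_filtration_top hh (mem_filtration_topOrder hfI))
    have hA' : A ∈ filtration 0 1 (height I) := by
      intro m hm
      rw [← expo_eta m, ← coeff_X_zero_pow_mul (topOrder I), ← hA] at hm
      simpa using hf f hfI _ hm
    obtain ⟨B, rfl⟩ := exists_eq_X_one_pow_mul hA'
    exact ⟨B, by rw [hA, mul_assoc]⟩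
  have hback : shear hh.neg (X 0 ^ topOrder I * X 1 ^ height I) =
      X 0 ^ topOrder I * (X 1 + -h) ^ height I := by
    rw [map_mul, map_pow, map_pow, shear_X_zero, shear_X_one]
  refine ⟨-h, hh.neg, le_antisymm ?_ ?_⟩
  · intro f hfI
    obtain ⟨B, hB⟩ := hdiv f hfI
    rw [Ideal.mem_span_singleton, ← hback, ← shear_neg_shear hh f, hB,
      map_mul (shear hh.neg) _ B]
    exact dvd_mul_right _ _
  · rw [Ideal.span_singleton_le_iff_mem]
    obtain ⟨f, hfI, hf0⟩ := expo_height_mem hI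
    obtain ⟨B, hB⟩ := hdiv f hfI
    -- For an `f` attaining the upper vertex, invariance of that coefficient makes the cofactor a
    -- unit, so `f` alone generates the ideal.
    have hB0 : constantCoeff B ≠ 0 := by
      rw [← coeff_shear hh (top_of_mem hfI), hB, X_pow_mul_X_pow_eq] at hf0
      have := coeff_add_monomial_mul (expo (topOrder I) (height I)) 0 B 1
      rw [add_zero, one_mul, coeff_zero_eq_constantCoeff_apply] at this
      rwa [this] at hf0
    obtain ⟨v, hv⟩ := (MvPowerSeries.isUnit_iff_constantCoeff.2 (isUnit_iff_ne_zero.2 hB0)).exists_right_inv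
    have : X 0 ^ topOrder I * (X 1 + -h) ^ height I = f * shear hh.neg v := by
      rw [← hback, ← shear_neg_shear hh f, hB, ← map_mul, mul_assoc, hv, mul_one]
    rw [this]
    exact I.mul_mem_right _ hfI

theorem IsMonomialLike.exists_shear_mem {I : Ideal PS} {k n : ℕ} (hI : IsMonomialLike I k n) :
    ∃ (h : PS) (hh : IsXSeries h), ∀ f ∈ I, shear hh f ∈ filtration 0 1 n := by
  obtain ⟨h, hh, rfl⟩ := hI
  refine ⟨-h, hh.neg, fun f hf => ?_⟩
  obtain ⟨c, rfl⟩ := Ideal.mem_span_singleton.1 hf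
  rw [map_mul, map_mul, map_pow, map_pow, map_add, shear_X_one, shear_eq_self hh.neg hh,
    neg_add_cancel_right]
  apply Ideal.mul_mem_right
  apply Ideal.mul_mem_left
  simpa using pow_mem_filtration (X_one_mem_filtration 0 1) n

/-- An ideal whose Newton diagram has a single vertex has depth zero. -/
theorem isMonomialLike_of_height_le {I : Ideal PS} (hI : I ≠ ⊥) (h : height I ≤ bottomOrder I) :
    IsMonomialLike I (topOrder I) (height I) := by
  apply isMonomialLike_of_shear_mem hI IsXSeries.zero
  intro f hf m hm
  rw [shear_zero] at hm
  have := bottomOrder_le (I := I) ⟨f, hf, hm⟩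
  omega

/-! ### Contact with smooth curves -/

/-- No smooth curve `y = h(x)` has contact at least `K` with the ideal along its upper vertex. -/
def ContactLT (I : Ideal PS) (K : ℕ) : Prop :=
  ∀ (h : PS) (hh : IsXSeries h), ∃ f ∈ I,
    shear hh f ∉ filtration 1 K (topOrder I + K * height I)

/-- Modulo `y` the power is `δ ^ n`, whose lowest term in `x` is the `n`-th power of that of `δ`. -/
theorem coeff_X_add_pow_of_order {δ : PS} {e : ℕ} (hδ : δ ∈ filtration 1 0 e) (n : ℕ) :
    coeff (expo (e * n) 0) ((X 1 + δ) ^ n) = coeff (expo e 0) δ ^ n := by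
  have h1 : (X 1 + δ) ^ n - δ ^ n ∈ filtration 0 1 1 := by
    obtain ⟨c, hc⟩ := sub_dvd_pow_sub_pow (X 1 + δ) δ n
    rw [hc, add_sub_cancel_right]
    exact Ideal.mul_mem_right _ _ (X_one_mem_filtration 0 1)
  have h2 := coeff_eq_zero_of_mem_filtration h1 (m := expo (e * n) 0) (by simp)
  rw [map_sub, sub_eq_zero] at h2
  obtain ⟨A, rfl⟩ := exists_eq_X_zero_pow_mul hδ
  have h3 := coeff_X_zero_pow_mul (e * n) 0 0 (A ^ n)
  have h4 := coeff_X_zero_pow_mul e 0 0 A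
  rw [add_zero, expo_zero_zero, coeff_zero_eq_constantCoeff_apply] at h3 h4
  rw [h2, h4, mul_pow, ← pow_mul, h3, map_pow]

/-- Two shears realizing contact `K` agree up to order `K`. -/
theorem sub_mem_filtration_of_shear {I : Ideal PS} (hI : I ≠ ⊥) (hpos : 0 < height I) {K K' : ℕ}
    (hKK : K ≤ K') {h h' : PS} (hh : IsXSeries h) (hh' : IsXSeries h')
    (hK : ∀ f ∈ I, shear hh f ∈ filtration 1 K (topOrder I + K * height I))
    (hK' : ∀ f ∈ I, shear hh' f ∈ filtration 1 K' (topOrder I + K' * height I)) :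
    h' - h ∈ filtration 1 0 K := by
  classical
  by_contra hcon
  have hδ : IsXSeries (h' - h) := hh'.sub hh
  set δ := h' - h with hδdef
  -- Let `e` be the order of `δ`, and suppose `e < K`.
  obtain ⟨e, he, hemin⟩ : ∃ e, coeff (expo e 0) δ ≠ 0 ∧ ∀ m, coeff m δ ≠ 0 → e ≤ m 0 := by
    have hex : ∃ e, coeff (expo e 0) δ ≠ 0 := by
      by_contra! h0
      apply hcon
      intro m hm
      exfalso
      apply hm
      rw [← expo_eta m, (hδ m hm).1]
      exact h0 _
    refine ⟨Nat.find hex, Nat.find_spec hex, fun m hm => Nat.find_min' hex ?_⟩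
    rwa [← (hδ m hm).1, expo_eta]
  have hδe : δ ∈ filtration 1 0 e := fun m hm => by simpa using hemin m hm
  have he0 : 0 < e := Nat.pos_of_ne_zero (by simpa using (hδ _ he).2)
  have heK : e < K := by
    by_contra hle
    exact hcon (filtration_anti (not_lt.1 hle) hδe)
  obtain ⟨f, hf, hf0⟩ := expo_height_mem hI
  set k := topOrder I
  set n := height I
  rw [← coeff_shear hh (top_of_mem hf)] at hf0
  set f' := shear hh f with hf'
  have hf'K := hK f hf
  have hf'k : f' ∈ filtration 1 0 k := shear_mem_filtration_top hh (mem_filtration_topOrder hf)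
  have hcomp : shear hδ f' = shear hh' f := by
    rw [hf', shear_shear]
    have : ∀ {g g' : PS} (hg : IsXSeries g) (hg' : IsXSeries g'), g = g' →
        shear hg f = shear hg' f := by rintro g _ hg hg' rfl; rfl
    exact this _ _ (by rw [hδdef]; ring)
  set u := coeff (expo k n) f' with hu
  -- Contact `K > e` makes `(k, n)` the only point of minimal weight for the weights `(1, e)`.
  have hr : f' - C u * (X 0 ^ k * X 1 ^ n) ∈ filtration 1 e (k + e * n + 1) := by
    intro m hm
    rw [map_sub, coeff_C_mul, X_pow_mul_X_pow_eq, coeff_monomial] at hm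
    split_ifs at hm with heq
    · rw [heq, ← hu, mul_one, sub_self] at hm
      exact absurd rfl hm
    · rw [mul_zero, sub_zero] at hm
      have h1 := hf'K m hm
      have h2 : k ≤ m 0 := by simpa using hf'k m hm
      rw [one_mul] at h1 ⊢
      obtain ⟨a, ha⟩ := Nat.exists_eq_add_of_le h2
      rcases lt_trichotomy (m 1) n with h3 | h3 | h3
      · obtain ⟨b, hb⟩ := Nat.exists_eq_add_of_lt h3
        have h4 : K * (b + 1) ≤ a := by
          rw [hb, ha] at h1
          nlinarith
        have h5 : e * (b + 1) < K * (b + 1) := Nat.mul_lt_mul_of_pos_right heK (Nat.succ_pos _)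
        rw [hb, ha]
        nlinarith
      · have h5 : k ≠ m 0 := fun h => heq (expo_ext (by simp [h]) (by simp [h3]))
        rw [h3]
        omega
      · have : e * (n + 1) ≤ e * m 1 := Nat.mul_le_mul_left _ h3
        rw [Nat.mul_succ] at this
        omega
  have hr' := shear_mem_filtration hδ (b := e)
    (fun m hm => by have := hδe m hm; omega) hr
  have h2 := coeff_eq_zero_of_mem_filtration hr' (m := expo (k + e * n) 0) (by simp)
  rw [map_sub, map_sub, sub_eq_zero] at h2
  have hC : shear hδ (C u) = C u := by
    have := (shear hδ).commutes u
    simpa [MvPowerSeries.algebraMap_apply] using this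
  rw [hcomp, map_mul (shear hδ), map_mul (shear hδ), map_pow, map_pow, hC, shear_X_zero,
    shear_X_one, coeff_C_mul,
    coeff_X_zero_pow_mul, coeff_X_add_pow_of_order hδe] at h2
  -- The shear by `δ` creates the monomial `x^(k + e n)`, with coefficient `u` times the `n`-th
  -- power of the leading coefficient of `δ`. Contact `K' > e` forbids it.
  have h3 := hK' f hf (expo (k + e * n) 0) (by rw [h2]; exact mul_ne_zero hf0 (pow_ne_zero _ he))
  simp only [expo_apply_zero, expo_apply_one, mul_zero, add_zero, one_mul] at h3
  have h4 : e * n < K' * n := Nat.mul_lt_mul_of_pos_right (heK.trans_le hKK) hpos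
  omega

/-- If the contact with smooth curves is unbounded, the ideal has depth zero. -/
theorem exists_contactLT {I : Ideal PS} (hI : I ≠ ⊥) (hd : ¬ IsDepthZero I) :
    ∃ K, ContactLT I K := by
  by_contra! hcon
  apply hd
  refine ⟨topOrder I, height I, ?_⟩
  rcases Nat.eq_zero_or_pos (height I) with h0 | hpos
  · apply isMonomialLike_of_shear_mem hI IsXSeries.zero
    intro f _
    rw [h0]
    exact mem_filtration_zero _ _ _
  unfold ContactLT at hcon
  push Not at hcon
  choose g hg hgK using hcon
  -- The limit curve: contact `K` fixes the coefficients of index below `K`, so the coefficient of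
  -- `x^i` is read off at contact `i + 1`.
  let h : PS := fun m => coeff m (g (m 0 + 1))
  have hcoeff : ∀ m, coeff m h = coeff m (g (m 0 + 1)) := fun m => rfl
  have hh : IsXSeries h := fun m hm => hg _ m hm
  have hsub : ∀ K, h - g K ∈ filtration 1 K K := by
    intro K m hm
    by_contra hlt
    have hm0 : m 0 + 1 ≤ K := by
      rw [not_le, one_mul] at hlt
      omega
    have h1 := coeff_eq_zero_of_mem_filtration (sub_mem_filtration_of_shear hI hpos hm0
      (hg (m 0 + 1)) (hg K) (hgK _) (hgK _)) (m := m) (by simp)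
    rw [map_sub, sub_eq_zero] at h1
    rw [map_sub, hcoeff, h1, sub_self] at hm
    exact hm rfl
  have hall : ∀ K, ∀ f ∈ I, shear hh f ∈ filtration 1 K (topOrder I + K * height I) := by
    intro K f hf
    have h1 := shear_mem_filtration (hh.sub (hg K)) (hsub K) (hgK K f hf)
    rw [shear_shear] at h1
    have : ∀ {g g' : PS} (hg : IsXSeries g) (hg' : IsXSeries g'), g = g' →
        shear hg f = shear hg' f := by rintro g _ hg hg' rfl; rfl
    rwa [this _ hh (by ring)] at h1
  apply isMonomialLike_of_shear_mem hI hh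
  intro f hf m hm
  by_contra hlt
  rw [not_le, zero_mul, zero_add, one_mul] at hlt
  -- A monomial with ordinate below the height violates contact `K` once `K` exceeds its abscissa.
  have h1 := hall (m 0 + 1) f hf m hm
  have h2 : (m 0 + 1) * (m 1 + 1) ≤ (m 0 + 1) * height I := Nat.mul_le_mul_left _ hlt
  rw [Nat.mul_succ] at h2
  omega

/-! ### Newton maps with `p = 1` -/

namespace NewtonMap

variable (τ : NewtonMap)

/-- For `p = 1` the normalization gives `q' = 0` and `p' = 1`. The Newton map is then the shear by
`μ x^q` followed by the dilation, and moving a further shear by `h` across the dilation multiplies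
`h` by `x^q`. -/
theorem shear_toAlgHom (hp : τ.p = 1) {h : PS} (hh : IsXSeries h) :
    ∃ (h' : PS) (hh' : IsXSeries h'), ∀ f,
      shear hh (τ.toAlgHom f) = subst (dilationSubst τ.q) (shear hh' f) := by
  classical
  have hq' : τ.q' = 0 := by have := τ.q'_lt; omega
  have hp' : τ.p' = 1 := by have := τ.bezout; rw [hp, hq'] at this; omega
  have hh' : IsXSeries (X 0 ^ τ.q * (h + C τ.μ)) := by
    intro m hm
    have h1 : X 0 ^ τ.q * (h + C τ.μ) ∈ filtration 1 0 τ.q :=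
      Ideal.mul_mem_right _ _ (by simpa using pow_mem_filtration (X_zero_mem_filtration 1 0) τ.q)
    have h2 : τ.q ≤ m 0 := by simpa using h1 m hm
    have hq := τ.q_pos
    refine ⟨?_, by omega⟩
    obtain ⟨c, hc⟩ := Nat.exists_eq_add_of_le h2
    rw [← expo_eta m, hc, coeff_X_zero_pow_mul, map_add] at hm
    by_contra h1
    apply hm
    have h3 : coeff (expo c (m 1)) h = 0 := by
      by_contra h3
      exact h1 (by simpa using (hh _ h3).1)
    rw [h3, coeff_C, if_neg, add_zero]
    intro h4
    apply h1
    simpa using DFunLike.congr_fun h4 1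
  refine ⟨_, hh', fun f => ?_⟩
  have hsh := hasSubst_shearSubst hh
  have hsh' := hasSubst_shearSubst hh'
  have hdil := hasSubst_dilationSubst τ.q
  rw [shear_apply hh, shear_apply hh', τ.toAlgHom_apply, subst_comp_subst_apply τ.hasSubst_subs hsh,
    subst_comp_subst_apply hsh' hdil]
  congr 1
  funext i
  have hD0 : ∀ n, subst (dilationSubst τ.q) (X 0 ^ n : PS) = X 0 ^ n := by
    intro n
    rw [subst_pow hdil, subst_X hdil]; rfl
  have hD1 : subst (dilationSubst τ.q) (X 1 : PS) = X 0 ^ τ.q * X 1 := by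
    rw [subst_X hdil]; rfl
  fin_cases i
  · change subst (shearSubst h) (C (τ.μ ^ τ.q') * X 0 ^ τ.p : PS) =
      subst (dilationSubst τ.q) (X 0 : PS)
    have := hD0 1
    rw [pow_one] at this
    rw [this, hq', hp, pow_zero, pow_one, map_one, one_mul, ← shear_apply hh, shear_X_zero]
  · change subst (shearSubst h) (X 0 ^ τ.q * (X 1 + C (τ.μ ^ τ.p')) : PS) =
      subst (dilationSubst τ.q) (X 1 + X 0 ^ τ.q * (h + C τ.μ) : PS)
    rw [subst_add hdil, hD1, subst_eq_self_of_isXSeries hdil rfl hh', ← shear_apply hh, map_mul,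
      map_pow, map_add, shear_X_zero, shear_X_one, hp', pow_one]
    have hC : shear hh (C τ.μ) = C τ.μ := by
      have := (shear hh).commutes τ.μ
      simpa [MvPowerSeries.algebraMap_apply] using this
    rw [hC]; ring

theorem mem_filtration_of_subst_dilation {q a b W : ℕ} {f : PS}
    (hf : subst (dilationSubst q) f ∈ filtration a b W) : f ∈ filtration a (a * q + b) W := by
  intro m hm
  rw [← expo_eta m, ← coeff_subst_dilation q] at hm
  have := hf _ hm
  simp only [expo_apply_zero, expo_apply_one] at this
  nlinarith

theorem toAlgHom_mem_mapIdeal {I : Ideal PS} {f : PS} (hf : f ∈ I) :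
    τ.toAlgHom f ∈ τ.mapIdeal I := Ideal.mem_map_of_mem _ hf

/-- A curve of contact `K` with the transform pulls back, through `shear_toAlgHom`, to a curve of
contact `q + K` with the ideal. -/
theorem contactLT_mapIdeal (hp : τ.p = 1) {I : Ideal PS}
    (ht : topOrder (τ.mapIdeal I) = topOrder I + τ.q * height I)
    (hn : height (τ.mapIdeal I) = height I) {K : ℕ} (hK : ContactLT I (τ.q + K)) :
    ContactLT (τ.mapIdeal I) K := by
  intro h hh
  by_contra! hcon
  obtain ⟨h', hh', hcomp⟩ := τ.shear_toAlgHom hp hh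
  obtain ⟨f, hf, hfn⟩ := hK h' hh'
  apply hfn
  have h1 := hcon _ (τ.toAlgHom_mem_mapIdeal hf)
  rw [hcomp, ht, hn] at h1
  have h2 := mem_filtration_of_subst_dilation h1
  rw [one_mul] at h2
  rwa [add_assoc, ← add_mul] at h2

/-- Depth zero amounts to divisibility by `y ^ height` after a shear. This is a condition for the
weights `(0, 1)`, which the dilation does not affect, so it descends. -/
theorem isDepthZero_of_mapIdeal (hp : τ.p = 1) {I : Ideal PS} (hI : I ≠ ⊥)
    (hn : height (τ.mapIdeal I) = height I) (hd : IsDepthZero (τ.mapIdeal I)) :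
    IsDepthZero I := by
  obtain ⟨k, n, hkn⟩ := hd
  obtain ⟨h, hh, hmem⟩ := hkn.exists_shear_mem
  obtain ⟨h', hh', hcomp⟩ := τ.shear_toAlgHom hp hh
  refine ⟨_, _, isMonomialLike_of_shear_mem hI hh' fun f hf => ?_⟩
  have h1 := hmem _ (τ.toAlgHom_mem_mapIdeal hf)
  rw [hcomp, ← hkn.topOrder_eq.2, hn] at h1
  have h2 := mem_filtration_of_subst_dilation h1
  rwa [zero_mul, zero_add] at h2

end NewtonMap

/-- The curve `y = 0` already has contact `q`, hence also every smaller contact. -/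
theorem ContactLT.le_of_le_filtration {I : Ideal PS} {K q : ℕ} (hK : ContactLT I K)
    (hq : I ≤ filtration 1 q (topOrder I + q * height I)) : q ≤ K := by
  by_contra hlt
  obtain ⟨f, hf, hfn⟩ := hK 0 IsXSeries.zero
  apply hfn
  rw [shear_zero]
  intro m hm
  have h1 := hq hf m hm
  have h2 := (top_of_mem hf m hm).1
  rw [one_mul] at h1 ⊢
  obtain ⟨c, hc⟩ := Nat.exists_eq_add_of_lt (not_le.1 hlt)
  rcases le_total (height I) (m 1) with h3 | h3
  · have := Nat.mul_le_mul_left K h3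
    omega
  · obtain ⟨b, hb⟩ := Nat.exists_eq_add_of_le h3
    rw [hb] at h1 ⊢
    rw [hc] at h1
    nlinarith

end NewtonTrees

namespace NewtonTrees

open MvPowerSeries

/-! ### The Newton maps of a face -/

/-- The Bézout pair is determined by `(p, q)`, so a Newton map amounts to a root once the face is
fixed. -/
theorem NewtonMap.eq_of_eq {τ τ' : NewtonMap} (hp : τ.p = τ'.p) (hq : τ.q = τ'.q)
    (hμ : τ.μ = τ'.μ) : τ = τ' := by
  obtain ⟨p, q, p', q', μ, hp0, hq0, hb, hle, hlt, hμ0⟩ := τ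
  obtain ⟨P, Q, P', Q', M, hP0, hQ0, hB, hLe, hLt, hM0⟩ := τ'
  dsimp only at hp hq hμ
  subst hp hq hμ
  have hcop : Nat.Coprime q p := by
    rw [Nat.coprime_iff_gcd_eq_one]
    have h1 : Nat.gcd q p ∣ q * q' + 1 := hb ▸ (Nat.gcd_dvd_right q p).mul_right _
    exact Nat.dvd_one.1 ((Nat.dvd_add_right ((Nat.gcd_dvd_left q p).mul_right q')).1 h1)
  have key : p * p' + q * Q' = p * P' + q * q' := by omega
  have hp' : p' = P' := by
    have h1 : p * p' ≡ p * P' [MOD q] := by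
      have := congrArg (· % q) key
      simp only [Nat.add_mul_mod_self_left] at this
      exact this
    have h2 : p' ≡ P' [MOD q] := Nat.ModEq.cancel_left_of_coprime hcop h1
    have hpos : 0 < p' := Nat.pos_of_ne_zero (by rintro rfl; simp at hb)
    have hPpos : 0 < P' := Nat.pos_of_ne_zero (by rintro rfl; simp at hB)
    -- The residues lie in `1, …, q`, not in `0, …, q - 1`, hence the shift by one.
    have h3 : p' - 1 ≡ P' - 1 [MOD q] := by
      apply Nat.ModEq.add_right_cancel' 1
      rwa [Nat.sub_add_cancel hpos, Nat.sub_add_cancel hPpos]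
    have := Nat.ModEq.eq_of_lt_of_lt h3 (by omega) (by omega)
    omega
  subst hp'
  have hq' : q' = Q' := Nat.eq_of_mul_eq_mul_left hq0 (by omega)
  subst hq'
  rfl

theorem NewtonMap.exists_of_coprime {p q : ℕ} (hp : 0 < p) (hq : 0 < q) (hpq : Nat.Coprime p q)
    {μ : ℂ} (hμ : μ ≠ 0) : ∃ τ : NewtonMap, τ.p = p ∧ τ.q = q ∧ τ.μ = μ := by
  obtain ⟨p', q', hb, hle, hlt⟩ : ∃ p' q', p * p' = q * q' + 1 ∧ p' ≤ q ∧ q' < p := by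
    rcases Nat.lt_or_ge 1 q with hq1 | hq1
    · obtain ⟨m, hmlt, hm⟩ := Nat.exists_mul_mod_eq_one_of_coprime hpq hq1
      refine ⟨m, p * m / q, ?_, hmlt.le, ?_⟩
      · have := Nat.div_add_mod (p * m) q
        omega
      · rw [Nat.div_lt_iff_lt_mul hq]
        exact Nat.mul_lt_mul_of_pos_left hmlt hp
    · have : q = 1 := by omega
      subst this
      exact ⟨1, p - 1, by omega, le_rfl, by omega⟩
  exact ⟨⟨p, q, p', q', μ, hp, hq, hb, hle, hlt, hμ⟩, rfl, rfl, rfl⟩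

/-- The Newton maps attached to a pair `(p, q)` and the roots of a nonzero polynomial. -/
theorem finite_newtonMap (p q : ℕ) {R : Polynomial ℂ} (hR : R ≠ 0) :
    {τ : NewtonMap | τ.p = p ∧ τ.q = q ∧ R.eval τ.μ = 0}.Finite := by
  apply Set.Finite.of_finite_image (f := fun τ : NewtonMap => τ.μ)
  · apply (Polynomial.finite_setOfPred_isRoot hR).subset
    rintro _ ⟨τ, ⟨-, -, h⟩, rfl⟩
    exact h
  · rintro τ ⟨hp, hq, -⟩ τ' ⟨hp', hq', -⟩ hμ
    exact NewtonMap.eq_of_eq (hp.trans hp'.symm) (hq.trans hq'.symm) hμ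

/-- The height of the transform does not exceed the height. In case of equality, the face is the
edge of a power of a smooth curve. -/
theorem NormalForm.rootMultiplicity_le_height {p q N d : ℕ} {F : MvPolynomial (Fin 2) ℂ} {r : ℕ}
    {f : Fin r → PS} (hI : Ideal.span (Set.range f) ≠ ⊥) (Φ : NormalForm p q N d F f)
    (hF : IsFace (Ideal.span (Set.range f)) p q N) (μ : ℂ) :
    (dehom F).rootMultiplicity μ ≤ height (Ideal.span (Set.range f)) ∧
    ((dehom F).rootMultiplicity μ = height (Ideal.span (Set.range f)) →
      p = 1 ∧ N = topOrder (Ideal.span (Set.range f)) +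
        q * height (Ideal.span (Set.range f))) := by
  obtain ⟨i, hi⟩ := Φ.exists_coeff_upper hF.1 hF.2.1
  have hline : p * (expo Φ.a (Φ.b + p * (Φ.e + d))) 0 +
      q * (expo Φ.a (Φ.b + p * (Φ.e + d))) 1 = N := by
    refine Eq.trans ?_ Φ.weight_eq
    simp; ring
  obtain ⟨h1, h2⟩ := hF.ordinate_le_height hI ⟨f i, Ideal.subset_span ⟨i, rfl⟩, hi⟩ hline
  simp only [expo_apply_zero, expo_apply_one] at h1 h2 hline
  have h3 : (dehom F).rootMultiplicity μ ≤ Φ.e := by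
    have h4 := Polynomial.count_roots (dehom F) (a := μ)
    rw [← h4, ← Φ.natDegree_dehom]
    exact (Multiset.count_le_card _ _).trans (Polynomial.card_roots' _)
  obtain ⟨p₀, hp₀⟩ := Nat.exists_eq_succ_of_ne_zero hF.1.ne'
  -- The chain is `multiplicity ≤ e ≤ b + p (e + d) ≤ height`. Equality throughout forces `d = 0`
  -- and `p = 1`, the multiplicity being positive.
  have h4 : Φ.e + d ≤ p * (Φ.e + d) := Nat.le_mul_of_pos_left _ hF.1
  refine ⟨by omega, fun heq => ?_⟩
  obtain ⟨m, hm, m', hm', hlt, hN, hN'⟩ := hF.exists_ordinate_lt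
  have h5 := (hF.ordinate_le_height hI hm' hN').1
  have he : 0 < Φ.e := by omega
  have h6 : Φ.b + p * (Φ.e + d) = height (Ideal.span (Set.range f)) := by omega
  have hd : d = 0 := by omega
  have hp : p = 1 := by
    have h7 : p * (Φ.e + d) = 1 * (Φ.e + d) := by omega
    exact Nat.eq_of_mul_eq_mul_right (by omega) h7
  refine ⟨hp, ?_⟩
  rw [← hline, h6, h2 h6, hp, one_mul]

theorem NormalForm.dehom_ne_zero {p q N d : ℕ} {F : MvPolynomial (Fin 2) ℂ} {r : ℕ}
    {f : Fin r → PS} (Φ : NormalForm p q N d F f) : dehom F ≠ 0 := Φ.dehom_monic.ne_zero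

theorem ne_bot_of_mem_idealSupport {J : Ideal PS} {m : Fin 2 →₀ ℕ} (hm : m ∈ idealSupport J) :
    J ≠ ⊥ := by
  rintro rfl
  obtain ⟨f, hf, hne⟩ := hm
  rw [Ideal.mem_bot] at hf
  simp [hf] at hne

/-- The Newton algorithm terminates as soon as it terminates at all transforms. -/
theorem exists_isTreeOf_of_transforms {r : ℕ} {f : Fin r → PS}
    (hI : Ideal.span (Set.range f) ≠ ⊥)
    (hd : ¬ IsDepthZero (Ideal.span (Set.range f)))
    (hrec : ∀ τ : NewtonMap,
      Ideal.span (Set.range fun i => τ.toAlgHom (f i)) ≠ ⊥ →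
      height (τ.mapIdeal (Ideal.span (Set.range f))) ≤ height (Ideal.span (Set.range f)) →
      (height (τ.mapIdeal (Ideal.span (Set.range f))) = height (Ideal.span (Set.range f)) →
        τ.p = 1 ∧ topOrder (τ.mapIdeal (Ideal.span (Set.range f))) =
          topOrder (Ideal.span (Set.range f)) + τ.q * height (Ideal.span (Set.range f)) ∧
        Ideal.span (Set.range f) ≤ filtration 1 τ.q (topOrder (Ideal.span (Set.range f)) +
          τ.q * height (Ideal.span (Set.range f)))) →
      ∃ B, IsTreeOf (fun J => ¬ IsDepthZero J)
        (Ideal.span (Set.range fun i => τ.toAlgHom (f i)))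
        (topOrder (Ideal.span (Set.range fun i => τ.toAlgHom (f i)))) B) :
    ∃ B, IsTreeOf (fun J => ¬ IsDepthZero J) (Ideal.span (Set.range f))
      (topOrder (Ideal.span (Set.range f))) B := by
  obtain ⟨m, p, q, N, hF, hsort, hcomp⟩ := exists_sorted_faces (Ideal.span (Set.range f))
  choose d F hΦ using fun i => (hF i).exists_normalForm
  let Φ := fun i => (hΦ i).some
  choose n σ hinj hrange using fun i =>
    (finite_newtonMap (p i) (q i) (Φ i).dehom_ne_zero).fin_param
  have hσ : ∀ i j, (σ i j).p = p i ∧ (σ i j).q = q i ∧ (dehom (F i)).eval (σ i j).μ = 0 := by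
    intro i j
    have : σ i j ∈ Set.range (σ i) := ⟨j, rfl⟩
    rw [hrange] at this
    exact this
  have hB : ∀ i j, ∃ B, IsTreeOf (fun J => ¬ IsDepthZero J)
      ((σ i j).mapIdeal (Ideal.span (Set.range f))) (N i) B := by
    intro i j
    obtain ⟨hp, hq, -⟩ := hσ i j
    have hle := le_filtration_iff.2 (isFace_iff.1 (hF i)).2.2.2.1
    obtain ⟨hmem, ht, hh⟩ := (Φ i).topOrder_mapIdeal
      (fun l => hle (Ideal.subset_span ⟨l, rfl⟩)) (σ i j) hp hq
    obtain ⟨h1, h2⟩ := (Φ i).rootMultiplicity_le_height hI (hF i) (σ i j).μ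
    have h3 := hrec (σ i j) ?_ (hh.trans_le h1) ?_
    · rw [← NewtonMap.mapIdeal_span, ht] at h3
      exact h3
    · rw [← NewtonMap.mapIdeal_span]
      exact ne_bot_of_mem_idealSupport hmem
    · intro heq
      obtain ⟨h4, h5⟩ := h2 (hh.symm.trans heq)
      refine ⟨hp.trans h4, by rw [ht, h5, hq], ?_⟩
      rw [hq, ← h5, ← h4]
      exact hle
  choose B hB using hB
  exact ⟨_, IsTreeOf.step _ hd m (fun i => (Φ i).toFace (hF i)) hsort
    (fun p' q' N' h => hcomp p' q' N' h) n σ hinj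
    (fun i => by
      rw [hrange]
      ext τ
      simp only [Set.mem_ofPred_eq, eval_dehom]
      rfl) B hB⟩

/-- The Newton algorithm terminates. -/
theorem exists_isTreeOf {r : ℕ} : ∀ (n : ℕ) (f : Fin r → PS),
    height (Ideal.span (Set.range f)) = n → Ideal.span (Set.range f) ≠ ⊥ →
    ∃ B, IsTreeOf (fun J => ¬ IsDepthZero J) (Ideal.span (Set.range f))
      (topOrder (Ideal.span (Set.range f))) B := by
  intro n
  induction n using Nat.strong_induction_on with
  | _ n ihn =>
  have hdz : ∀ f : Fin r → PS, IsDepthZero (Ideal.span (Set.range f)) →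
      ∃ B, IsTreeOf (fun J => ¬ IsDepthZero J) (Ideal.span (Set.range f))
        (topOrder (Ideal.span (Set.range f))) B := by
    rintro f ⟨k, ν, hk⟩
    exact ⟨_, hk.topOrder_eq.1 ▸ IsTreeOf.halt _ k ν hk⟩
  -- Inner induction, at constant height, on a bound for the contact with smooth curves.
  have hK : ∀ (K : ℕ) (f : Fin r → PS), height (Ideal.span (Set.range f)) = n →
      Ideal.span (Set.range f) ≠ ⊥ → ContactLT (Ideal.span (Set.range f)) K →
      ∃ B, IsTreeOf (fun J => ¬ IsDepthZero J) (Ideal.span (Set.range f))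
        (topOrder (Ideal.span (Set.range f))) B := by
    intro K
    induction K using Nat.strong_induction_on with
    | _ K ihK =>
    intro f hn hI hK
    by_cases hd : IsDepthZero (Ideal.span (Set.range f))
    · exact hdz f hd
    refine exists_isTreeOf_of_transforms hI hd fun τ hne hle heq => ?_
    rcases hle.lt_or_eq with hlt | he
    · exact ihn _ (hn ▸ hlt) _ (by rw [τ.mapIdeal_span]) hne
    · obtain ⟨hp, ht, hfil⟩ := heq he
      -- When the height does not drop, the contact bound drops by `q ≥ 1`.
      have hqK := hK.le_of_le_filtration hfil
      obtain ⟨K', rfl⟩ := Nat.exists_eq_add_of_le hqK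
      have hc := τ.contactLT_mapIdeal hp ht he hK
      rw [τ.mapIdeal_span] at hc he
      exact ihK K' (by have := τ.q_pos; omega) _ (he.trans hn) hne hc
  intro f hn hI
  by_cases hd : IsDepthZero (Ideal.span (Set.range f))
  · exact hdz f hd
  · obtain ⟨K, hK'⟩ := exists_contactLT hI hd
    exact hK K f hn hI hK'

end NewtonTrees

namespace NewtonTrees

/-! ### Generic linear combinations -/

/-- The property `Q` holds outside the zero set of a nonzero polynomial. -/
def Generic {r : ℕ} (Q : (Fin r → ℂ) → Prop) : Prop :=
  ∃ P : MvPolynomial (Fin r) ℂ, P ≠ 0 ∧ ∀ c : Fin r → ℂ, MvPolynomial.eval c P ≠ 0 → Q c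

namespace Generic

variable {r : ℕ} {Q Q' : (Fin r → ℂ) → Prop}

theorem mono (hQ : Generic Q) (h : ∀ c, Q c → Q' c) : Generic Q' := by
  obtain ⟨P, hP, hc⟩ := hQ
  exact ⟨P, hP, fun c hne => h c (hc c hne)⟩

theorem of_forall (h : ∀ c, Q c) : Generic Q := ⟨1, one_ne_zero, fun c _ => h c⟩

theorem and (hQ : Generic Q) (hQ' : Generic Q') : Generic fun c => Q c ∧ Q' c := by
  obtain ⟨P, hP, hc⟩ := hQ
  obtain ⟨P', hP', hc'⟩ := hQ'
  refine ⟨P * P', mul_ne_zero hP hP', fun c hne => ?_⟩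
  rw [map_mul] at hne
  exact ⟨hc c (left_ne_zero_of_mul hne), hc' c (right_ne_zero_of_mul hne)⟩

theorem forall_mem {ι : Type*} (s : Finset ι) {R : ι → (Fin r → ℂ) → Prop}
    (h : ∀ i ∈ s, Generic (R i)) : Generic fun c => ∀ i ∈ s, R i c := by
  classical
  induction s using Finset.induction_on with
  | empty => exact of_forall fun c i hi => absurd hi (Finset.notMem_empty i)
  | insert a s ha ih =>
    refine ((h a (Finset.mem_insert_self a s)).and
      (ih fun i hi => h i (Finset.mem_insert_of_mem hi))).mono fun c hc i hi => ?_
    rcases Finset.mem_insert.1 hi with rfl | hi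
    · exact hc.1
    · exact hc.2 i hi

theorem forall_fintype {ι : Type*} [Fintype ι] {R : ι → (Fin r → ℂ) → Prop}
    (h : ∀ i, Generic (R i)) : Generic fun c => ∀ i, R i c :=
  (forall_mem Finset.univ fun i _ => h i).mono fun _ hc i => hc i (Finset.mem_univ i)

/-- A nonzero polynomial over the infinite field `ℂ` is nonzero at some point. -/
theorem nonempty (hQ : Generic Q) : ∃ c, Q c := by
  obtain ⟨P, hP, hc⟩ := hQ
  by_contra! hne
  refine hP (MvPolynomial.funext fun c => ?_)
  by_contra hne'
  rw [map_zero] at hne'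
  exact hne c (hc c hne')

end Generic

theorem generic_sum_ne_zero {r : ℕ} {v : Fin r → ℂ} (hv : ∃ i, v i ≠ 0) :
    Generic fun c => ∑ i, c i * v i ≠ 0 := by
  obtain ⟨i, hi⟩ := hv
  have heval : ∀ c : Fin r → ℂ, MvPolynomial.eval c
      (∑ j, MvPolynomial.X j * MvPolynomial.C (v j)) = ∑ j, c j * v j := by
    intro c
    simp
  refine ⟨∑ j, MvPolynomial.X j * MvPolynomial.C (v j), fun h0 => ?_, fun c hc => ?_⟩
  · have h1 := heval (Pi.single i 1)
    rw [h0, map_zero] at h1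
    apply hi
    simpa [Pi.single_apply] using h1.symm
  · rwa [heval] at hc

open Polynomial in
/-- The linear combination of the polynomials `κ i` with coefficients `c i`. -/
noncomputable def combination {r : ℕ} (κ : Fin r → ℂ[X]) (c : Fin r → ℂ) : ℂ[X] :=
  ∑ i, C (c i) * κ i

/-! ### Separability of generic combinations in one variable -/

section

open Polynomial

variable {r : ℕ} {κ : Fin r → ℂ[X]}

theorem eval_combination (c : Fin r → ℂ) (μ : ℂ) :
    (combination κ c).eval μ = ∑ i, c i * (κ i).eval μ := by
  simp [combination, eval_finsetSum]

theorem coeff_combination (c : Fin r → ℂ) (j : ℕ) :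
    (combination κ c).coeff j = ∑ i, c i * (κ i).coeff j := by
  simp [combination]

theorem combination_add_smul (c c' : Fin r → ℂ) (t : ℂ) :
    combination κ (c + t • c') = combination κ c + C t * combination κ c' := by
  simp only [combination, Finset.mul_sum, ← Finset.sum_add_distrib]
  refine Finset.sum_congr rfl fun i _ => ?_
  simp only [Pi.add_apply, Pi.smul_apply, smul_eq_mul, C_add, C_mul]
  ring

theorem natDegree_combination_le {d : ℕ} (hd : ∀ i, (κ i).natDegree ≤ d) (c : Fin r → ℂ) :
    (combination κ c).natDegree ≤ d := by
  apply natDegree_sum_le_of_forall_le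
  intro i _
  exact (natDegree_C_mul_le _ _).trans (hd i)

theorem isCoprime_of_no_common_root {A B : ℂ[X]} (h : ∀ μ, A.eval μ = 0 → B.eval μ ≠ 0) :
    IsCoprime A B := by
  apply isCoprime_of_irreducible_dvd
  · rintro ⟨rfl, rfl⟩
    exact h 0 (by simp) (by simp)
  · intro z hz hA hB
    obtain ⟨μ, hμ⟩ := IsAlgClosed.exists_root z (degree_pos_of_irreducible hz).ne'
    exact h μ (eval_eq_zero_of_dvd_of_eval_eq_zero hA hμ)
      (eval_eq_zero_of_dvd_of_eval_eq_zero hB hμ)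

/-- Some linear combination has no multiple root. -/
theorem exists_combination_separable {d : ℕ} (hd : ∀ i, (κ i).natDegree ≤ d)
    (hcoeff : ∃ i, (κ i).coeff d ≠ 0) (hroot : ∀ μ, ∃ i, (κ i).eval μ ≠ 0) (hpos : 0 < d) :
    ∃ c, (combination κ c).coeff d ≠ 0 ∧ (combination κ c).Separable := by
  -- A separable member is sought in a pencil `A + t B`, with `A` of full degree `d` and `B` without
  -- common root with `A`.
  obtain ⟨c₀, hc₀⟩ := (generic_sum_ne_zero hcoeff).nonempty
  rw [← coeff_combination] at hc₀
  have hne : combination κ c₀ ≠ 0 := fun h => hc₀ (by rw [h, coeff_zero])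
  have hdeg : (combination κ c₀).natDegree = d :=
    le_antisymm (natDegree_combination_le hd _) (le_natDegree_of_ne_zero hc₀)
  obtain ⟨c₁, hc₁⟩ := (Generic.forall_mem (combination κ c₀).roots.toFinset
    fun μ _ => generic_sum_ne_zero (hroot μ)).nonempty
  have hAB : ∀ μ, (combination κ c₀).eval μ = 0 → (combination κ c₁).eval μ ≠ 0 := by
    intro μ hμ
    rw [eval_combination c₁]
    exact hc₁ μ (by rw [Multiset.mem_toFinset, mem_roots hne]; exact hμ)
  set A := combination κ c₀
  set B := combination κ c₁
  -- If the Wronskian vanished, `A` would divide its own derivative.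
  have hW : A * derivative B - derivative A * B ≠ 0 := by
    intro hW
    have hdvd : A ∣ derivative A :=
      (isCoprime_of_no_common_root hAB).dvd_of_dvd_mul_right ⟨derivative B, (sub_eq_zero.1 hW).symm⟩
    have hA' : derivative A = 0 := by
      by_contra h
      have h1 := natDegree_le_of_dvd hdvd h
      have h2 := natDegree_derivative_lt (p := A) (by omega)
      omega
    have := derivative_eq_zero.1 hA'
    omega
  -- A multiple root `μ` of `A + t B` is a root of the Wronskian, and then `t = -A(μ) / B(μ)`.
  -- Finitely many `t` are excluded, together with the one for which the degree drops.
  obtain ⟨t, ht⟩ := Set.Finite.exists_notMem (s :=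
    (fun μ => - A.eval μ / B.eval μ) '' {μ | (A * derivative B - derivative A * B).IsRoot μ} ∪
      {- A.coeff d / B.coeff d})
    (((finite_setOfPred_isRoot hW).image _).union (Set.finite_singleton _))
  have ht1 : ∀ μ, (A * derivative B - derivative A * B).eval μ = 0 → - A.eval μ / B.eval μ ≠ t :=
    fun μ hμ h => ht (Or.inl ⟨μ, hμ, h⟩)
  have ht2 : t ≠ - A.coeff d / B.coeff d := fun h => ht (Or.inr h)
  refine ⟨c₀ + t • c₁, ?_, ?_⟩ <;> rw [combination_add_smul]
  · intro h
    rw [coeff_add, coeff_C_mul] at h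
    by_cases hB : B.coeff d = 0
    · rw [hB, mul_zero, add_zero] at h
      exact hc₀ h
    · apply ht2
      rw [eq_div_iff hB]
      linear_combination h
  · apply isCoprime_of_no_common_root
    intro μ h1 h2
    rw [derivative_add, derivative_C_mul] at h2
    simp only [eval_add, eval_mul, eval_C] at h1 h2
    have hB : B.eval μ ≠ 0 := by
      intro hB
      rw [hB, mul_zero, add_zero] at h1
      exact hAB μ h1 hB
    apply ht1 μ
    · simp only [eval_sub, eval_mul]
      linear_combination eval μ (derivative B) * h1 - eval μ B * h2
    · rw [div_eq_iff hB]
      linear_combination -h1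

/-- A generic linear combination of polynomials without common root has no multiple root. -/
theorem generic_separable {d : ℕ} (hd : ∀ i, (κ i).natDegree ≤ d)
    (hcoeff : ∃ i, (κ i).coeff d ≠ 0) (hroot : ∀ μ, ∃ i, (κ i).eval μ ≠ 0) :
    Generic fun c => (combination κ c).Separable := by
  rcases Nat.eq_zero_or_pos d with rfl | hpos
  · refine (generic_sum_ne_zero hcoeff).mono fun c hc => ?_
    rw [← coeff_combination] at hc
    rw [eq_C_of_natDegree_le_zero (natDegree_combination_le hd c)]
    exact separable_C _ |>.2 (isUnit_iff_ne_zero.2 hc)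
  · let K : (MvPolynomial (Fin r) ℂ)[X] := ∑ i, C (MvPolynomial.X i) * (κ i).map MvPolynomial.C
    have hK : ∀ c, K.map (MvPolynomial.eval c) = combination κ c := by
      intro c
      simp only [K, combination, Polynomial.map_sum, Polynomial.map_mul, map_C, Polynomial.map_map,
        MvPolynomial.eval_X]
      refine Finset.sum_congr rfl fun i _ => ?_
      have : (MvPolynomial.eval c).comp MvPolynomial.C = RingHom.id ℂ := by ext; simp
      rw [this, Polynomial.map_id]
    have hKd : K.natDegree ≤ d := by
      apply natDegree_sum_le_of_forall_le
      intro i _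
      exact (natDegree_C_mul_le _ _).trans (natDegree_map_le.trans (hd i))
    -- The discriminant-type resultant is a polynomial in the coefficients `c`; the separable member
    -- found above shows that it is not identically zero.
    refine ⟨resultant K (derivative K) d (d - 1), fun h0 => ?_, fun c hc => ?_⟩
    · obtain ⟨c, hc, hsep⟩ := exists_combination_separable hd hcoeff hroot hpos
      have hdeg : (combination κ c).natDegree = d :=
        le_antisymm (natDegree_combination_le hd _) (le_natDegree_of_ne_zero hc)
      apply resultant_ne_zero _ _ hsep
      rw [natDegree_derivative, hdeg, ← hK, derivative_map, resultant_map_map, h0, map_zero]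
    -- The Bézout identity for the resultant specializes to every `c`, whether or not the degree
    -- drops.
    · obtain ⟨U, V, -, -, hUV⟩ := exists_mul_add_mul_eq_C_resultant (m := d) (n := d - 1)
        K (derivative K) hKd ((natDegree_derivative_le K).trans (by omega)) (Or.inl hpos.ne')
      have h1 := congrArg (Polynomial.map (MvPolynomial.eval c)) hUV
      rw [Polynomial.map_add, Polynomial.map_mul, Polynomial.map_mul, ← derivative_map, hK, map_C] at h1
      refine ⟨C (MvPolynomial.eval c (resultant K (derivative K) d (d - 1)))⁻¹ *
        U.map (MvPolynomial.eval c), C (MvPolynomial.eval c (resultant K (derivative K) d (d - 1)))⁻¹ *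
        V.map (MvPolynomial.eval c), ?_⟩
      calc _ = C (MvPolynomial.eval c (resultant K (derivative K) d (d - 1)))⁻¹ *
            (combination κ c * U.map (MvPolynomial.eval c) +
              derivative (combination κ c) * V.map (MvPolynomial.eval c)) := by ring
        _ = 1 := by rw [h1, ← C_mul, inv_mul_cancel₀ hc, C_1]

/-- A separable polynomial of degree `d` has `d` distinct roots. -/
theorem exists_roots_of_separable {K : ℂ[X]} {d : ℕ} (hK : K.Separable) (hd : K.natDegree = d) :
    ∃ ρ : Fin d → ℂ, Function.Injective ρ ∧ Set.range ρ = {μ | K.eval μ = 0} := by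
  have hne : K ≠ 0 := hK.ne_zero
  have hcard : K.roots.toFinset.card = d := by
    rw [Multiset.toFinset_card_of_nodup (nodup_roots hK), ← hd]
    exact (IsAlgClosed.splits K).natDegree_eq_card_roots.symm
  let E := K.roots.toFinset.equivFinOfCardEq hcard
  refine ⟨fun j => (E.symm j : ℂ), Subtype.val_injective.comp E.symm.injective, ?_⟩
  ext μ
  have : μ ∈ K.roots.toFinset ↔ K.eval μ = 0 := by
    rw [Multiset.mem_toFinset, mem_roots hne, IsRoot.def]
  rw [Set.mem_ofPred_eq, ← this]
  exact ⟨fun ⟨j, hj⟩ => hj ▸ (E.symm j).2, fun h => ⟨E ⟨μ, h⟩, by simp⟩⟩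

end

end NewtonTrees

namespace NewtonTrees

open MvPowerSeries

/-! ### Faces of a generic linear combination -/

/-- After division by `x^N` the series has order one in `y`, and the implicit function theorem
applies. This is the source of the arrows decorated with `1`. -/
theorem isMonomialLike_one_of_coeff {g : PS} {N : ℕ} (hg : g ∈ filtration 1 0 N)
    (h0 : coeff (expo N 0) g = 0) (h1 : coeff (expo N 1) g ≠ 0) :
    IsMonomialLike (Ideal.span {g}) N 1 := by
  obtain ⟨A, rfl⟩ := exists_eq_X_zero_pow_mul hg
  have hA : ∀ j, coeff (expo N j) (X 0 ^ N * A) = coeff (expo 0 j) A := fun j => by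
    simpa using coeff_X_zero_pow_mul N 0 j A
  rw [hA] at h0 h1
  obtain ⟨u, h, hu, hh, hA⟩ := exists_isUnit_mul_eq_X_add h0 h1
  refine ⟨h, hh, ?_⟩
  rw [pow_one, ← hA, mul_left_comm, Ideal.span_singleton_mul_left_unit hu]

theorem mem_range_append {α : Type*} {n d : ℕ} {s : Fin n → α} {t : Fin d → α} {a : α} :
    a ∈ Set.range (Fin.append s t) ↔ a ∈ Set.range s ∨ a ∈ Set.range t := by
  constructor
  · rintro ⟨j, rfl⟩
    refine Fin.addCases (fun i => ?_) (fun i => ?_) j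
    · exact Or.inl ⟨i, (Fin.append_left s t i).symm⟩
    · exact Or.inr ⟨i, (Fin.append_right s t i).symm⟩
  · rintro (⟨i, rfl⟩ | ⟨i, rfl⟩)
    · exact ⟨_, Fin.append_left s t i⟩
    · exact ⟨_, Fin.append_right s t i⟩

namespace NormalForm

variable {p q N d : ℕ} {F : MvPolynomial (Fin 2) ℂ} {r : ℕ} {f : Fin r → PS}

/-- The face polynomial of the combination is `F` times the combination of the `kᵢ`, made monic. The
leading coefficient remains as the constant `k`, so `d` becomes zero. -/
theorem exists_combination (Φ : NormalForm p q N d F f) (hp : 0 < p) (hq : 0 < q)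
    (hf : ∀ i, f i ∈ filtration p q N) (c : Fin r → ℂ)
    (hd : (combination (fun i => dehom (Φ.k i)) c).coeff d ≠ 0)
    (h0 : (combination (fun i => dehom (Φ.k i)) c).eval 0 ≠ 0) :
    ∃ (F' : MvPolynomial (Fin 2) ℂ) (l : ℂ), l ≠ 0 ∧
      dehom F' = Polynomial.C l * (dehom F * combination (fun i => dehom (Φ.k i)) c) ∧
      Nonempty (NormalForm p q N 0 F' fun _ : Fin 1 => ∑ i, c i • f i) := by
  set K := combination (fun i => dehom (Φ.k i)) c with hK
  let G : MvPolynomial (Fin 2) ℂ := ∑ i, MvPolynomial.C (c i) * Φ.k i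
  have hG : G.IsHomogeneous d := MvPolynomial.IsHomogeneous.sum _ _ _ fun i _ => by
    simpa using (MvPolynomial.isHomogeneous_C _ (c i)).mul (Φ.k_hom i)
  have hGK : dehom G = K := by
    simp only [G, hK, combination, map_sum, map_mul, dehom_C]
  have hKd : K.natDegree ≤ d := hGK ▸ natDegree_dehom_le hG
  have hl := inv_ne_zero hd
  have hF' : dehom (MvPolynomial.C (K.coeff d)⁻¹ * (F * G)) =
      Polynomial.C (K.coeff d)⁻¹ * (dehom F * K) := by
    rw [map_mul, map_mul, dehom_C, hGK]
  refine ⟨MvPolynomial.C (K.coeff d)⁻¹ * (F * G), (K.coeff d)⁻¹, hl, hF', ⟨?_⟩⟩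
  refine ⟨Φ.a, Φ.b, Φ.e + d, fun _ => MvPolynomial.C (K.coeff d), ?_, ?_, ?_, fun _ =>
    MvPolynomial.isHomogeneous_C _ _, fun g hg => ?_, ?_, fun _ => ?_⟩
  · simpa using (MvPolynomial.isHomogeneous_C _ _).mul (Φ.F_hom.mul hG)
  · rw [hF', Polynomial.coeff_C_mul, Polynomial.coeff_mul_add_eq_of_natDegree_le
      (natDegree_dehom_le Φ.F_hom) hKd, Φ.F_monic, one_mul, inv_mul_cancel₀ hd]
  · rw [hF', Polynomial.eval_mul, Polynomial.eval_mul, Polynomial.eval_C]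
    exact mul_ne_zero hl (mul_ne_zero Φ.F_eval h0)
  · exact isUnit_of_dvd_unit (hg 0) ((isUnit_iff_ne_zero.2 hd).map MvPolynomial.C)
  · rw [add_zero]
    exact Φ.weight_eq
  · have h1 : MvPolynomial.C (K.coeff d)⁻¹ * (F * G) * MvPolynomial.C (K.coeff d) = F * G := by
      rw [mul_right_comm, ← MvPolynomial.C_mul, inv_mul_cancel₀ hd, MvPolynomial.C_1, one_mul]
    have h2 : F * G = ∑ i, MvPolynomial.C (c i) * (F * Φ.k i) := by
      rw [Finset.mul_sum]
      exact Finset.sum_congr rfl fun i _ => by ring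
    have h3 : substPow p q (F * G) = ∑ i, C (c i) * substPow p q (F * Φ.k i) := by
      rw [h2]
      simp only [← substPow_C_mul]
      exact map_sum (MvPolynomial.aeval _) _ _
    have h4 : ∑ i, c i • f i = ∑ i, C (c i) * f i :=
      Finset.sum_congr rfl fun i _ => smul_eq_C_mul _ _
    rw [h1, h3, h4, initialPart_sum_mul hp hq _ _ hf, Finset.mul_sum]
    refine Finset.sum_congr rfl fun i _ => ?_
    rw [Φ.initialPart_eq, constantCoeff_C]
    ring

/-- The conditions on a linear combination under which a face keeps its shape. -/
structure IsGoodFor (Φ : NormalForm p q N d F f) (c : Fin r → ℂ) : Prop where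
  coeff_ne : (combination (fun i => dehom (Φ.k i)) c).coeff d ≠ 0
  eval_zero_ne : (combination (fun i => dehom (Φ.k i)) c).eval 0 ≠ 0
  eval_ne : ∀ μ, (dehom F).eval μ = 0 → (combination (fun i => dehom (Φ.k i)) c).eval μ ≠ 0
  separable : (combination (fun i => dehom (Φ.k i)) c).Separable

theorem generic_isGoodFor (Φ : NormalForm p q N d F f) : Generic Φ.IsGoodFor := by
  have hdeg : ∀ i, (dehom (Φ.k i)).natDegree ≤ d := fun i => natDegree_dehom_le (Φ.k_hom i)
  have hc := Φ.k_coprime.exists_coeff_ne_zero Φ.k_hom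
  have hμ := Φ.k_coprime.exists_eval_ne_zero Φ.k_hom
  refine ((((generic_sum_ne_zero hc).and (generic_sum_ne_zero (hμ 0))).and
    (Generic.forall_mem (dehom F).roots.toFinset fun μ _ => generic_sum_ne_zero (hμ μ))).and
    (generic_separable hdeg hc hμ)).mono fun c ⟨⟨⟨h1, h2⟩, h3⟩, h4⟩ => ⟨?_, ?_, ?_, h4⟩
  · rwa [coeff_combination]
  · rwa [eval_combination]
  · intro μ h
    rw [eval_combination]
    refine h3 μ ?_
    rw [Multiset.mem_toFinset, Polynomial.mem_roots Φ.dehom_ne_zero]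
    exact h

/-- The face of a good linear combination, and its Newton maps. -/
theorem exists_face_combination (Φ : NormalForm p q N d F f)
    (hF : IsFace (Ideal.span (Set.range f)) p q N) {c : Fin r → ℂ} (hc : Φ.IsGoodFor c)
    (hsupp : idealSupport (Ideal.span {∑ i, c i • f i}) = idealSupport (Ideal.span (Set.range f)))
    {n : ℕ} {σ : Fin n → NewtonMap} (hσ : Function.Injective σ)
    (hrange : Set.range σ = {τ | τ.p = p ∧ τ.q = q ∧ (dehom F).eval τ.μ = 0}) :
    ∃ S : Face (Ideal.span {∑ i, c i • f i}), (S.p = p ∧ S.q = q ∧ S.N = N ∧ S.d = 0) ∧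
      ∃ ρ : Fin d → NewtonMap, Function.Injective (Fin.append σ ρ) ∧
        Set.range (Fin.append σ ρ) = {τ | τ.p = p ∧ τ.q = q ∧
          MvPolynomial.eval ![1, τ.μ] S.F = 0} ∧
        ∀ j, IsMonomialLike ((ρ j).mapIdeal (Ideal.span {∑ i, c i • f i})) N 1 := by
  set K := combination (fun i => dehom (Φ.k i)) c with hK
  obtain ⟨hp, hq, hpq, hle, -⟩ := isFace_iff.1 hF
  have hfil := le_filtration_iff.2 hle
  have hf : ∀ i, f i ∈ filtration p q N := fun i => hfil (Ideal.subset_span ⟨i, rfl⟩)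
  obtain ⟨F', l, hl, hF', ⟨Φ'⟩⟩ := Φ.exists_combination hp hq hf c hc.coeff_ne hc.eval_zero_ne
  set g := ∑ i, c i • f i with hg
  have hgfil : g ∈ filtration p q N :=
    Ideal.sum_mem _ fun i _ => Submodule.smul_of_tower_mem _ _ (hf i)
  have hr : Set.range (fun _ : Fin 1 => g) = {g} := Set.range_const
  have hFg : IsFace (Ideal.span (Set.range fun _ : Fin 1 => g)) p q N := by
    rw [hr]
    exact (isFace_congr hsupp).2 hF
  have hS : ∃ S : Face (Ideal.span {g}), (S.p = p ∧ S.q = q ∧ S.N = N ∧ S.d = 0) ∧ S.F = F' := by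
    have : ∃ S : Face (Ideal.span (Set.range fun _ : Fin 1 => g)),
        (S.p = p ∧ S.q = q ∧ S.N = N ∧ S.d = 0) ∧ S.F = F' :=
      ⟨Φ'.toFace hFg, ⟨rfl, rfl, rfl, rfl⟩, rfl⟩
    rwa [hr] at this
  obtain ⟨S, hS1, hS2⟩ := hS
  have hKd : K.natDegree = d := le_antisymm
    (natDegree_combination_le (fun i => natDegree_dehom_le (Φ.k_hom i)) c)
    (Polynomial.le_natDegree_of_ne_zero hc.coeff_ne)
  -- The additional Newton maps come from the `d` simple roots of `K`, nonzero because `K(0) ≠ 0`.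
  obtain ⟨ξ, hξ, hξr⟩ := exists_roots_of_separable hc.separable hKd
  have hξK : ∀ j, K.eval (ξ j) = 0 := fun j => by
    have : ξ j ∈ Set.range ξ := ⟨j, rfl⟩
    rwa [hξr] at this
  have hξ0 : ∀ j, ξ j ≠ 0 := fun j h => hc.eval_zero_ne (h ▸ hξK j)
  choose ρ hρp hρq hρμ using fun j => NewtonMap.exists_of_coprime hp hq hpq (hξ0 j)
  have hσF : ∀ j, (dehom F).eval (σ j).μ = 0 := fun j => by
    have : σ j ∈ Set.range σ := ⟨j, rfl⟩
    rw [hrange] at this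
    exact this.2.2
  have hev : ∀ μ, MvPolynomial.eval ![1, μ] F' = 0 ↔ (dehom F).eval μ = 0 ∨ K.eval μ = 0 := by
    intro μ
    rw [← eval_dehom, hF', Polynomial.eval_mul, Polynomial.eval_mul, Polynomial.eval_C, mul_eq_zero,
      mul_eq_zero]
    simp [hl, K]
  refine ⟨S, hS1, ρ, ?_, ?_, fun j => ?_⟩
  · rw [Fin.append_injective_iff]
    refine ⟨hσ, fun j j' h => hξ ?_, fun i j h => ?_⟩
    · rw [← hρμ, h, hρμ]
    · have h1 := hσF i
      rw [h, hρμ] at h1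
      exact hc.eval_ne _ h1 (hξK j)
  · ext τ
    rw [mem_range_append, hrange, Set.mem_ofPred_eq, Set.mem_ofPred_eq, hS2, hev]
    constructor
    · rintro (⟨h1, h2, h3⟩ | ⟨j, rfl⟩)
      · exact ⟨h1, h2, Or.inl h3⟩
      · exact ⟨hρp j, hρq j, Or.inr (by rw [hρμ]; exact hξK j)⟩
    · rintro ⟨h1, h2, h3 | h3⟩
      · exact Or.inl ⟨h1, h2, h3⟩
      · right
        have : τ.μ ∈ Set.range ξ := by rw [hξr]; exact h3
        obtain ⟨j, hj⟩ := this
        exact ⟨j, NewtonMap.eq_of_eq ((hρp j).trans h1.symm) ((hρq j).trans h2.symm)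
          ((hρμ j).trans hj)⟩
  · have hsing : (ρ j).mapIdeal (Ideal.span {g}) = Ideal.span {(ρ j).toAlgHom g} := by
      rw [NewtonMap.mapIdeal, Ideal.map_span, Set.image_singleton]
    -- A root of `K` is simple and is not a root of `F`, so its multiplicity in the new face
    -- polynomial is one.
    have hm : (dehom (F' * Φ'.k 0)).rootMultiplicity (ρ j).μ = 1 := by
      have hk : (dehom (Φ'.k 0)).eval (ξ j) ≠ 0 := by
        obtain ⟨i, hi⟩ := Φ'.k_coprime.exists_eval_ne_zero Φ'.k_hom (ξ j)
        rwa [Subsingleton.elim i 0] at hi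
      have hFξ : (dehom F).eval (ξ j) ≠ 0 := fun h => hc.eval_ne _ h (hξK j)
      have hk0 : dehom (Φ'.k 0) ≠ 0 := by rintro h; simp [h] at hk
      have hK0 : K ≠ 0 := hc.separable.ne_zero
      have hl0 : Polynomial.C l ≠ 0 := Polynomial.C_ne_zero.2 hl
      rw [map_mul, Polynomial.rootMultiplicity_mul (mul_ne_zero Φ'.dehom_ne_zero hk0), hρμ, hF',
        Polynomial.rootMultiplicity_mul (mul_ne_zero hl0 (mul_ne_zero Φ.dehom_ne_zero hK0)),
        Polynomial.rootMultiplicity_mul (mul_ne_zero Φ.dehom_ne_zero hK0),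
        Polynomial.rootMultiplicity_eq_zero hk, Polynomial.rootMultiplicity_eq_zero hFξ,
        Polynomial.rootMultiplicity_C, add_zero, zero_add, zero_add]
      apply le_antisymm (Polynomial.rootMultiplicity_le_one_of_separable hc.separable _)
      exact (Polynomial.rootMultiplicity_pos hK0).2 (hξK j)
    have hne : F' * Φ'.k 0 ≠ 0 := by rintro h; simp [h] at hm
    have h1 := (ρ j).coeff_toAlgHom (by rw [hρp, hρq]; exact hgfil) (Φ'.mul_hom 0) hne
      (by rw [hρp, hρq]; exact Φ'.initialPart_eq 0) (by rw [hρp, hρq]; exact Φ'.weight_eq)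
    rw [hm] at h1
    rw [hsing]
    exact isMonomialLike_one_of_coeff
      ((ρ j).toAlgHom_mem_filtration (by rw [hρp, hρq]; exact hgfil)) (h1.1 0 one_pos) h1.2

end NormalForm

end NewtonTrees

namespace NewtonTrees

/-! ### Decorated trees -/

namespace Branch

/-- A vertical chain of vertices. -/
def chain {m : ℕ} (q p N d n : Fin m → ℕ) (h : (i : Fin m) → Fin (n i) → Branch) (b : Branch) :
    Branch :=
  Fin.foldr m (fun i b => vertex (q i) (p i) (N i) (d i) (n i) (h i) b) b

theorem chain_succ {m : ℕ} (q p N d n : Fin (m + 1) → ℕ) (h : (i : Fin (m + 1)) → Fin (n i) → Branch)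
    (b : Branch) : chain q p N d n h b = vertex (q 0) (p 0) (N 0) (d 0) (n 0) (h 0)
      (chain (fun i => q i.succ) (fun i => p i.succ) (fun i => N i.succ) (fun i => d i.succ)
        (fun i => n i.succ) (fun i => h i.succ) b) :=
  Fin.foldr_succ _ _

theorem addArrows_chain : ∀ {m : ℕ} (q p N d n : Fin m → ℕ)
    (h : (i : Fin m) → Fin (n i) → Branch) (b : Branch),
    (chain q p N d n h b).addArrows = chain q p N (fun _ => 0) (fun i => n i + d i)
      (fun i => Fin.append (fun j => (h i j).addArrows) fun _ => arrow 1) b.addArrows := by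
  intro m
  induction m with
  | zero => intros; rfl
  | succ m ih => intros; rw [chain_succ, chain_succ, addArrows, ih]

theorem contractInner_chain : ∀ {m : ℕ} (q p N d n : Fin m → ℕ)
    (h : (i : Fin m) → Fin (n i) → Branch) (b : Branch),
    (chain q p N d n h b).contractInner = chain q p N d n
      (fun i j => (h i j).contractInner.contractTop) b.contractInner := by
  intro m
  induction m with
  | zero => intros; rfl
  | succ m ih => intros; rw [chain_succ, chain_succ, contractInner, ih]

theorem apply_append {α β : Type*} (φ : α → β) {n d : ℕ} (s : Fin n → α) (t : Fin d → α)
    (j : Fin (n + d)) : φ (Fin.append s t j) = Fin.append (fun i => φ (s i)) (fun i => φ (t i)) j := by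
  refine Fin.addCases (fun i => ?_) (fun i => ?_) j <;> simp

/-- Shifting changes only the decorations `q` of vertices, so it leaves the new arrows untouched. -/
theorem addArrows_shift (c : ℕ) (B : Branch) : (B.shift c).addArrows = B.addArrows.shift c := by
  induction B generalizing c with
  | arrow m => rfl
  | vertex q p N d n h b ihh ihb =>
    simp only [shift, addArrows, ihh, ihb]
    congr 1
    funext j
    rw [apply_append (shift (c * p ^ 2))]
    rfl

theorem contractTop_eq (B : Branch) : (∃ q N h ν, B = vertex q 1 N 0 1 h (arrow 0) ∧
    h 0 = arrow ν ∧ B.contractTop = arrow ν) ∨ ((∀ q N h ν, h 0 = arrow ν →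
      B ≠ vertex q 1 N 0 1 h (arrow 0)) ∧ B.contractTop = B) := by
  by_cases hB : ∃ q N h, B = vertex q 1 N 0 1 h (arrow 0)
  · obtain ⟨q, N, h, rfl⟩ := hB
    cases h0 : h 0 with
    | arrow ν => exact Or.inl ⟨q, N, h, ν, rfl, h0, by simp only [contractTop, h0]⟩
    | vertex q' p' N' d' n' h' b' =>
      refine Or.inr ⟨?_, by simp only [contractTop, h0]⟩
      rintro q₁ N₁ h₁ ν hν heq
      injection heq with _ _ _ _ _ h2
      rw [h2, hν] at h0
      cases h0
  · refine Or.inr ⟨fun q N h ν _ heq => hB ⟨q, N, h, heq⟩, ?_⟩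
    unfold contractTop
    split
    · exact absurd ⟨_, _, _, rfl⟩ hB
    · rfl

/-- The test for contraction does not look at `q`, and `q` is all that a shift changes. -/
theorem contractTop_shift (c : ℕ) (B : Branch) :
    (B.shift c).contractTop = B.contractTop.shift c := by
  rcases contractTop_eq B with ⟨q, N, h, ν, rfl, h0, hB⟩ | ⟨hne, hB⟩
  · rw [hB]
    simp only [shift, contractTop, h0]
  · rw [hB]
    rcases contractTop_eq (B.shift c) with ⟨q, N, h, ν, hs, h0, -⟩ | ⟨-, hs⟩
    · exfalso
      cases B with
      | arrow m => simp [shift] at hs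
      | vertex q' p' N' d' n' h' b' =>
        simp only [shift] at hs
        injection hs with _ h2 _ h4 h5 h6 h7
        subst h2 h4 h5
        have h6 := congrFun (eq_of_heq h6) 0
        rw [h0] at h6
        cases h8 : h' 0 with
        | vertex => rw [h8] at h6; simp [shift] at h6
        | arrow ν' =>
          cases b' with
          | vertex => simp [shift] at h7
          | arrow m' =>
            simp only [shift, arrow.injEq] at h7
            subst h7
            exact hne _ _ _ _ h8 rfl
    · exact hs

theorem contractInner_shift (c : ℕ) (B : Branch) :
    (B.shift c).contractInner = B.contractInner.shift c := by
  induction B generalizing c with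
  | arrow m => rfl
  | vertex q p N d n h b ihh ihb => simp only [shift, contractInner, ihh, ihb, contractTop_shift]

theorem shift_eq_arrow {c ν : ℕ} {B : Branch} (h : B.shift c = arrow ν) : B = arrow ν := by
  cases B with
  | arrow m => exact h
  | vertex => simp [shift] at h

/-- The chains that can be contracted. -/
theorem contractTop_chain_eq {m : ℕ} (q p N d n : Fin m → ℕ) (h : (i : Fin m) → Fin (n i) → Branch)
    (β : ℕ) : (chain q p N d n h (arrow β)).contractTop = chain q p N d n h (arrow β) ∨
      β = 0 ∧ ∃ i₀ : Fin m, (∀ i, i = i₀) ∧ p i₀ = 1 ∧ d i₀ = 0 ∧ ∃ j₀ : Fin (n i₀),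
        (∀ j, j = j₀) ∧ ∃ ν, h i₀ j₀ = arrow ν := by
  rcases contractTop_eq (chain q p N d n h (arrow β)) with ⟨Q, M, H, ν, heq, h0, -⟩ | ⟨-, h1⟩
  · right
    cases m with
    | zero => simp [chain] at heq
    | succ m =>
      rw [chain_succ] at heq
      injection heq with _ h2 _ h4 h5 h6 h7
      cases m with
      | succ m => rw [chain_succ] at h7; simp at h7
      | zero =>
        simp only [chain, Fin.foldr_zero, arrow.injEq] at h7
        refine ⟨h7, 0, fun i => Fin.fin_one_eq_zero i, h2, h4, ?_⟩
        -- The index type `Fin (n 0)` must become a variable before `n 0 = 1` can be substituted.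
        generalize h 0 = h₀ at *
        generalize n 0 = n₀ at *
        subst h5
        refine ⟨0, fun j => Subsingleton.elim _ _, ν, ?_⟩
        rw [eq_of_heq h6, h0]
  · exact Or.inl h1

theorem contractTop_chain_of {m : ℕ} {q p N d n : Fin m → ℕ} {h : (i : Fin m) → Fin (n i) → Branch}
    {ν : ℕ} (i₀ : Fin m) (hi : ∀ i, i = i₀) (hp : p i₀ = 1) (hd : d i₀ = 0) (j₀ : Fin (n i₀))
    (hj : ∀ j, j = j₀) (hν : h i₀ j₀ = arrow ν) :
    (chain q p N d n h (arrow 0)).contractTop = arrow ν := by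
  cases m with
  | zero => exact i₀.elim0
  | succ m =>
    cases m with
    | succ m => exact absurd ((hi 0).trans (hi 1).symm) (by simp)
    | zero =>
      have h0 : i₀ = 0 := Fin.fin_one_eq_zero i₀
      subst h0
      rw [chain_succ]
      simp only [chain, Fin.foldr_zero]
      have hn : n 0 = 1 := by
        have := Fintype.card_eq_one_iff.2 ⟨j₀, hj⟩
        rwa [Fintype.card_fin] at this
      rw [hp, hd]
      generalize h 0 = h₀ at *
      generalize n 0 = n₀ at *
      subst hn
      rw [Subsingleton.elim j₀ 0] at hν
      simp only [contractTop, hν]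

end Branch

end NewtonTrees

namespace NewtonTrees

open MvPowerSeries

/-! ### Newton trees reduced to an arrow -/

theorem IsTreeOf.eq_arrow {I : Ideal PS} {t : ℕ} {B : Branch}
    (h : IsTreeOf (fun J => ¬ IsDepthZero J) I t B) {k ν : ℕ} (hI : IsMonomialLike I k ν) :
    t = k ∧ B = Branch.arrow ν := by
  cases h with
  | halt _ k' ν' hI' =>
    exact ⟨hI'.topOrder_eq.1.symm.trans hI.topOrder_eq.1,
      congrArg Branch.arrow (hI'.topOrder_eq.2.symm.trans hI.topOrder_eq.2)⟩
  | step _ hd => exact absurd ⟨k, ν, hI⟩ hd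

/-- A step yields a bare arrow only if there is no face; the diagram then has a single vertex, which
already means depth zero. -/
theorem IsTreeOf.isDepthZero_of_arrow {I : Ideal PS} (hne : I ≠ ⊥) {t ν : ℕ} {B : Branch}
    (h : IsTreeOf (fun J => ¬ IsDepthZero J) I t B) (hB : B = Branch.arrow ν) :
    IsDepthZero I := by
  cases h with
  | halt _ k' ν' hI' => exact ⟨_, _, hI'⟩
  | step _ hd m S sorted complete n σ inj ran C glued =>
    cases m with
    | succ m => rw [Fin.foldr_succ] at hB; simp at hB
    | zero =>
      by_cases hlt : bottomOrder I < height I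
      · obtain ⟨p, q, N, hF, -⟩ := exists_isFace_top hne hlt
        exact (complete p q N hF).choose.elim0
      · exact ⟨_, _, isMonomialLike_of_height_le hne (not_lt.1 hlt)⟩

/-! ### The contraction of a stage -/

namespace NormalForm

variable {p q N d : ℕ} {F : MvPolynomial (Fin 2) ℂ} {r : ℕ} {f : Fin r → PS}

theorem le_of_mem_idealSupport (Φ : NormalForm p q N d F f) (hp : 0 < p) (hq : 0 < q)
    (hf : ∀ i, f i ∈ filtration p q N) {m : Fin 2 →₀ ℕ}
    (hm : m ∈ idealSupport (Ideal.span (Set.range f))) (hN : p * m 0 + q * m 1 = N) :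
    Φ.a ≤ m 0 ∧ Φ.b ≤ m 1 := by
  obtain ⟨g, hg, hne⟩ := hm
  obtain ⟨a, rfl⟩ := Ideal.mem_span_range_iff_exists_fun.1 hg
  have h1 : coeff m (initialPart p q N (∑ i, a i * f i)) ≠ 0 := by
    rwa [coeff_initialPart, if_pos hN]
  rw [initialPart_sum_mul hp hq _ _ hf, map_sum] at h1
  obtain ⟨i, -, hi⟩ := Finset.exists_ne_zero_of_sum_ne_zero h1
  rw [coeff_C_mul, coeff_initialPart, if_pos hN] at hi
  exact Φ.le_of_coeff_ne_zero (right_ne_zero_of_mul hi) hN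

end NormalForm

theorem eq_of_rootMultiplicity_eq_natDegree {R : Polynomial ℂ} (hR : R ≠ 0) {μ ξ : ℂ}
    (h : R.rootMultiplicity μ = R.natDegree) (hξ : R.eval ξ = 0) : ξ = μ := by
  rw [(IsAlgClosed.splits R).natDegree_eq_card_roots, ← Polynomial.count_roots,
    Multiset.count_eq_card] at h
  exact (h ξ ((Polynomial.mem_roots hR).2 hξ)).symm

theorem rootMultiplicity_eq_natDegree {R : Polynomial ℂ} (hR : R ≠ 0) {μ : ℂ}
    (h : ∀ ξ, R.eval ξ = 0 → ξ = μ) : R.rootMultiplicity μ = R.natDegree := by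
  rw [(IsAlgClosed.splits R).natDegree_eq_card_roots, ← Polynomial.count_roots,
    Multiset.count_eq_card]
  exact fun ξ hξ => (h ξ ((Polynomial.mem_roots hR).1 hξ)).symm

/-- If the stage of an ideal can be contracted, the ideal has depth zero. -/
theorem contractTop_chain_of_not_isDepthZero {I : Ideal PS} {r : ℕ} {f : Fin r → PS}
    (hf : I = Ideal.span (Set.range f)) (hI : I ≠ ⊥) (hd : ¬ IsDepthZero I) {m : ℕ}
    (S : Fin m → Face I)
    (complete : ∀ p q N, IsFace I p q N → ∃ i, (S i).p = p ∧ (S i).q = q ∧ (S i).N = N)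
    {n : Fin m → ℕ} (σ : (i : Fin m) → Fin (n i) → NewtonMap)
    (range_eq : ∀ i, Set.range (σ i) =
      {τ | τ.p = (S i).p ∧ τ.q = (S i).q ∧ MvPolynomial.eval ![1, τ.μ] (S i).F = 0})
    {B : (i : Fin m) → Fin (n i) → Branch}
    (glued : ∀ i j, IsTreeOf (fun J => ¬ IsDepthZero J) ((σ i j).mapIdeal I) (S i).N (B i j)) :
    (Branch.chain (fun i => (S i).q) (fun i => (S i).p) (fun i => (S i).N) (fun i => (S i).d) n
      (fun i j => (B i j).shift ((S i).p * (S i).q)) (Branch.arrow (bottomOrder I))).contractTop =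
    Branch.chain (fun i => (S i).q) (fun i => (S i).p) (fun i => (S i).N) (fun i => (S i).d) n
      (fun i j => (B i j).shift ((S i).p * (S i).q)) (Branch.arrow (bottomOrder I)) := by
  refine (Branch.contractTop_chain_eq _ _ _ _ _ _ _).resolve_right ?_
  rintro ⟨hβ, i₀, hi, hp1, hd0, j₀, hj, ν, hν⟩
  have hν := Branch.shift_eq_arrow hν
  obtain ⟨Φ⟩ := (S i₀).nonempty_normalForm hf
  obtain ⟨hp, hq, hpq, hle, -⟩ := isFace_iff.1 (S i₀).isFace
  have hfil : ∀ l, f l ∈ filtration (S i₀).p (S i₀).q (S i₀).N := fun l =>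
    (S i₀).le_filtration (hf ▸ Ideal.subset_span ⟨l, rfl⟩)
  have hτ : σ i₀ j₀ ∈ Set.range (σ i₀) := ⟨j₀, rfl⟩
  rw [range_eq] at hτ
  obtain ⟨hτp, hτq, hτμ⟩ := hτ
  obtain ⟨hmem, ht, hh⟩ := Φ.topOrder_mapIdeal hfil (σ i₀ j₀) hτp hτq
  rw [← hf] at hmem ht hh
  have hdz := (glued i₀ j₀).isDepthZero_of_arrow (ne_bot_of_mem_idealSupport hmem) hν
  have hface : ∀ p q N, IsFace I p q N → p = (S i₀).p ∧ q = (S i₀).q ∧ N = (S i₀).N := by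
    intro p q N hF
    obtain ⟨i, h1, h2, h3⟩ := complete p q N hF
    rw [hi i] at h1 h2 h3
    exact ⟨h1.symm, h2.symm, h3.symm⟩
  -- A single glued edge means a single root, so `F(1, X)` is a power of `X - μ`.
  have hroot : (dehom (S i₀).F).rootMultiplicity (σ i₀ j₀).μ = Φ.e := by
    rw [← Φ.natDegree_dehom]
    apply rootMultiplicity_eq_natDegree Φ.dehom_ne_zero
    intro ξ hξ
    have hξ0 : ξ ≠ 0 := fun h => Φ.F_eval (h ▸ hξ)
    obtain ⟨τ, h1, h2, rfl⟩ := NewtonMap.exists_of_coprime hp hq hpq hξ0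
    have : τ ∈ Set.range (σ i₀) := by
      rw [range_eq]
      exact ⟨h1, h2, by rw [← eval_dehom]; exact hξ⟩
    obtain ⟨j, rfl⟩ := this
    rw [hj j]
  have hupper : expo Φ.a (Φ.b + (S i₀).p * (Φ.e + (S i₀).d)) ∈ idealSupport I := by
    obtain ⟨l, hl⟩ := Φ.exists_coeff_upper hp hq
    exact ⟨f l, hf ▸ Ideal.subset_span ⟨l, rfl⟩, hl⟩
  have hlower : expo (Φ.a + (S i₀).q * (Φ.e + (S i₀).d)) Φ.b ∈ idealSupport I := by
    obtain ⟨l, hl⟩ := Φ.exists_coeff_lower hp hq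
    exact ⟨f l, hf ▸ Ideal.subset_span ⟨l, rfl⟩, hl⟩
  have hweight := Φ.weight_eq
  -- If the face ended above ordinate `0`, the bottom order being `0`, there would be a second face
  -- below it.
  have hb : Φ.b = 0 := by
    by_contra hb
    obtain ⟨p', q', N', hF', -, hlt⟩ := exists_isFace_below hlower (p := (S i₀).p) (q := (S i₀).q)
      (N := (S i₀).N) hp (by
        refine Eq.trans ?_ hweight
        simp only [expo_apply_zero, expo_apply_one]; ring) hle
      (fun m' hm' hlt => by
        refine lt_of_le_of_ne (hle m' hm') fun h => ?_
        have := (Φ.le_of_mem_idealSupport hp hq hfil (hf ▸ hm') h.symm).2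
        simp only [expo_apply_one] at hlt
        omega)
      (by
        obtain ⟨m', hm', h⟩ := exists_mem_bottomOrder hI
        refine ⟨m', hm', ?_⟩
        simp only [expo_apply_one]
        omega)
    obtain ⟨rfl, rfl, -⟩ := hface p' q' N' hF'
    exact lt_irrefl _ hlt
  have hbh : bottomOrder I < height I := by
    by_contra hlt
    exact hd ⟨_, _, isMonomialLike_of_height_le hI (not_lt.1 hlt)⟩
  -- The upper vertex lies on a face, hence on this one. With `p = 1` and `b = d = 0` it follows
  -- that `e` is the height, so the Newton map preserves the height and depth zero descends.
  obtain ⟨P, Q, M, hF, hPQ⟩ := exists_isFace_top hI hbh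
  obtain ⟨rfl, rfl, rfl⟩ := hface P Q M hF
  have ha : Φ.a = topOrder I := by
    apply le_antisymm
    · have htop : expo (topOrder I) (height I) ∈ idealSupport (Ideal.span (Set.range f)) := by
        rw [← hf]
        exact expo_height_mem hI
      simpa using (Φ.le_of_mem_idealSupport hp hq hfil htop (by simpa using hPQ)).1
    · simpa using topOrder_le hupper
  have he : Φ.e = height I := by
    simp only [hp1, hd0, hb, ha, one_mul, mul_zero, add_zero] at hweight
    rw [hp1, one_mul] at hPQ
    exact Nat.eq_of_mul_eq_mul_left hq (by omega)
  exact hd ((σ i₀ j₀).isDepthZero_of_mapIdeal (hτp.trans hp1) hI (hh.trans (hroot.trans he)) hdz)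

/-- The only face of an ideal of depth zero that has a face. -/
theorem IsMonomialLike.exists_face {I : Ideal PS} {k ν : ℕ} (hI : IsMonomialLike I k ν)
    (hlt : bottomOrder I < height I) :
    bottomOrder I = 0 ∧ ∃ e, IsFace I 1 e (k + e * ν) ∧
      (∀ p q N, IsFace I p q N → p = 1 ∧ q = e ∧ N = k + e * ν) ∧
      ∃ τ : NewtonMap, τ.p = 1 ∧ τ.q = e ∧ IsMonomialLike (τ.mapIdeal I) (k + e * ν) ν := by
  classical
  obtain ⟨htop, hheight⟩ := hI.topOrder_eq
  have hne := hI.ne_bot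
  obtain ⟨h, hh, hIeq⟩ := hI
  have hh0 : h ≠ 0 := by
    rintro rfl
    obtain ⟨m, hm, hb⟩ := exists_mem_bottomOrder hne
    have : I ≤ filtration 0 1 ν := by
      rw [hIeq, Ideal.span_singleton_le_iff_mem, add_zero]
      apply Ideal.mul_mem_left
      simpa using pow_mem_filtration (X_one_mem_filtration 0 1) ν
    have := le_filtration_iff.1 this m hm
    omega
  have hex : ∃ e, coeff (expo e 0) h ≠ 0 := by
    by_contra! hcon
    apply hh0
    ext m
    rw [map_zero]
    by_contra hm
    apply hm
    rw [← expo_eta m, (hh m hm).1]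
    exact hcon _
  -- With `e` the order of `h`, the face joins `(k, ν)` to `(k + e ν, 0)`.
  obtain ⟨e, he, hmin⟩ : ∃ e, coeff (expo e 0) h ≠ 0 ∧ ∀ e' < e, coeff (expo e' 0) h = 0 :=
    ⟨Nat.find hex, Nat.find_spec hex, fun e' he' => not_not.1 (Nat.find_min hex he')⟩
  have he0 : 0 < e := Nat.pos_of_ne_zero (by simpa using (hh _ he).2)
  have hfilh : h ∈ filtration 1 0 e := by
    intro m hm
    by_contra hcon
    apply hm
    rw [← expo_eta m, (hh m hm).1]
    exact hmin _ (by omega)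
  have hIfil : I ≤ filtration 1 e (k + e * ν) := by
    rw [hIeq, Ideal.span_singleton_le_iff_mem]
    apply mul_mem_filtration
    · simpa using pow_mem_filtration (X_zero_mem_filtration 1 e) k
    · refine pow_mem_filtration (add_mem (X_one_mem_filtration 1 e) fun m hm => ?_) ν
      have := hfilh m hm
      nlinarith [Nat.zero_le (e * m 1)]
  have hupper : expo k ν ∈ idealSupport I := by
    have := expo_height_mem hne
    rwa [htop, hheight] at this
  have hlower : expo (k + e * ν) 0 ∈ idealSupport I := by
    refine ⟨X 0 ^ k * (X 1 + h) ^ ν, by rw [hIeq]; exact Ideal.subset_span rfl, ?_⟩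
    rw [coeff_X_zero_pow_mul, coeff_X_add_pow_of_order hfilh]
    exact pow_ne_zero _ he
  have hbot : bottomOrder I = 0 := by simpa using bottomOrder_le hlower
  have hν : 0 < ν := by omega
  have hface : IsFace I 1 e (k + e * ν) := by
    rw [isFace_iff]
    refine ⟨one_pos, he0, Nat.coprime_one_left e, le_filtration_iff.1 hIfil, _, hupper, _, hlower,
      fun h => ?_, by simp, by simp⟩
    have := DFunLike.congr_fun h 1
    simp only [expo_apply_one] at this
    omega
  refine ⟨hbot, e, hface, fun p q N hF => ?_, ?_⟩
  -- Both ends of this segment satisfy the inequality of any other face. Comparing with a point of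
  -- that face below the upper end, and with one above the lower end, bounds its slope from both
  -- sides.
  · have hs : e * p = q * 1 := by
      obtain ⟨hp, hq, -, hle, -⟩ := isFace_iff.1 hF
      obtain ⟨m, hm, m', hm', hlt, hN, hN'⟩ := hF.exists_ordinate_lt
      have h1 := le_filtration_iff.1 hIfil m hm
      have h2 := le_filtration_iff.1 hIfil m' hm'
      have h3 := hle _ hupper
      have h4 := hle _ hlower
      have h5 := (hF.ordinate_le_height hne hm' hN').1
      simp only [expo_apply_zero, expo_apply_one, mul_zero, add_zero, one_mul] at h1 h2 h3 h4
      rw [hheight] at h5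
      zify at *
      rw [mul_one]
      apply le_antisymm
      · have hw : (0 : ℤ) < ν - m 1 := by linarith
        have h6 : (p : ℤ) * (k + e * ν) ≤ p * (m 0 + e * m 1) :=
          mul_le_mul_of_nonneg_left h1 (by positivity)
        have h7 : (e * p : ℤ) * (ν - m 1) ≤ q * (ν - m 1) := by linarith
        exact le_of_mul_le_mul_right h7 hw
      · have hw : (0 : ℤ) < m' 1 := by
          have : (0 : ℤ) ≤ m 1 := by positivity
          linarith
        have h6 : (p : ℤ) * (k + e * ν) ≤ p * (m' 0 + e * m' 1) :=
          mul_le_mul_of_nonneg_left h2 (by positivity)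
        have h7 : (q : ℤ) * m' 1 ≤ (e * p) * m' 1 := by linarith
        exact le_of_mul_le_mul_right h7 hw
    obtain ⟨h1, h2, h3⟩ := hface.eq_of_slope_eq hF hs
    exact ⟨h1.symm, h2.symm, h3.symm⟩
  · obtain ⟨A, hA⟩ := exists_eq_X_zero_pow_mul hfilh
    have hAc : ∀ i j, coeff (expo (e + i) j) h = coeff (expo i j) A := fun i j => by
      rw [hA, coeff_X_zero_pow_mul]
    set c := constantCoeff A with hc
    have hc0 : c ≠ 0 := by
      have := hAc 0 0
      rw [add_zero, expo_zero_zero, coeff_zero_eq_constantCoeff_apply] at this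
      rwa [this] at he
    have hAX : IsXSeries (A - C c) := by
      intro m hm
      by_cases hm0 : m = 0
      · subst hm0
        rw [coeff_zero_eq_constantCoeff_apply, map_sub, constantCoeff_C, sub_self] at hm
        exact absurd rfl hm
      · rw [map_sub, coeff_C, if_neg hm0, sub_zero, ← expo_eta m, ← hAc] at hm
        have h1 := (hh _ hm).1
        simp only [expo_apply_one] at h1
        refine ⟨h1, fun h2 => hm0 ?_⟩
        rw [← expo_eta m, h1, h2, expo_zero_zero]
    -- Writing `h = x^e A` with `A(0) = c`, the root is `μ = -c`: then `y + h` becomes `x^e (y + (A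
    -- - c))`.
    obtain ⟨τ, hp, hq, hμ⟩ := NewtonMap.exists_of_coprime one_pos he0 (Nat.coprime_one_left e)
      (neg_ne_zero.2 hc0)
    refine ⟨τ, hp, hq, A - C c, hAX, ?_⟩
    have hq' : τ.q' = 0 := by have := τ.q'_lt; omega
    have hp' : τ.p' = 1 := by have := τ.bezout; rw [hp, hq'] at this; omega
    have hX0 : τ.toAlgHom (X 0) = X 0 := by
      rw [τ.toAlgHom_X_zero, hq', hp, pow_zero, pow_one, map_one, one_mul]
    have hX1 : τ.toAlgHom (X 1) = X 0 ^ e * (X 1 + C (-c)) := by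
      rw [τ.toAlgHom_X_one, hq, hp', pow_one, hμ]
    have hτh : τ.toAlgHom h = h := by
      rw [τ.toAlgHom_apply]
      refine subst_eq_self_of_isXSeries τ.hasSubst_subs ?_ hh
      rw [← subst_X (R := ℂ) τ.hasSubst_subs 0, ← τ.toAlgHom_apply, hX0]
    rw [NewtonMap.mapIdeal, hIeq, Ideal.map_span, Set.image_singleton]
    congr 2
    have h1 : τ.toAlgHom (X 0 ^ k * (X 1 + h) ^ ν) =
        X 0 ^ k * (X 0 ^ e * (X 1 + C (-c)) + h) ^ ν := by
      rw [map_mul, map_pow, map_pow, map_add, hX0, hX1, hτh]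
    refine h1.trans ?_
    rw [hA, pow_add, pow_mul, mul_assoc, ← mul_pow, map_neg]
    congr 2
    ring

/-- The stage of an ideal of depth zero with a face is contracted. -/
theorem contractTop_chain_of_isMonomialLike {I : Ideal PS} {r : ℕ} {f : Fin r → PS}
    (hf : I = Ideal.span (Set.range f)) {k ν : ℕ} (hI : IsMonomialLike I k ν)
    (hlt : bottomOrder I < height I) {m : ℕ} (S : Fin m → Face I)
    (sorted : ∀ i j, i < j → (S i).q * (S j).p < (S j).q * (S i).p)
    (complete : ∀ p q N, IsFace I p q N → ∃ i, (S i).p = p ∧ (S i).q = q ∧ (S i).N = N)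
    {n : Fin m → ℕ} (σ : (i : Fin m) → Fin (n i) → NewtonMap)
    (injective : ∀ i, Function.Injective (σ i))
    (range_eq : ∀ i, Set.range (σ i) =
      {τ | τ.p = (S i).p ∧ τ.q = (S i).q ∧ MvPolynomial.eval ![1, τ.μ] (S i).F = 0})
    {B : (i : Fin m) → Fin (n i) → Branch}
    (glued : ∀ i j, IsTreeOf (fun J => ¬ IsDepthZero J) ((σ i j).mapIdeal I) (S i).N (B i j)) :
    (Branch.chain (fun i => (S i).q) (fun i => (S i).p) (fun i => (S i).N) (fun i => (S i).d) n
      (fun i j => (B i j).shift ((S i).p * (S i).q)) (Branch.arrow (bottomOrder I))).contractTop =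
    Branch.arrow ν := by
  obtain ⟨hbot, e, hface, huniq, τ, hτp, hτq, hτ⟩ := hI.exists_face hlt
  have hne := hI.ne_bot
  have hS : ∀ i, (S i).p = 1 ∧ (S i).q = e ∧ (S i).N = k + e * ν := fun i => huniq _ _ _ (S i).isFace
  obtain ⟨i₀, -⟩ := complete _ _ _ hface
  have hi : ∀ i, i = i₀ := by
    have hnlt : ∀ i j, ¬ i < j := fun i j hij => by
      have := sorted i j hij
      rw [(hS i).1, (hS i).2.1, (hS j).1, (hS j).2.1] at this
      exact lt_irrefl _ this
    exact fun i => le_antisymm (not_lt.1 (hnlt _ _)) (not_lt.1 (hnlt _ _))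
  obtain ⟨hp1, hqe, hN⟩ := hS i₀
  obtain ⟨Φ⟩ := (S i₀).nonempty_normalForm hf
  obtain ⟨hp, hq, -⟩ := isFace_iff.1 (S i₀).isFace
  have hfil : ∀ l, f l ∈ filtration (S i₀).p (S i₀).q (S i₀).N := fun l =>
    (S i₀).le_filtration (hf ▸ Ideal.subset_span ⟨l, rfl⟩)
  have hmult : (dehom (S i₀).F).rootMultiplicity τ.μ = ν := by
    rw [← (Φ.topOrder_mapIdeal hfil τ (hτp.trans hp1.symm) (hτq.trans hqe.symm)).2.2, ← hf]
    exact hτ.topOrder_eq.2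
  -- As the multiplicity of the root is already `ν`, this bound leaves room for nothing else: `d =
  -- 0` and there is no other root.
  have hbound : Φ.b + (S i₀).p * (Φ.e + (S i₀).d) ≤ ν := by
    obtain ⟨l, hl⟩ := Φ.exists_coeff_upper hp hq
    have := ((S i₀).isFace.ordinate_le_height hne ⟨f l, hf ▸ Ideal.subset_span ⟨l, rfl⟩, hl⟩ (by
      refine Eq.trans ?_ Φ.weight_eq
      simp only [expo_apply_zero, expo_apply_one]; ring)).1
    rwa [expo_apply_one, hI.topOrder_eq.2] at this
  have hνpos : 0 < ν := by have := hI.topOrder_eq.2; omega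
  have hmle : ν ≤ Φ.e := by
    rw [← hmult, ← Φ.natDegree_dehom, ← Polynomial.count_roots]
    exact (Multiset.count_le_card _ _).trans (Polynomial.card_roots' _)
  simp only [hp1, one_mul] at hbound
  have hd0 : (S i₀).d = 0 := by omega
  have hroots : ∀ ξ, (dehom (S i₀).F).eval ξ = 0 → ξ = τ.μ := fun ξ hξ =>
    eq_of_rootMultiplicity_eq_natDegree Φ.dehom_ne_zero
      (by rw [hmult, Φ.natDegree_dehom]; omega) hξ
  have hτmem : τ ∈ Set.range (σ i₀) := by
    rw [range_eq]
    refine ⟨hτp.trans hp1.symm, hτq.trans hqe.symm, ?_⟩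
    rw [← eval_dehom]
    exact (Polynomial.rootMultiplicity_pos Φ.dehom_ne_zero).1 (hmult ▸ hνpos)
  obtain ⟨j₀, hj₀⟩ := hτmem
  have hj : ∀ j, j = j₀ := by
    intro j
    have : σ i₀ j ∈ Set.range (σ i₀) := ⟨j, rfl⟩
    rw [range_eq] at this
    obtain ⟨h1, h2, h3⟩ := this
    rw [← eval_dehom] at h3
    apply injective i₀
    rw [hj₀]
    exact NewtonMap.eq_of_eq (h1.trans (hp1.trans hτp.symm)) (h2.trans (hqe.trans hτq.symm))
      (hroots _ h3)
  have hB := ((glued i₀ j₀).eq_arrow (hj₀ ▸ hτ)).2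
  rw [hbot]
  exact Branch.contractTop_chain_of i₀ hi hp1 hd0 j₀ hj (by rw [hB]; rfl)

end NewtonTrees

namespace NewtonTrees

open MvPowerSeries

/-! ### The Newton tree of a generic linear combination -/

/-- Writing `fᵢ = G aᵢ`, some `aᵢ` is a unit because the `fᵢ` generate `(G)`; a generic combination
of the `aᵢ` is then a unit. -/
theorem generic_span_eq {r : ℕ} {f : Fin r → PS} {G : PS} (hG : G ≠ 0)
    (hf : Ideal.span (Set.range f) = Ideal.span {G}) :
    Generic fun c => Ideal.span {∑ i, c i • f i} = Ideal.span {G} := by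
  have hdvd : ∀ i, ∃ a, f i = G * a := fun i => by
    have : f i ∈ Ideal.span {G} := hf ▸ Ideal.subset_span ⟨i, rfl⟩
    exact Ideal.mem_span_singleton.1 this
  choose a ha using hdvd
  have hex : ∃ i, constantCoeff (a i) ≠ 0 := by
    have hmem : G ∈ Ideal.span (Set.range f) := by
      rw [hf]
      exact Ideal.subset_span rfl
    obtain ⟨b, hb⟩ := Ideal.mem_span_range_iff_exists_fun.1 hmem
    have h1 : G * ∑ i, b i * a i = G * 1 := by
      rw [mul_one]
      conv_rhs => rw [← hb]
      rw [Finset.mul_sum]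
      exact Finset.sum_congr rfl fun i _ => by rw [ha i]; ring
    have h2 := congrArg constantCoeff (mul_left_cancel₀ hG h1)
    by_contra! hcon
    simp [map_sum, hcon] at h2
  refine (generic_sum_ne_zero hex).mono fun c hc => ?_
  have h1 : ∑ i, c i • f i = (∑ i, c i • a i) * G := by
    rw [Finset.sum_mul]
    exact Finset.sum_congr rfl fun i _ => by rw [ha i, smul_mul_assoc, mul_comm G]
  rw [h1, Ideal.span_singleton_mul_left_unit]
  rw [MvPowerSeries.isUnit_iff_constantCoeff, isUnit_iff_ne_zero, map_sum]
  simpa [smul_eq_C_mul] using hc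

/-- Genericity is imposed on the faces of one tree; uniqueness of the normal form transfers it to
the face data of any other tree. -/
theorem NormalForm.eq_and_isGoodFor {p q N d p' q' N' d' : ℕ} {F F' : MvPolynomial (Fin 2) ℂ}
    {r : ℕ} {f : Fin r → PS} (hp : 0 < p) (hpp : p = p') (hqq : q = q') (hNN : N = N')
    (Φ : NormalForm p q N d F f) (Φ' : NormalForm p' q' N' d' F' f) {c : Fin r → ℂ}
    (hc : Φ.IsGoodFor c) : F = F' ∧ ∃ Ψ : NormalForm p' q' N' d' F' f, Ψ.IsGoodFor c := by
  subst hpp hqq hNN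
  obtain ⟨rfl, rfl⟩ := NormalForm.unique hp Φ Φ'
  exact ⟨rfl, Φ, hc⟩

theorem NewtonMap.mapIdeal_span_sum (τ : NewtonMap) {r : ℕ} (f : Fin r → PS) (c : Fin r → ℂ) :
    τ.mapIdeal (Ideal.span {∑ i, c i • f i}) = Ideal.span {∑ i, c i • τ.toAlgHom (f i)} := by
  rw [NewtonMap.mapIdeal, Ideal.map_span, Set.image_singleton, map_sum]
  simp only [map_smul]

/-- The step of the algorithm at a generic linear combination of the generators. -/
theorem trees_of_step {I : Ideal PS} {r : ℕ} {f : Fin r → PS}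
    (hf : I = Ideal.span (Set.range f)) (hI : I ≠ ⊥) (hd : ¬ IsDepthZero I) {c : Fin r → ℂ}
    (hsupp : idealSupport (Ideal.span {∑ i, c i • f i}) = idealSupport (Ideal.span (Set.range f)))
    {m : ℕ} (S : Fin m → Face I)
    (sorted : ∀ i j, i < j → (S i).q * (S j).p < (S j).q * (S i).p)
    (complete : ∀ p q N, IsFace I p q N → ∃ i, (S i).p = p ∧ (S i).q = q ∧ (S i).N = N)
    (hgood : ∀ i, ∃ Φ : NormalForm (S i).p (S i).q (S i).N (S i).d (S i).F f, Φ.IsGoodFor c)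
    {n : Fin m → ℕ} (σ : (i : Fin m) → Fin (n i) → NewtonMap)
    (injective : ∀ i, Function.Injective (σ i))
    (range_eq : ∀ i, Set.range (σ i) =
      {τ | τ.p = (S i).p ∧ τ.q = (S i).q ∧ MvPolynomial.eval ![1, τ.μ] (S i).F = 0})
    {B : (i : Fin m) → Fin (n i) → Branch}
    (hB : ∀ i j, IsTreeOf (fun _ => True) ((σ i j).mapIdeal (Ideal.span {∑ i, c i • f i}))
      (S i).N (B i j).addArrows)
    (hB' : ∀ i j, IsTreeOf (fun J => ¬ IsDepthZero J)
      ((σ i j).mapIdeal (Ideal.span {∑ i, c i • f i})) (S i).N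
      (B i j).addArrows.contractInner.contractTop) :
    IsTreeOf (fun _ => True) (Ideal.span {∑ i, c i • f i}) (topOrder I)
      (Branch.chain (fun i => (S i).q) (fun i => (S i).p) (fun i => (S i).N) (fun i => (S i).d) n
        (fun i j => (B i j).shift ((S i).p * (S i).q)) (Branch.arrow (bottomOrder I))).addArrows ∧
    IsTreeOf (fun J => ¬ IsDepthZero J) (Ideal.span {∑ i, c i • f i}) (topOrder I)
      (Branch.chain (fun i => (S i).q) (fun i => (S i).p) (fun i => (S i).N) (fun i => (S i).d) n
        (fun i j => (B i j).shift ((S i).p * (S i).q))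
        (Branch.arrow (bottomOrder I))).addArrows.contractInner.contractTop := by
  set g := ∑ i, c i • f i with hg
  have hsupp' : idealSupport (Ideal.span {g}) = idealSupport I := hf ▸ hsupp
  have hr : Ideal.span {g} = Ideal.span (Set.range fun _ : Fin 1 => g) := by rw [Set.range_const]
  have hface : ∀ i, ∃ S' : Face (Ideal.span {g}),
      (S'.p = (S i).p ∧ S'.q = (S i).q ∧ S'.N = (S i).N ∧ S'.d = 0) ∧
      ∃ ρ : Fin (S i).d → NewtonMap, Function.Injective (Fin.append (σ i) ρ) ∧
        Set.range (Fin.append (σ i) ρ) = {τ | τ.p = (S i).p ∧ τ.q = (S i).q ∧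
          MvPolynomial.eval ![1, τ.μ] S'.F = 0} ∧
        ∀ j, IsMonomialLike ((ρ j).mapIdeal (Ideal.span {g})) (S i).N 1 := by
    intro i
    obtain ⟨Φ, hΦ⟩ := hgood i
    refine Φ.exists_face_combination (hf ▸ (S i).isFace) hΦ hsupp (injective i) ?_
    rw [range_eq]
    simp only [eval_dehom]
  choose S' hS' ρ hinj hrange hρ using hface
  have hSp := fun i => (hS' i).1
  have hSq := fun i => (hS' i).2.1
  have hSN := fun i => (hS' i).2.2.1
  have hSd := fun i => (hS' i).2.2.2
  have htop : topOrder (Ideal.span {g}) = topOrder I := topOrder_congr hsupp'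
  have hbottom : bottomOrder (Ideal.span {g}) = bottomOrder I := bottomOrder_congr hsupp'
  have hsorted : ∀ i j, i < j → (S' i).q * (S' j).p < (S' j).q * (S' i).p := by
    simpa only [hSp, hSq] using sorted
  have hcomplete : ∀ p q N, IsFace (Ideal.span {g}) p q N →
      ∃ i, (S' i).p = p ∧ (S' i).q = q ∧ (S' i).N = N := by
    simpa only [hSp, hSq, hSN] using fun p q N h => complete p q N ((isFace_congr hsupp').1 h)
  have hrange' : ∀ i, Set.range (Fin.append (σ i) (ρ i)) = {τ | τ.p = (S' i).p ∧ τ.q = (S' i).q ∧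
      MvPolynomial.eval ![1, τ.μ] (S' i).F = 0} := by
    simpa only [hSp, hSq] using hrange
  -- The old Newton maps carry the given trees; each new one carries an arrow `1`, for either
  -- stopping rule.
  have hglued : ∀ (cont : Ideal PS → Prop) (C : (i : Fin m) → Fin (n i) → Branch),
      (∀ i j, IsTreeOf cont ((σ i j).mapIdeal (Ideal.span {g})) (S i).N (C i j)) →
      ∀ i j, IsTreeOf cont ((Fin.append (σ i) (ρ i) j).mapIdeal (Ideal.span {g})) (S' i).N
        (Fin.append (C i) (fun _ => Branch.arrow 1) j) := by
    intro cont C hC i j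
    rw [hSN]
    refine Fin.addCases (fun j => ?_) (fun j => ?_) j
    · rw [Fin.append_left, Fin.append_left]
      exact hC i j
    · rw [Fin.append_right, Fin.append_right]
      exact IsTreeOf.halt _ _ _ (hρ i j)
  have hchain : ∀ (C : (i : Fin m) → Fin (n i) → Branch),
      Branch.chain (fun i => (S' i).q) (fun i => (S' i).p) (fun i => (S' i).N) (fun i => (S' i).d)
        (fun i => n i + (S i).d) (fun i j => (Fin.append (C i) (fun _ => Branch.arrow 1) j).shift
          ((S' i).p * (S' i).q)) (Branch.arrow (bottomOrder (Ideal.span {g}))) =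
      Branch.chain (fun i => (S i).q) (fun i => (S i).p) (fun i => (S i).N) (fun _ => 0)
        (fun i => n i + (S i).d) (fun i j => (Fin.append (C i) (fun _ => Branch.arrow 1) j).shift
          ((S i).p * (S i).q)) (Branch.arrow (bottomOrder I)) := by
    intro C
    simp only [hSp, hSq, hSN, hSd, hbottom]
  have hstep : ∀ (cont : Ideal PS → Prop), cont (Ideal.span {g}) →
      ∀ (C : (i : Fin m) → Fin (n i) → Branch),
      (∀ i j, IsTreeOf cont ((σ i j).mapIdeal (Ideal.span {g})) (S i).N (C i j)) →
      IsTreeOf cont (Ideal.span {g}) (topOrder I)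
        (Branch.chain (fun i => (S i).q) (fun i => (S i).p) (fun i => (S i).N) (fun _ => 0)
          (fun i => n i + (S i).d) (fun i j => (Fin.append (C i) (fun _ => Branch.arrow 1) j).shift
            ((S i).p * (S i).q)) (Branch.arrow (bottomOrder I))) := by
    intro cont hcont C hC
    rw [← htop, ← hchain]
    exact IsTreeOf.step _ hcont m S' hsorted hcomplete _ (fun i => Fin.append (σ i) (ρ i)) hinj
      hrange' _ (hglued cont C hC)
  have hadd : (Branch.chain (fun i => (S i).q) (fun i => (S i).p) (fun i => (S i).N)
      (fun i => (S i).d) n (fun i j => (B i j).shift ((S i).p * (S i).q))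
        (Branch.arrow (bottomOrder I))).addArrows =
      Branch.chain (fun i => (S i).q) (fun i => (S i).p) (fun i => (S i).N) (fun _ => 0)
        (fun i => n i + (S i).d) (fun i j =>
          (Fin.append (fun j => (B i j).addArrows) (fun _ => Branch.arrow 1) j).shift
            ((S i).p * (S i).q)) (Branch.arrow (bottomOrder I)) := by
    rw [Branch.addArrows_chain]
    congr 1
    funext i j
    rw [Branch.apply_append (Branch.shift ((S i).p * (S i).q))]
    simp only [Branch.addArrows_shift]
    rfl
  have hcontract : (Branch.chain (fun i => (S i).q) (fun i => (S i).p) (fun i => (S i).N)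
      (fun i => (S i).d) n (fun i j => (B i j).shift ((S i).p * (S i).q))
        (Branch.arrow (bottomOrder I))).addArrows.contractInner =
      Branch.chain (fun i => (S i).q) (fun i => (S i).p) (fun i => (S i).N) (fun _ => 0)
        (fun i => n i + (S i).d) (fun i j =>
          (Fin.append (fun j => (B i j).addArrows.contractInner.contractTop)
            (fun _ => Branch.arrow 1) j).shift ((S i).p * (S i).q))
        (Branch.arrow (bottomOrder I)) := by
    rw [hadd, Branch.contractInner_chain]
    congr 1
    funext i j
    rw [Branch.contractInner_shift, Branch.contractTop_shift,
      Branch.apply_append fun b : Branch => b.contractInner.contractTop]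
    rfl
  rw [hcontract, hadd]
  refine ⟨hstep _ trivial _ hB, ?_⟩
  rw [← hchain]
  -- If the combination acquires depth zero, its Newton tree stops here and the stage just built is
  -- the one that contracts. Otherwise the stage is not contractible and the step is a genuine one.
  by_cases hdz : IsDepthZero (Ideal.span {g})
  · obtain ⟨k, ν, hk⟩ := hdz
    have hlt : bottomOrder (Ideal.span {g}) < height (Ideal.span {g}) := by
      rw [hbottom, height_congr hsupp']
      by_contra hlt
      exact hd ⟨_, _, isMonomialLike_of_height_le hI (not_lt.1 hlt)⟩
    rw [contractTop_chain_of_isMonomialLike hr hk hlt S' hsorted hcomplete _ hinj hrange'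
      (hglued _ _ hB'), ← htop, hk.topOrder_eq.1]
    exact IsTreeOf.halt _ k ν hk
  · have hne : Ideal.span {g} ≠ ⊥ :=
      ne_bot_of_mem_idealSupport (hsupp'.symm ▸ expo_height_mem hI)
    rw [contractTop_chain_of_not_isDepthZero hr hne hdz S' hcomplete _ hrange' (hglued _ _ hB'),
      hchain]
    exact hstep _ hdz _ hB'

/-- The condition on `c` must be chosen before the tree, so the conclusion ranges over all trees of
`I` while the induction runs along one of them. Other trees differ in the listing of the edges and
in the chosen face data, and pass through the same transforms. -/
theorem generic_trees {I : Ideal PS} {t : ℕ} {B : Branch}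
    (h : IsTreeOf (fun J => ¬ IsDepthZero J) I t B) : ∀ {r : ℕ} (f : Fin r → PS),
    I = Ideal.span (Set.range f) → I ≠ ⊥ →
    Generic fun c => ∀ t' B', IsTreeOf (fun J => ¬ IsDepthZero J) I t' B' →
      IsTreeOf (fun _ => True) (Ideal.span {∑ i, c i • f i}) t' B'.addArrows ∧
      IsTreeOf (fun J => ¬ IsDepthZero J) (Ideal.span {∑ i, c i • f i}) t'
        B'.addArrows.contractInner.contractTop := by
  induction h with
  | halt I k ν hI =>
    intro r f hf hne
    obtain ⟨h, hh, hIeq⟩ := id hI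
    have hG : X 0 ^ k * (X 1 + h) ^ ν ≠ 0 := by
      rintro h0
      rw [h0, Ideal.span_singleton_eq_bot.2 rfl] at hIeq
      exact hne hIeq
    refine (generic_span_eq hG (hf.symm.trans hIeq)).mono fun c hc t' B' hB' => ?_
    obtain ⟨ht, hb⟩ := hB'.eq_arrow hI
    rw [hc, ← hIeq, ht, hb]
    exact ⟨IsTreeOf.halt _ _ _ hI, IsTreeOf.halt _ _ _ hI⟩
  | step I hd m S sorted complete n σ injective range_eq B glued ih =>
    intro r f hf hne
    have Φ := fun i => ((S i).nonempty_normalForm hf).some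
    have hih : ∀ i j, Generic fun c => ∀ t' B',
        IsTreeOf (fun J => ¬ IsDepthZero J) ((σ i j).mapIdeal I) t' B' →
        IsTreeOf (fun _ => True) (Ideal.span {∑ l, c l • (σ i j).toAlgHom (f l)}) t' B'.addArrows ∧
        IsTreeOf (fun J => ¬ IsDepthZero J) (Ideal.span {∑ l, c l • (σ i j).toAlgHom (f l)}) t'
          B'.addArrows.contractInner.contractTop := by
      intro i j
      have hτ : σ i j ∈ Set.range (σ i) := ⟨j, rfl⟩
      rw [range_eq] at hτ
      refine ih i j _ (by rw [hf, NewtonMap.mapIdeal_span]) ?_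
      have := ((Φ i).topOrder_mapIdeal (fun l => (S i).le_filtration
        (hf ▸ Ideal.subset_span ⟨l, rfl⟩)) (σ i j) hτ.1 hτ.2.1).1
      rw [← hf] at this
      exact ne_bot_of_mem_idealSupport this
    have hgen : Generic fun c => idealSupport (Ideal.span {∑ i, c i • f i}) =
        idealSupport (Ideal.span (Set.range f)) := exists_generic_idealSupport f
    refine ((hgen.and (Generic.forall_fintype fun i => (Φ i).generic_isGoodFor)).and
      (Generic.forall_fintype fun i => Generic.forall_fintype (hih i))).mono
      fun c ⟨⟨hsupp, hgood⟩, hrec⟩ t' B' hB' => ?_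
    cases hB' with
    | halt _ _ _ hk => exact absurd ⟨_, _, hk⟩ hd
    | step _ _ m' S' sorted' complete' n' σ' injective' range_eq' B' glued' =>
      -- Each face of the second tree is a face of the first, with the same face polynomial, hence
      -- with the same Newton maps.
      have hmatch : ∀ i', ∃ i, ((S i).p = (S' i').p ∧ (S i).q = (S' i').q ∧ (S i).N = (S' i').N) ∧
          (S i).F = (S' i').F ∧ ∃ Ψ : NormalForm (S' i').p (S' i').q (S' i').N (S' i').d (S' i').F f,
            Ψ.IsGoodFor c := by
        intro i'
        obtain ⟨i, h1, h2, h3⟩ := complete _ _ _ (S' i').isFace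
        exact ⟨i, ⟨h1, h2, h3⟩, (Φ i).eq_and_isGoodFor (S i).isFace.1 h1 h2 h3
          ((S' i').nonempty_normalForm hf).some (hgood i)⟩
      have htrees : ∀ i' j', IsTreeOf (fun _ => True)
          ((σ' i' j').mapIdeal (Ideal.span {∑ i, c i • f i})) (S' i').N (B' i' j').addArrows ∧
          IsTreeOf (fun J => ¬ IsDepthZero J)
            ((σ' i' j').mapIdeal (Ideal.span {∑ i, c i • f i})) (S' i').N
            (B' i' j').addArrows.contractInner.contractTop := by
        intro i' j'
        obtain ⟨i, ⟨h1, h2, -⟩, h4, -⟩ := hmatch i'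
        have hτ : σ' i' j' ∈ Set.range (σ' i') := ⟨j', rfl⟩
        rw [range_eq', ← h1, ← h2, ← h4, ← range_eq] at hτ
        obtain ⟨j, hj⟩ := hτ
        rw [NewtonMap.mapIdeal_span_sum, ← hj]
        exact hrec i j _ _ (hj ▸ glued' i' j')
      exact trees_of_step hf hne hd hsupp S' sorted' complete'
        (fun i' => (hmatch i').choose_spec.2.2) σ' injective' range_eq'
        (fun i j => (htrees i j).1) (fun i j => (htrees i j).2)

end NewtonTrees

/-! ### The proposition -/

theorem mainTheorem11 (r : ℕ) (f : Fin r → NewtonTrees.PS)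
    (hf : ¬ (Ideal.span (Set.range f)).IsPrincipal) :
    (∃ T, NewtonTrees.IsNewtonTree (Ideal.span (Set.range f)) T) ∧
    ∃ P : MvPolynomial (Fin r) ℂ, P ≠ 0 ∧
      ∀ c : Fin r → ℂ, MvPolynomial.eval c P ≠ 0 →
        ∀ T, NewtonTrees.IsNewtonTree (Ideal.span (Set.range f)) T →
          NewtonTrees.IsExtendedNewtonTree (Ideal.span {∑ i, c i • f i}) T.addArrows ∧
          NewtonTrees.IsNewtonTree (Ideal.span {∑ i, c i • f i}) T.addArrows.contract := by
  have hI : Ideal.span (Set.range f) ≠ ⊥ := fun h => hf (h ▸ bot_isPrincipal)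
  obtain ⟨B, hB⟩ := NewtonTrees.exists_isTreeOf _ f rfl hI
  obtain ⟨P, hP, hgen⟩ := NewtonTrees.generic_trees hB f rfl hI
  exact ⟨⟨⟨_, B⟩, hB⟩, P, hP, fun c hc T hT => hgen c hc T.top T.branch hT⟩
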